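/- **Setting.** Let $U\subset\mathbb R^n$ be open and bounded, and let $K\subset\overline U$ be closed. For $\delta>0$ let $K_\delta$ be the open $\delta$-neighbourhood of $K$ and $V:=K_\delta\cap U$. The spaces $W^{1,\infty}(U,\mathbb R^m)$ and $W^{1,\infty}(V,\mathbb R^m)$ carry the norm $\max\{\|\varphi\|_\infty,\|D\varphi\|_\infty\}$ (Euclidean norms on $\mathbb R^m$ and $\mathbb R^{mn}$). A functional $f^*\in W^{1,\infty}(U,\mathbb R^m)^*$ is a *trace on $K$* if $f^*(\varphi)=0$ whenever $\varphi=0$ a.e. on $K_r\cap U$ for some $r>0$. Let $ba(U,\mathcal B,\mathcal L^n)$ be the space of bounded finitely additive real set functions on the Borel subsets of $U$ that vanish on $\mathcal L^n$-null sets. For a vector $\nu$ of such measures, $|\nu|(A)$ is the supremum of $\sum_j|\nu(A_j)|$ over finite Borel partitions $(A_j)$ of $A$, $\|\nu\|=|\nu|(U)$, and $\operatorname{core}\nu$ is the set of all $x\in\mathbb R^n$ with $|\nu|(O\cap U)>0$ for every open $O\ni x$. Integrals of vector functions against vector measures of the same length are sums of the componentwise integrals. Let $\chi$ be the tent function: $\chi=1$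 on $K_{\delta/2}$, $\chi=2-\frac2\delta\operatorname{dist}(\cdot,K)$ on $K_\delta\setminus K_{\delta/2}$, $\chi=0$ outside $K_\delta$. Put $$S_\delta(f^*):=\sup\{f^*(\chi\varphi):\varphi\in W^{1,\infty}(U,\mathbb R^m),\ \|\varphi|_V\|_{W^{1,\infty}(V)}\le1\}.$$ *Case (L)* holds for $K,\delta$ if $\iota(\varphi)=([\varphi]_K,D\varphi)$, defined on $W^{1,\infty}(V,\mathbb R^m)$, is injective with continuous inverse on its image, where the image has the norm $\max\{\|\varphi\|_K,\|D\varphi\|_\infty\}$ and $\|\varphi\|_K=\lim_{r\downarrow0}\|\varphi\|_{L^\infty(K_r\cap V)}$ is the norm of the class $[\varphi]_K$ modulo $\{\|\cdot\|_K=0\}$. *Case (C)* holds if every $\varphi\in W^{1,\infty}(V,\mathbb R^m)$ extends continuously up to $K$ (to $V\cup K$) and $\iota(\varphi)=(\varphi|_K,D\varphi)$ is injective with continuous inverse on its image, where the image has the norm $\max\{\sup_K|\varphi|,\|D\varphi\|_\infty\}$. The analogous *case (G)*, with $\iota(\varphi)=(\varphi,D\varphi)$, always holds. **Theorem.** Let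 $f^*\in W^{1,\infty}(U,\mathbb R^m)^*$ be a trace on $K$ and let $\delta>0$. There are $\lambda\in ba(U,\mathcal B,\mathcal L^n)^m$ and $\mu\in ba(U,\mathcal B,\mathcal L^n)^{mn}$ with $\operatorname{core}\lambda,\operatorname{core}\mu\subset\overline V$, $$f^*(\varphi)=\int_V\varphi\,d\lambda+\int_V D\varphi\,d\mu\quad\text{for all }\varphi\in W^{1,\infty}(U,\mathbb R^m),\tag{1}$$ $$\|\lambda\|+\|\mu\|=|\lambda|(V)+|\mu|(V)\le c\,S_\delta(f^*),\tag{2}$$ where $c\ge1$ is a constant. More precisely: - (G) In general $\lambda,\mu$ can be chosen such that equality holds in (2) with $c=1$. - (L) In case (L), $\lambda,\mu$ can be chosen such that (1) and (2) hold with $c=\max\{1,\|\iota^{-1}\|\}$, $\operatorname{core}\lambda\subset K$, and for every open $O\supset K$ and all $\varphi\in W^{1,\infty}(U,\mathbb R^m)$ $$f^*(\varphi)=\int_{O\cap U}\varphi\,d\lambda+\int_V D\varphi\,d\mu.$$ - (C) In case (C), $\lambda,\mu$ can be chosen such that (1) and (2) hold with $c=\max\{1,\|\iota^{-1}\|\}$,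 $\operatorname{core}\lambda\subset K$, and $\lambda$ corresponds to an $\mathbb R^m$-valued Radon measure $\sigma$ supported in $K$: $|\sigma|(K)=\|\lambda\|$, $\int_U g\,d\lambda=\int_K g\,d\sigma$ for all $g\in C(\overline U,\mathbb R^m)$, and $$f^*(\varphi)=\int_K\varphi\,d\sigma+\int_V D\varphi\,d\mu\quad\text{for all }\varphi\in W^{1,\infty}(U,\mathbb R^m),$$ where $\varphi$ on $K$ denotes the continuous extension of $\varphi|_V$ up to $K$. -/

import Mathlib

open MeasureTheory Set Filter Topology
open scoped ENNReal

noncomputable section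

namespace TraceRep

/-- The Euclidean space `ℝⁿ`. -/
abbrev Euc (n : ℕ) := EuclideanSpace ℝ (Fin n)

/-- The space `ℝᵐⁿ` of `m × n` matrices, with the Euclidean norm of an `mn`-vector. -/
abbrev EucMat (m n : ℕ) := EuclideanSpace ℝ (Fin m × Fin n)

/-! ### Bounded finitely additive measures -/

section FinitelyAdditive

variable {α : Type*} [MeasurableSpace α]

/-- Total variation `|ν|(A)` of a vector-valued set function: the supremum of `∑ⱼ ‖ν (Pⱼ)‖` over
all finite partitions of `A` into measurable sets. -/
def variation {F : Type*} [NormedAddCommGroup F] (ν : Set α → F) (A : Set α) : ℝ≥0∞ :=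
  ⨆ (k : ℕ) (P : Fin k → Set α) (_ : ∀ j, MeasurableSet (P j))
    (_ : Pairwise fun i j => Disjoint (P i) (P j)) (_ : ⋃ j, P j = A), ∑ j, ‖ν (P j)‖ₑ

/-- `ba(U, 𝓑(U), μ)`: the bounded, finitely additive, real set functions on the measurable subsets
of `U` that vanish on the measurable sets `A ⊆ U` with `μ A = 0` (weak absolute continuity). The set
function is extended by the value `0` to all sets that are not measurable subsets of `U`. -/
structure Ba (U : Set α) (μ : Measure α) where
  /-- the set function -/
  toFun : Set α → ℝ
  eq_zero_of_not : ∀ A, ¬ (MeasurableSet A ∧ A ⊆ U) → toFun A = 0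
  add : ∀ A B, MeasurableSet A → MeasurableSet B → A ⊆ U → B ⊆ U → Disjoint A B →
    toFun (A ∪ B) = toFun A + toFun B
  bounded : ∃ C : ℝ, ∀ A, |toFun A| ≤ C
  wac : ∀ A, MeasurableSet A → A ⊆ U → μ A = 0 → toFun A = 0

variable {U : Set α} {μ : Measure α}

/-- The outer measure `|ν|^*(S)` associated to the total variation of `ν`, for `S ⊆ U`. -/
def outerVariation (ν : Ba U μ) (S : Set α) : ℝ≥0∞ :=
  ⨅ (B : Set α) (_ : MeasurableSet B) (_ : B ⊆ U) (_ : S ⊆ B), variation ν.toFun B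

/-- `∫_U h dν` for a simple function `h`. -/
def simpleIntegral (ν : Ba U μ) (h : SimpleFunc α ℝ) : ℝ :=
  ∑ c ∈ h.range, c * ν.toFun (h ⁻¹' {c} ∩ U)

/-- `∫_U |h| d|ν|` for a simple function `h`. -/
def simpleAbsIntegral (ν : Ba U μ) (h : SimpleFunc α ℝ) : ℝ≥0∞ :=
  ∑ c ∈ h.range, ‖c‖ₑ * variation ν.toFun (h ⁻¹' {c} ∩ U)

/-- `f` is `ν`-integrable on `U` with `∫_U f dν = I`: there is a determining sequence of simple
functions which converges to `f` in measure, is Cauchy in the mean with respect to `|ν|`, and whose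
integrals converge to `I`. -/
def HasIntegral (ν : Ba U μ) (f : α → ℝ) (I : ℝ) : Prop :=
  ∃ h : ℕ → SimpleFunc α ℝ,
    (∀ ε : ℝ, 0 < ε →
      Tendsto (fun k => outerVariation ν {x | x ∈ U ∧ ε < |h k x - f x|}) atTop (𝓝 0)) ∧
    Tendsto (fun p : ℕ × ℕ => simpleAbsIntegral ν (h p.1 - h p.2)) atTop (𝓝 0) ∧
    Tendsto (fun k => simpleIntegral ν (h k)) atTop (𝓝 I)

variable {ι : Type*} [Fintype ι]

/-- For a vector measure `ν` and a vector-valued `F`: every component `Fᵢ` is `νᵢ`-integrable on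
`A ⊆ U`, and `∫_A F dν = ∑ᵢ ∫_A Fᵢ dνᵢ = I`. -/
def HasVecIntegral (ν : ι → Ba U μ) (A : Set α) (F : α → EuclideanSpace ℝ ι) (I : ℝ) : Prop :=
  ∃ J : ι → ℝ, (∀ i, HasIntegral (ν i) (A.indicator fun x => F x i) (J i)) ∧ I = ∑ i, J i

/-- The total variation `|ν|(A)` of a vector measure (with the Euclidean norm on its values). -/
def vecVariation (ν : ι → Ba U μ) (A : Set α) : ℝ≥0∞ :=
  variation (fun B => (WithLp.toLp 2 fun i => (ν i).toFun B : EuclideanSpace ℝ ι)) A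

/-- The norm `‖ν‖ = |ν|(U)` of a vector measure. -/
def baNorm (ν : ι → Ba U μ) : ℝ≥0∞ := vecVariation ν U

/-- The core of a vector measure on a subset `U` of a topological space: the points all of whose
open neighbourhoods `O` satisfy `|ν|(O ∩ U) > 0`. -/
def core [TopologicalSpace α] (ν : ι → Ba U μ) : Set α :=
  {x | ∀ O : Set α, IsOpen O → x ∈ O → 0 < vecVariation ν (O ∩ U)}

end FinitelyAdditive

/-! ### The Sobolev space `W^{1,∞}` -/

variable {n m : ℕ}

lemma integrable_mul_test {V : Set (Euc n)} {ι : Type*} [Fintype ι]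
    (p : Lp (EuclideanSpace ℝ ι) ⊤ (volume.restrict V)) (i : ι) {θ : Euc n → ℝ}
    (hθ : Continuous θ) (hc : HasCompactSupport θ) :
    Integrable (fun x => p x i * θ x) (volume.restrict V) := by
  have h1 : Integrable θ (volume.restrict V) := (hθ.integrable_of_hasCompactSupport hc).restrict
  have hp := Lp.memLp p
  refine h1.bdd_mul (c := (eLpNorm p ⊤ (volume.restrict V)).toReal) ?_ ?_
  · exact (EuclideanSpace.proj (𝕜 := ℝ) i).continuous.comp_aestronglyMeasurable hp.1
  · have h2 := ae_le_eLpNormEssSup (f := p) (μ := volume.restrict V)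
    filter_upwards [h2] with x hx
    refine (PiLp.norm_apply_le (p x) i).trans ?_
    have h3 := ENNReal.toReal_mono hp.2.ne (by simpa [eLpNorm_exponent_top] using hx)
    simpa using h3

/-- The space `W^{1,∞}(V, ℝᵐ)`. An element is a pair `(φ, Dφ)` of `φ ∈ L^∞(V, ℝᵐ)` and its weak
derivative `Dφ ∈ L^∞(V, ℝᵐⁿ)` (for open `V` the second entry is determined by the first). As a
subspace of the product it carries the norm `max {‖φ‖_∞, ‖Dφ‖_∞}`. -/
def W1Inf (V : Set (Euc n)) (m : ℕ) :
    Submodule ℝ (Lp (Euc m) ⊤ (volume.restrict V) × Lp (EucMat m n) ⊤ (volume.restrict V)) where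
  carrier := {p | ∀ (i : Fin m) (j : Fin n) (η : Euc n → ℝ),
    ContDiff ℝ ((⊤ : ℕ∞) : WithTop ℕ∞) η → HasCompactSupport η → tsupport η ⊆ V →
    ∫ x in V, p.1 x i * fderiv ℝ η x (EuclideanSpace.single j 1) = - ∫ x in V, p.2 x (i, j) * η x}
  add_mem' := by
    intro p q hp hq i j η hη hc hs
    have hD : Continuous fun x => fderiv ℝ η x (EuclideanSpace.single j 1) :=
      (hη.continuous_fderiv (by simp)).clm_apply continuous_const
    have hDc : HasCompactSupport fun x => fderiv ℝ η x (EuclideanSpace.single j 1) :=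
      hc.fderiv_apply ℝ _
    have e1 : ∫ x in V, (p + q).1 x i * fderiv ℝ η x (EuclideanSpace.single j 1) =
        ∫ x in V, (p.1 x i * fderiv ℝ η x (EuclideanSpace.single j 1) +
          q.1 x i * fderiv ℝ η x (EuclideanSpace.single j 1)) := by
      refine integral_congr_ae ?_
      filter_upwards [Lp.coeFn_add p.1 q.1] with x hx
      have hi : (p + q).1 x i = p.1 x i + q.1 x i := congrArg (fun v : Euc m => v i) hx
      rw [hi, add_mul]
    have e2 : ∫ x in V, (p + q).2 x (i, j) * η x =
        ∫ x in V, (p.2 x (i, j) * η x + q.2 x (i, j) * η x) := by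
      refine integral_congr_ae ?_
      filter_upwards [Lp.coeFn_add p.2 q.2] with x hx
      have hi : (p + q).2 x (i, j) = p.2 x (i, j) + q.2 x (i, j) :=
        congrArg (fun v : EucMat m n => v (i, j)) hx
      rw [hi, add_mul]
    rw [e1, e2, integral_add (integrable_mul_test p.1 i hD hDc) (integrable_mul_test q.1 i hD hDc),
      integral_add (integrable_mul_test p.2 (i, j) hη.continuous hc)
        (integrable_mul_test q.2 (i, j) hη.continuous hc), hp i j η hη hc hs, hq i j η hη hc hs]
    ring
  zero_mem' := by
    intro i j η hη hc hs
    have e1 : ∫ x in V, (0 : Lp (Euc m) ⊤ (volume.restrict V)) x i *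
        fderiv ℝ η x (EuclideanSpace.single j 1) = 0 := by
      refine integral_eq_zero_of_ae ?_
      filter_upwards [Lp.coeFn_zero (Euc m) ⊤ (volume.restrict V)] with x hx
      have hi : (0 : Lp (Euc m) ⊤ (volume.restrict V)) x i = 0 :=
        congrArg (fun v : Euc m => v i) hx
      rw [hi, zero_mul]
      rfl
    have e2 : ∫ x in V, (0 : Lp (EucMat m n) ⊤ (volume.restrict V)) x (i, j) * η x = 0 := by
      refine integral_eq_zero_of_ae ?_
      filter_upwards [Lp.coeFn_zero (EucMat m n) ⊤ (volume.restrict V)] with x hx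
      have hi : (0 : Lp (EucMat m n) ⊤ (volume.restrict V)) x (i, j) = 0 :=
        congrArg (fun v : EucMat m n => v (i, j)) hx
      rw [hi, zero_mul]
      rfl
    exact e1.trans (by rw [Prod.snd_zero, e2, neg_zero])
  smul_mem' := by
    intro c p hp i j η hη hc hs
    have e1 : ∫ x in V, (c • p).1 x i * fderiv ℝ η x (EuclideanSpace.single j 1) =
        ∫ x in V, c * (p.1 x i * fderiv ℝ η x (EuclideanSpace.single j 1)) := by
      refine integral_congr_ae ?_
      filter_upwards [Lp.coeFn_smul c p.1] with x hx
      have hi : (c • p).1 x i = c * p.1 x i := congrArg (fun v : Euc m => v i) hx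
      rw [hi, mul_assoc]
    have e2 : ∫ x in V, (c • p).2 x (i, j) * η x = ∫ x in V, c * (p.2 x (i, j) * η x) := by
      refine integral_congr_ae ?_
      filter_upwards [Lp.coeFn_smul c p.2] with x hx
      have hi : (c • p).2 x (i, j) = c * p.2 x (i, j) :=
        congrArg (fun v : EucMat m n => v (i, j)) hx
      rw [hi, mul_assoc]
    rw [e1, e2, integral_const_mul, integral_const_mul, hp i j η hη hc hs]
    ring

/-- A representative of `φ ∈ W^{1,∞}(V, ℝᵐ)`. -/
def val {V : Set (Euc n)} (φ : W1Inf V m) : Euc n → Euc m := φ.1.1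

/-- A representative of the weak derivative `Dφ` of `φ ∈ W^{1,∞}(V, ℝᵐ)`. -/
def grad {V : Set (Euc n)} (φ : W1Inf V m) : Euc n → EucMat m n := φ.1.2

/-! ### Traces and the localized functional -/

/-- The set `K_δ ∩ U`, where `K_δ` is the open `δ`-neighbourhood of `K`. -/
def nbhd (U K : Set (Euc n)) (δ : ℝ) : Set (Euc n) := Metric.thickening δ K ∩ U

/-- `f` is a trace on `K` over `W^{1,∞}(U, ℝᵐ)`: it vanishes on all `φ` that vanish on `K_δ ∩ U`
for some `δ > 0`. -/
def IsTrace {U : Set (Euc n)} (K : Set (Euc n)) (f : StrongDual ℝ (W1Inf U m)) : Prop :=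
  ∀ φ : W1Inf U m, (∃ δ : ℝ, 0 < δ ∧ ∀ᵐ x ∂(volume.restrict (nbhd U K δ)), val φ x = 0) → f φ = 0

open Classical in
/-- The tent function of `K` and `δ`: it is `1` on `K_{δ/2}`, `0` outside `K_δ`, and
`2 - (2/δ) dist(·, K)` in between. -/
def tent (K : Set (Euc n)) (δ : ℝ) (x : Euc n) : ℝ :=
  if x ∈ Metric.thickening (δ / 2) K then 1
  else if x ∈ Metric.thickening δ K then 2 - 2 / δ * Metric.infDist x K
  else 0

/-- `sup { f(χφ) : φ ∈ W^{1,∞}(U, ℝᵐ), ‖φ|_{K_δ ∩ U}‖_{W^{1,∞}} ≤ 1 }`, where `χ` is the tent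
function of `K` and `δ`; here `ψ` is the element `χφ` of `W^{1,∞}(U, ℝᵐ)`. -/
def localNorm {U : Set (Euc n)} (K : Set (Euc n)) (δ : ℝ) (f : StrongDual ℝ (W1Inf U m)) : ℝ :=
  sSup {r : ℝ | ∃ φ ψ : W1Inf U m,
    eLpNorm (val φ) ⊤ (volume.restrict (nbhd U K δ)) ≤ 1 ∧
    eLpNorm (grad φ) ⊤ (volume.restrict (nbhd U K δ)) ≤ 1 ∧
    (∀ᵐ x ∂(volume.restrict U), val ψ x = tent K δ x • val φ x) ∧ r = f ψ}

/-! ### The Lebesgue case (L) and the continuity case (C) -/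

/-- The seminorm `‖φ‖_K = inf_{r > 0} ‖φ‖_{L^∞(K_r ∩ V)}` on `L^∞(V, ℝᵐ)`, i.e. the norm of the
class of `φ` in the factor space `L^∞_K(V, ℝᵐ)`. -/
def seminormK (V K : Set (Euc n)) (φ : Euc n → Euc m) : ℝ :=
  (⨅ (r : ℝ) (_ : 0 < r), eLpNorm φ ⊤ (volume.restrict (nbhd V K r))).toReal

/-- With `V = K_δ ∩ U` and `ι(φ) = ([φ]_K, Dφ) ∈ L^∞_K(V, ℝᵐ) × L^∞(V, ℝᵐⁿ)` on `W^{1,∞}(V, ℝᵐ)`: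
`‖φ‖ ≤ C ‖ι(φ)‖` for all `φ`, i.e. `ι` is invertible on its image with `‖ι⁻¹‖ ≤ C`. -/
def InvBoundL (U K : Set (Euc n)) (δ : ℝ) (m : ℕ) (C : ℝ) : Prop :=
  0 ≤ C ∧ ∀ φ : W1Inf (nbhd U K δ) m, ‖φ‖ ≤ C * max (seminormK (nbhd U K δ) K (val φ)) ‖φ.1.2‖

/-- Case (L): `ι` is injective with a continuous (that is, bounded) inverse on its image. -/
def CaseL (U K : Set (Euc n)) (δ : ℝ) (m : ℕ) : Prop := ∃ C, InvBoundL U K δ m C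

/-- The operator norm `‖ι⁻¹‖` in case (L). -/
def invNormL (U K : Set (Euc n)) (δ : ℝ) (m : ℕ) : ℝ := sInf {C | InvBoundL U K δ m C}

/-- `g` is a continuous extension of the class `φ` (of functions on `V`) up to `K`. -/
def IsContExt (V K : Set (Euc n)) (φ g : Euc n → Euc m) : Prop :=
  ContinuousOn g (V ∪ K) ∧ ∀ᵐ x ∂(volume.restrict V), g x = φ x

/-- With `V = K_δ ∩ U` and `ι(φ) = (φ|_K, Dφ) ∈ C(K, ℝᵐ) × L^∞(V, ℝᵐⁿ)` on `W^{1,∞}(V, ℝᵐ)`, where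
`φ|_K = g|_K` for the continuous extension `g` of `φ` up to `K`: `‖φ‖ ≤ C ‖ι(φ)‖` for all `φ`, i.e.
`ι` is invertible on its image with `‖ι⁻¹‖ ≤ C`. -/
def InvBoundC (U K : Set (Euc n)) (δ : ℝ) (m : ℕ) (C : ℝ) : Prop :=
  0 ≤ C ∧ ∀ (φ : W1Inf (nbhd U K δ) m) (g : Euc n → Euc m), IsContExt (nbhd U K δ) K (val φ) g →
    ‖φ‖ ≤ C * max (⨆ x : K, ‖g x‖) ‖φ.1.2‖

/-- Case (C): all `φ ∈ W^{1,∞}(K_δ ∩ U, ℝᵐ)` are continuously extendable up to `K`, and `ι` is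
injective with a continuous (that is, bounded) inverse on its image. -/
def CaseC (U K : Set (Euc n)) (δ : ℝ) (m : ℕ) : Prop :=
  (∀ φ : W1Inf (nbhd U K δ) m, ∃ g, IsContExt (nbhd U K δ) K (val φ) g) ∧
    ∃ C, InvBoundC U K δ m C

/-- The operator norm `‖ι⁻¹‖` in case (C). -/
def invNormC (U K : Set (Euc n)) (δ : ℝ) (m : ℕ) : ℝ := sInf {C | InvBoundC U K δ m C}

/-! ### Representing measures -/

/-- The vector measures `lam ∈ ba(U, 𝓑(U), 𝓛ⁿ)ᵐ` and `mu ∈ ba(U, 𝓑(U), 𝓛ⁿ)ᵐⁿ` have their cores in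
the closure of `V = K_δ ∩ U`, they represent `f` in the form `f(φ) = ∫_V φ dlam + ∫_V Dφ dmu`, and
their norms are the total variations on `V`. -/
def Represents {U : Set (Euc n)} (K : Set (Euc n)) (δ : ℝ) (f : StrongDual ℝ (W1Inf U m))
    (lam : Fin m → Ba U (volume : Measure (Euc n)))
    (mu : Fin m × Fin n → Ba U (volume : Measure (Euc n))) : Prop :=
  core lam ⊆ closure (nbhd U K δ) ∧ core mu ⊆ closure (nbhd U K δ) ∧
  (∀ φ : W1Inf U m, ∃ a b : ℝ, HasVecIntegral lam (nbhd U K δ) (val φ) a ∧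
    HasVecIntegral mu (nbhd U K δ) (grad φ) b ∧ f φ = a + b) ∧
  baNorm lam + baNorm mu = vecVariation lam (nbhd U K δ) + vecVariation mu (nbhd U K δ)

end TraceRep

end

noncomputable section

namespace TraceRep

/-! ### Finitely additive measures given by functionals on `L^∞` -/

/-! The space `W1Inf U m` is a subspace of `L^∞ × L^∞` through `φ ↦ (φ, Dφ)`. The proof bounds `f`
on it by a seminorm that sees only `V = K_δ ∩ U`, extends by Hahn–Banach, and reads the two
components of the extension as finitely additive measures.

The bound comes from the trace property. The difference `χφ - φ` vanishes on `K_{δ/2} ∩ U`, so `f(φ)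
= f(χφ)`, and by homogeneity `f(φ) ≤ S_δ max(‖φ‖_{L^∞(V)}, ‖Dφ‖_{L^∞(V)})` (`exists_tent_mul`,
`apply_le_localNorm`). That `χφ` belongs to `W^{1,∞}` is the product rule with a Lipschitz factor;
it requires testing weak derivatives against Lipschitz functions, which is done by mollification.

Hahn–Banach on the product gives functionals `F`, `G` on `L^∞`, and `‖F‖ + ‖G‖` is bounded by the
constant because the dual of a maximum norm is a sum norm (`exists_functionals`). A functional on
`L^∞` is the same as the vector measure `A ↦ (F(1_A eᵢ))ᵢ`, with `‖F‖` equal to its total variation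
(`baNorm_ofDual`). A domination `|F x| ≤ c ‖x‖_K` says that `F` ignores functions vanishing near
`K`; it yields the location of the core and the freedom to choose the domain of integration. In the
general case the converse bound `S_δ ≤ ‖F‖ + ‖G‖` follows by testing, hence equality.

Case (L) is the same extension with the seminorm `‖·‖_K` in the first component, at the cost of the
factor `‖ι⁻¹‖`. Case (C) implies the bound of case (L) with the same constant, since the supremum
over `K` of a continuous extension is at most `‖φ‖_K`. There `F` is determined on continuous
functions by their values on `K`, so a vector-valued Riesz theorem (`exists_density`) gives `σ`. As
`‖F‖` may exceed `|σ|(K)`, `F` is replaced by another Hahn–Banach extension `F'` of its restriction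
to continuous functions, with norm exactly `|σ|(K)` (`exists_radon_functional`); the representation
of `f` survives because every `φ` on `V` extends continuously to `K`. -/

lemma norm_sum_indicator_le {α β E : Type*} [NormedAddCommGroup E] (s : Finset β) {P : β → Set α}
    (hd : (s : Set β).PairwiseDisjoint P) {v : β → E} {C : ℝ} (hC : 0 ≤ C)
    (hv : ∀ b ∈ s, ‖v b‖ ≤ C) (x : α) : ‖∑ b ∈ s, (P b).indicator (fun _ => v b) x‖ ≤ C := by
  by_cases h : ∃ b ∈ s, x ∈ P b
  · obtain ⟨b, hb, hx⟩ := h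
    rw [Finset.sum_eq_single b, indicator_of_mem hx]
    · exact hv b hb
    · intro c hc hcb
      exact indicator_of_notMem
        (fun hxc => (disjoint_left.1 (hd (Finset.mem_coe.2 hc) (Finset.mem_coe.2 hb) hcb)) hxc hx) _
    · exact fun h => absurd hb h
  · push Not at h
    rw [Finset.sum_eq_zero fun b hb => indicator_of_notMem (h b hb) _]
    simpa using hC

section OfDual

/-- The range is totally bounded, so rounding to a finite net works. The approximation has to be
uniform, because finitely additive integrals have no dominated convergence theorem. -/
lemma exists_simpleFunc_norm_sub_le {α E : Type*} [MeasurableSpace α] [NormedAddCommGroup E]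
    [ProperSpace E] [MeasurableSpace E] [BorelSpace E] {f : α → E} (hf : StronglyMeasurable f)
    {C : ℝ} (hC : ∀ x, ‖f x‖ ≤ C) {ε : ℝ} (hε : 0 < ε) :
    ∃ h : SimpleFunc α E, ∀ x, ‖h x - f x‖ ≤ ε := by
  have htb : TotallyBounded (Metric.closedBall (0 : E) C) :=
    (isCompact_closedBall 0 C).totallyBounded
  obtain ⟨t, htf, ht⟩ := Metric.totallyBounded_iff.1 htb ε hε
  rcases isEmpty_or_nonempty α with h | ⟨⟨x0⟩⟩
  · exact ⟨0, fun x => isEmptyElim x⟩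
  obtain ⟨y0, hy0, -⟩ := mem_iUnion₂.1 (ht (mem_closedBall_zero_iff.2 (hC x0)))
  -- `SimpleFunc.nearestPt` selects among the first terms of a sequence, so the finite net is
  -- enumerated as `e 0, …, e N`.
  obtain ⟨N, e, he⟩ : ∃ (N : ℕ) (e : ℕ → E), ∀ y ∈ t, ∃ k ≤ N, e k = y := by
    obtain ⟨e, he⟩ := htf.countable.exists_eq_range ⟨y0, hy0⟩
    have : ∀ y : t, ∃ k, e k = y := fun y => he.subset y.2
    choose k hk using this
    have := htf.to_subtype
    obtain ⟨N, hN⟩ := (Set.finite_range k).bddAbove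
    exact ⟨N, e, fun y hy => ⟨k ⟨y, hy⟩, hN ⟨_, rfl⟩, hk _⟩⟩
  refine ⟨(SimpleFunc.nearestPt e N).comp f hf.measurable, fun x => ?_⟩
  obtain ⟨y, hy, hxy⟩ := mem_iUnion₂.1 (ht (mem_closedBall_zero_iff.2 (hC x)))
  obtain ⟨k, hk, rfl⟩ := he y hy
  have h1 := SimpleFunc.edist_nearestPt_le e (f x) hk
  have h2 : edist (SimpleFunc.nearestPt e N (f x)) (f x) ≤ ENNReal.ofReal ε := by
    refine h1.trans ?_
    rw [edist_comm, edist_dist]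
    exact ENNReal.ofReal_le_ofReal (Metric.mem_ball.1 hxy).le
  rw [edist_dist, ENNReal.ofReal_le_ofReal_iff hε.le, dist_eq_norm] at h2
  simpa using h2

/-! ### Total variation of set functions -/

variable {α : Type*} [MeasurableSpace α]

lemma enorm_sum_le_variation {F : Type*} [NormedAddCommGroup F] (ν : Set α → F) {A : Set α} {k : ℕ}
    (P : Fin k → Set α) (h1 : ∀ j, MeasurableSet (P j))
    (h2 : Pairwise fun i j => Disjoint (P i) (P j)) (h3 : ⋃ j, P j = A) :
    ∑ j, ‖ν (P j)‖ₑ ≤ variation ν A :=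
  le_iSup_of_le k <| le_iSup_of_le P <| le_iSup_of_le h1 <| le_iSup_of_le h2 <|
    le_iSup_of_le h3 le_rfl

lemma variation_le {F : Type*} [NormedAddCommGroup F] {ν : Set α → F} {A : Set α} {C : ℝ≥0∞}
    (h : ∀ (k : ℕ) (P : Fin k → Set α), (∀ j, MeasurableSet (P j)) →
      (Pairwise fun i j => Disjoint (P i) (P j)) → ⋃ j, P j = A → ∑ j, ‖ν (P j)‖ₑ ≤ C) :
    variation ν A ≤ C :=
  iSup_le fun k => iSup_le fun P => iSup_le fun h1 => iSup_le fun h2 => iSup_le fun h3 =>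
    h k P h1 h2 h3

/-- A single supremum over a nonempty index type is the form in which two suprema can be added. -/
lemma variation_eq_iSup {F : Type*} [NormedAddCommGroup F] (ν : Set α → F) (A : Set α) :
    variation ν A = ⨆ p : {p : Σ k : ℕ, Fin k → Set α // (∀ j, MeasurableSet (p.2 j)) ∧
      (Pairwise fun i j => Disjoint (p.2 i) (p.2 j)) ∧ ⋃ j, p.2 j = A},
      ∑ j, ‖ν (p.1.2 j)‖ₑ :=
  le_antisymm
    (variation_le fun k P h1 h2 h3 => le_iSup_of_le ⟨⟨k, P⟩, h1, h2, h3⟩ le_rfl)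
    (iSup_le fun p => enorm_sum_le_variation ν p.1.2 p.2.1 p.2.2.1 p.2.2.2)

/-- Partitions of `A` and of `B` concatenate to one of `A ∪ B`. No additivity of `ν` enters, and
superadditivity is all that is needed later. -/
lemma variation_add_le {F : Type*} [NormedAddCommGroup F] (ν : Set α → F) {A B : Set α}
    (hA : MeasurableSet A) (hB : MeasurableSet B) (hAB : Disjoint A B) :
    variation ν A + variation ν B ≤ variation ν (A ∪ B) := by
  have hne : ∀ {A : Set α}, MeasurableSet A → Nonempty {p : Σ k : ℕ, Fin k → Set α //
      (∀ j, MeasurableSet (p.2 j)) ∧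
      (Pairwise fun i j => Disjoint (p.2 i) (p.2 j)) ∧ ⋃ j, p.2 j = A} := fun {A} hA =>
    ⟨⟨1, fun _ => A⟩, fun _ => hA, fun i j hij => absurd (Subsingleton.elim i j) hij,
      iUnion_const A⟩
  have := hne hA
  have := hne hB
  rw [variation_eq_iSup ν A, variation_eq_iSup ν B]
  refine ENNReal.iSup_add_iSup_le ?_
  rintro ⟨⟨k, P⟩, h1, h2, h3⟩ ⟨⟨l, Q⟩, h1', h2', h3'⟩
  have hPQ : ∀ i j, Disjoint (P i) (Q j) := fun i j =>
    hAB.mono (h3 ▸ subset_iUnion P i) (h3' ▸ subset_iUnion Q j)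
  have key := enorm_sum_le_variation (A := A ∪ B) ν (Fin.append P Q) ?_ ?_ ?_
  · simpa [Fin.sum_univ_add] using key
  · intro j
    refine Fin.addCases (fun i => ?_) (fun i => ?_) j
    · simpa using h1 i
    · simpa using h1' i
  · intro i j
    refine Fin.addCases (fun i => ?_) (fun i => ?_) i <;>
    refine Fin.addCases (fun j => ?_) (fun j => ?_) j
    · intro hij
      simpa using h2 (fun h => hij (by rw [h]))
    · intro _
      simpa using hPQ i j
    · intro _
      simpa using (hPQ j i).symm
    · intro hij
      simpa using h2' (fun h => hij (by rw [h]))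
  · rw [← h3, ← h3']
    ext x
    simp only [mem_iUnion, mem_union]
    constructor
    · rintro ⟨j, hj⟩
      revert hj
      refine Fin.addCases (fun i => ?_) (fun i => ?_) j
      · intro h; left; exact ⟨i, by simpa using h⟩
      · intro h; right; exact ⟨i, by simpa using h⟩
    · rintro (⟨i, hi⟩ | ⟨i, hi⟩)
      · exact ⟨Fin.castAdd l i, by simpa using hi⟩
      · exact ⟨Fin.natAdd k i, by simpa using hi⟩

lemma sum_variation_le {F : Type*} [NormedAddCommGroup F] (ν : Set α → F) {β : Type*}
    (s : Finset β) {A : β → Set α} (hA : ∀ b ∈ s, MeasurableSet (A b))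
    (hd : (s : Set β).PairwiseDisjoint A) :
    ∑ b ∈ s, variation ν (A b) ≤ variation ν (⋃ b ∈ s, A b) := by
  classical
  induction s using Finset.induction_on with
  | empty => simp
  | insert b s hb ih =>
    rw [Finset.sum_insert hb, Finset.set_biUnion_insert]
    have hA' : ∀ c ∈ s, MeasurableSet (A c) := fun c hc => hA c (Finset.mem_insert_of_mem hc)
    refine (add_le_add_right (ih hA' (hd.subset (by simp))) _).trans ?_
    refine variation_add_le ν (hA b (Finset.mem_insert_self _ _))
      (Finset.measurableSet_biUnion s hA') ?_
    rw [disjoint_iUnion₂_right]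
    intro c hc
    exact hd (by simp) (by simp [hc]) (fun h => hb (h ▸ hc))

lemma variation_mono_norm {F G : Type*} [NormedAddCommGroup F] [NormedAddCommGroup G]
    {ν : Set α → F} {ν' : Set α → G} {A : Set α} (h : ∀ B, ‖ν B‖ₑ ≤ ‖ν' B‖ₑ) :
    variation ν A ≤ variation ν' A :=
  variation_le fun _ P h1 h2 h3 =>
    (Finset.sum_le_sum fun j _ => h (P j)).trans (enorm_sum_le_variation ν' P h1 h2 h3)

/-! ### Functionals on `L^∞` and the vector measures they induce -/

variable {μ : Measure α} {U : Set α} {ι : Type*} [Fintype ι]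

open Classical in
/-- A functional on `L^∞` applied to (the class of) a function. -/
def applyFun (F : StrongDual ℝ (Lp (EuclideanSpace ℝ ι) ⊤ (μ.restrict U)))
    (f : α → EuclideanSpace ℝ ι) : ℝ :=
  if h : MemLp f ⊤ (μ.restrict U) then F h.toLp else 0

variable (F : StrongDual ℝ (Lp (EuclideanSpace ℝ ι) ⊤ (μ.restrict U)))

lemma applyFun_of_memLp {f : α → EuclideanSpace ℝ ι} (hf : MemLp f ⊤ (μ.restrict U)) :
    applyFun F f = F hf.toLp := dif_pos hf

lemma applyFun_coe (φ : Lp (EuclideanSpace ℝ ι) ⊤ (μ.restrict U)) : applyFun F φ = F φ := by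
  rw [applyFun_of_memLp F (Lp.memLp φ), Lp.toLp_coeFn]

lemma applyFun_congr {f g : α → EuclideanSpace ℝ ι} (h : f =ᵐ[μ.restrict U] g) :
    applyFun F f = applyFun F g := by
  by_cases hf : MemLp f ⊤ (μ.restrict U)
  · have hg := (memLp_congr_ae h).1 hf
    rw [applyFun_of_memLp F hf, applyFun_of_memLp F hg, (MemLp.toLp_eq_toLp_iff hf hg).2 h]
  · have hg := fun hg => hf ((memLp_congr_ae h).2 hg)
    rw [applyFun, applyFun, dif_neg hf, dif_neg hg]

lemma applyFun_add {f g : α → EuclideanSpace ℝ ι} (hf : MemLp f ⊤ (μ.restrict U))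
    (hg : MemLp g ⊤ (μ.restrict U)) :
    applyFun F (f + g) = applyFun F f + applyFun F g := by
  rw [applyFun_of_memLp F hf, applyFun_of_memLp F hg, applyFun_of_memLp F (hf.add hg), ← map_add]
  rfl

lemma applyFun_smul (c : ℝ) {f : α → EuclideanSpace ℝ ι} (hf : MemLp f ⊤ (μ.restrict U)) :
    applyFun F (c • f) = c * applyFun F f := by
  rw [applyFun_of_memLp F hf, applyFun_of_memLp F (hf.const_smul c), ← smul_eq_mul, ← map_smul]
  rfl

lemma applyFun_sub {f g : α → EuclideanSpace ℝ ι} (hf : MemLp f ⊤ (μ.restrict U))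
    (hg : MemLp g ⊤ (μ.restrict U)) :
    applyFun F (f - g) = applyFun F f - applyFun F g := by
  rw [applyFun_of_memLp F hf, applyFun_of_memLp F hg, applyFun_of_memLp F (hf.sub hg), ← map_sub]
  rfl

lemma applyFun_zero : applyFun F (0 : α → EuclideanSpace ℝ ι) = 0 := by
  rw [applyFun_of_memLp F MemLp.zero, ← map_zero F]
  rfl

lemma applyFun_sum {β : Type*} (s : Finset β) {f : β → α → EuclideanSpace ℝ ι}
    (hf : ∀ b ∈ s, MemLp (f b) ⊤ (μ.restrict U)) :
    applyFun F (∑ b ∈ s, f b) = ∑ b ∈ s, applyFun F (f b) := by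
  classical
  induction s using Finset.induction_on with
  | empty => simpa using applyFun_zero F
  | insert b s hb ih =>
    have hs : ∀ c ∈ s, MemLp (f c) ⊤ (μ.restrict U) := fun c hc =>
      hf c (Finset.mem_insert_of_mem hc)
    rw [Finset.sum_insert hb, Finset.sum_insert hb,
      applyFun_add F (hf b (Finset.mem_insert_self _ _)) (memLp_finsetSum' s hs), ih hs]

lemma norm_toLp_top_le {E : Type*} [NormedAddCommGroup E] {ν : Measure α} {f : α → E}
    (hf : MemLp f ⊤ ν) {C : ℝ} (hC : 0 ≤ C) (h : ∀ᵐ x ∂ν, ‖f x‖ ≤ C) : ‖hf.toLp‖ ≤ C := by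
  rw [Lp.norm_toLp]
  refine ENNReal.toReal_le_of_le_ofReal hC ?_
  rw [eLpNorm_exponent_top]
  exact eLpNormEssSup_le_of_ae_bound h

lemma ae_norm_le_norm {E : Type*} [NormedAddCommGroup E] {ν : Measure α} (φ : Lp E ⊤ ν) :
    ∀ᵐ x ∂ν, ‖φ x‖ ≤ ‖φ‖ := by
  filter_upwards [ae_le_eLpNormEssSup (f := φ) (μ := ν)] with x hx
  have h3 := ENNReal.toReal_mono (Lp.memLp φ).2.ne (by simpa [eLpNorm_exponent_top] using hx)
  simpa [Lp.norm_def] using h3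

lemma norm_le_of_ae_le {E : Type*} [NormedAddCommGroup E] {ν : Measure α} {φ : Lp E ⊤ ν}
    {C : ℝ} (hC : 0 ≤ C) (h : ∀ᵐ x ∂ν, ‖φ x‖ ≤ C) : ‖φ‖ ≤ C := by
  simpa using norm_toLp_top_le (Lp.memLp φ) hC h

/-- Membership in `L^∞` need not be assumed: outside it the default value `0` of `applyFun`
satisfies the bound. -/
lemma abs_applyFun_le {f : α → EuclideanSpace ℝ ι} {C : ℝ} (hC : 0 ≤ C)
    (h : ∀ᵐ x ∂μ.restrict U, ‖f x‖ ≤ C) : |applyFun F f| ≤ ‖F‖ * C := by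
  by_cases hf : MemLp f ⊤ (μ.restrict U)
  · rw [applyFun_of_memLp F hf, ← Real.norm_eq_abs]
    exact (F.le_opNorm _).trans
      (mul_le_mul_of_nonneg_left (norm_toLp_top_le hf hC h) (norm_nonneg F))
  · rw [applyFun, dif_neg hf, abs_zero]
    positivity

lemma memLp_indicator_const {A : Set α} (hA : MeasurableSet A) (v : EuclideanSpace ℝ ι) :
    MemLp (A.indicator fun _ => v) ⊤ (μ.restrict U) :=
  (memLp_top_const v).indicator hA

variable [DecidableEq ι]

open Classical in
/-- The `i`-th component of the vector measure `A ↦ (F (1_A eᵢ))ᵢ` given by a functional `F`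
on `L^∞`. -/
def ofDual (i : ι) : Ba U μ where
  toFun A := if MeasurableSet A ∧ A ⊆ U then
    applyFun F (A.indicator fun _ => EuclideanSpace.single i 1) else 0
  eq_zero_of_not A hA := if_neg hA
  add A B hA hB hAU hBU hAB := by
    rw [if_pos ⟨hA.union hB, union_subset hAU hBU⟩, if_pos ⟨hA, hAU⟩, if_pos ⟨hB, hBU⟩,
      ← applyFun_add F (memLp_indicator_const hA _) (memLp_indicator_const hB _),
      indicator_union_of_disjoint hAB]
    rfl
  bounded := by
    refine ⟨‖F‖ * 1, fun A => ?_⟩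
    split_ifs with h
    · refine abs_applyFun_le F zero_le_one (Eventually.of_forall fun x => ?_)
      refine (norm_indicator_le_norm_self _ _).trans ?_
      simp
    · simp
  wac A hA hAU h0 := by
    rw [if_pos ⟨hA, hAU⟩, ← applyFun_zero F]
    refine applyFun_congr F ?_
    have : ∀ᵐ x ∂μ.restrict U, x ∉ A :=
      measure_eq_zero_iff_ae_notMem.1
        (le_antisymm ((Measure.restrict_apply_le _ _).trans h0.le) bot_le)
    filter_upwards [this] with x hx
    simp [hx]

lemma ofDual_apply (i : ι) {A : Set α} (hA : MeasurableSet A) (hAU : A ⊆ U) :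
    (ofDual F i).toFun A = applyFun F (A.indicator fun _ => EuclideanSpace.single i 1) :=
  if_pos ⟨hA, hAU⟩

lemma ofDual_sum_mul {A : Set α} (hA : MeasurableSet A) (hAU : A ⊆ U) (v : EuclideanSpace ℝ ι) :
    ∑ i, (ofDual F i).toFun A * v i = applyFun F (A.indicator fun _ => v) := by
  have h1 : (A.indicator fun _ => v) =
      ∑ i, v i • A.indicator fun _ : α => (EuclideanSpace.single i (1 : ℝ)) := by
    funext x
    by_cases hx : x ∈ A
    · ext j
      simp [hx, Finset.sum_apply, Pi.single_apply]
    · simp [hx]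
  rw [h1, applyFun_sum F _ fun i _ => (memLp_indicator_const hA _).const_smul (v i)]
  refine Finset.sum_congr rfl fun i _ => ?_
  rw [applyFun_smul F _ (memLp_indicator_const hA _), ofDual_apply F i hA hAU, mul_comm]

/-- The vector measure with components `ofDual F i`. -/
def vecFun (A : Set α) : EuclideanSpace ℝ ι := WithLp.toLp 2 fun i => (ofDual F i).toFun A

/-- The dictionary between the functional and its measure; everything about `vecFun` is deduced from
it by testing with vectors `v`. -/
lemma inner_vecFun {A : Set α} (hA : MeasurableSet A) (hAU : A ⊆ U) (v : EuclideanSpace ℝ ι) :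
    inner ℝ (vecFun F A) v = applyFun F (A.indicator fun _ => v) := by
  rw [← ofDual_sum_mul F hA hAU v, PiLp.inner_apply]
  simp [vecFun, mul_comm]

lemma vecVariation_ofDual (A : Set α) :
    vecVariation (ofDual F) A = variation (vecFun F) A := rfl

lemma sum_enorm_eq_ofReal {β E : Type*} [NormedAddCommGroup E] (s : Finset β) (f : β → E) :
    ∑ b ∈ s, ‖f b‖ₑ = ENNReal.ofReal (∑ b ∈ s, ‖f b‖) := by
  rw [ENNReal.ofReal_sum_of_nonneg fun _ _ => norm_nonneg _]
  simp

/-- The variation sum over a partition is the value of `F` on the step function that carries on each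
piece the unit vector in the direction of its measure. -/
lemma vecVariation_ofDual_le {A : Set α} (hAU : A ⊆ U) :
    vecVariation (ofDual F) A ≤ ENNReal.ofReal ‖F‖ := by
  rw [vecVariation_ofDual]
  refine variation_le fun k P h1 h2 h3 => ?_
  rw [sum_enorm_eq_ofReal]
  refine ENNReal.ofReal_le_ofReal ?_
  have hPU : ∀ j, P j ⊆ U := fun j => (subset_iUnion P j).trans (h3.subset.trans hAU)
  -- Only `≤ 1` is claimed, since for `v = 0` the inverse is `0` and the normalized vector vanishes.
  have hone : ∀ v : EuclideanSpace ℝ ι, ‖‖v‖⁻¹ • v‖ ≤ 1 := fun v => by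
    rw [norm_smul, norm_inv, norm_norm]
    exact inv_mul_le_one
  have e : ∑ j, ‖vecFun F (P j)‖ = applyFun F
      (∑ j, (P j).indicator fun _ => ‖vecFun F (P j)‖⁻¹ • vecFun F (P j)) := by
    rw [applyFun_sum F _ fun j _ => memLp_indicator_const (h1 j) _]
    refine Finset.sum_congr rfl fun j _ => ?_
    rw [← inner_vecFun F (h1 j) (hPU j), inner_smul_right, real_inner_self_eq_norm_sq]
    rcases eq_or_ne ‖vecFun F (P j)‖ 0 with h | h
    · simp [h]
    · field_simp
  rw [e]
  refine (le_abs_self _).trans ((abs_applyFun_le F zero_le_one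
    (Eventually.of_forall fun x => ?_)).trans (mul_one _).le)
  rw [Finset.sum_apply]
  exact norm_sum_indicator_le _ (fun i _ j _ hij => h2 hij) zero_le_one (fun j _ => hone _) x

lemma variation_ofDual_ne_top (i : ι) : variation (ofDual F i).toFun U ≠ ⊤ := by
  refine ne_top_of_le_ne_top ENNReal.ofReal_ne_top
    ((variation_mono_norm fun B => ?_).trans (vecVariation_ofDual_le F subset_rfl))
  have := PiLp.enorm_apply_le (vecFun F B) i
  exact this

lemma applyFun_simpleFunc (hU : MeasurableSet U) (h : SimpleFunc α (EuclideanSpace ℝ ι)) :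
    applyFun F h = ∑ c ∈ h.range, inner ℝ (vecFun F (h ⁻¹' {c} ∩ U)) c := by
  have h1 : (h : α → EuclideanSpace ℝ ι) =ᵐ[μ.restrict U]
      ∑ c ∈ h.range, (h ⁻¹' {c} ∩ U).indicator fun _ => c := by
    filter_upwards [ae_restrict_mem hU] with x hx
    rw [Finset.sum_apply, Finset.sum_eq_single (h x)]
    · simp [hx]
    · intro c _ hc
      simp [hc.symm]
    · intro hc
      exact absurd (SimpleFunc.mem_range_self h x) hc
  have hm : ∀ c, MeasurableSet (h ⁻¹' {c} ∩ U) := fun c => (h.measurableSet_fiber c).inter hU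
  rw [applyFun_congr F h1, applyFun_sum F _ fun c _ => memLp_indicator_const (hm c) _]
  exact Finset.sum_congr rfl fun c _ => (inner_vecFun F (hm c) inter_subset_right c).symm

lemma sum_variation_fiber_le {E G : Type*} [NormedAddCommGroup G] (ν : Set α → G)
    (hU : MeasurableSet U) (h : SimpleFunc α E) :
    ∑ c ∈ h.range, variation ν (h ⁻¹' {c} ∩ U) ≤ variation ν U := by
  refine (sum_variation_le ν h.range (fun c _ => (h.measurableSet_fiber c).inter hU) ?_).trans_eq ?_
  · intro c _ d _ hcd
    refine disjoint_left.2 fun x hx hx' => hcd ?_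
    rw [← mem_singleton_iff.1 (mem_preimage.1 hx.1), mem_singleton_iff.1 (mem_preimage.1 hx'.1)]
  · congr 1
    ext x
    simp only [mem_iUnion, mem_inter_iff, mem_preimage, mem_singleton_iff, exists_prop]
    exact ⟨fun ⟨_, _, _, hx⟩ => hx, fun hx => ⟨h x, SimpleFunc.mem_range_self h x, rfl, hx⟩⟩

lemma enorm_le_variation {G : Type*} [NormedAddCommGroup G] (ν : Set α → G) {A : Set α}
    (hA : MeasurableSet A) : ‖ν A‖ₑ ≤ variation ν A := by
  simpa using enorm_sum_le_variation ν (fun _ : Fin 1 => A) (fun _ => hA)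
    (fun i j hij => absurd (Subsingleton.elim i j) hij) (iUnion_const A)

/-- Setting the function to zero where it exceeds its essential bound gives a pointwise bound, as
uniform approximation requires. -/
lemma exists_bounded_representative {E : Type*} [NormedAddCommGroup E] {ν : Measure α} {f : α → E}
    (hf : MemLp f ⊤ ν) :
    ∃ g : α → E, StronglyMeasurable g ∧ f =ᵐ[ν] g ∧ ∀ x, ‖g x‖ ≤ ‖hf.toLp‖ := by
  have hm : StronglyMeasurable (hf.toLp : α → E) := Lp.stronglyMeasurable _
  refine ⟨{x | ‖(hf.toLp : α → E) x‖ ≤ ‖hf.toLp‖}.indicator (hf.toLp : α → E),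
    hm.indicator (measurableSet_le hm.norm.measurable measurable_const), ?_, fun x => ?_⟩
  · filter_upwards [hf.coeFn_toLp, ae_norm_le_norm hf.toLp] with x h1 h2
    rw [indicator_of_mem (by exact h2), h1]
  · rw [indicator]
    split_ifs with h
    · exact h
    · simp

/-- On a simple function `h`, `F h` is the sum of the pairings of the values `c` with the measures
of the fibres, hence at most the total variation times `sup ‖h‖`. Uniform approximation extends the
bound to all of `L^∞`. -/
lemma norm_le_baNorm (hU : MeasurableSet U) : ENNReal.ofReal ‖F‖ ≤ baNorm (ofDual F) := by
  have hfin : baNorm (ofDual F) ≠ ⊤ :=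
    ne_top_of_le_ne_top ENNReal.ofReal_ne_top (vecVariation_ofDual_le F subset_rfl)
  refine ENNReal.ofReal_le_of_le_toReal
    (F.opNorm_le_bound ENNReal.toReal_nonneg fun φ => ?_)
  refine le_of_forall_pos_le_add fun ε hε => ?_
  set M := (baNorm (ofDual F)).toReal with hM
  obtain ⟨g, hg, hφg, hgb⟩ := exists_bounded_representative (Lp.memLp φ)
  rw [Lp.toLp_coeFn] at hgb
  -- The accuracy `ε / (‖F‖ + M + 1)` pays for replacing `φ` by `h`, which costs `‖F‖ η`, and for
  -- the larger supremum of `h`, which costs `M η`; the summand `1` keeps the denominator positive.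
  have hKpos : 0 < ‖F‖ + M + 1 := by positivity
  obtain ⟨h, hh⟩ := exists_simpleFunc_norm_sub_le hg hgb (div_pos hε hKpos)
  set η := ε / (‖F‖ + M + 1)
  have hhb : ∀ x, ‖h x‖ ≤ ‖φ‖ + η := fun x => by
    have := norm_le_insert' (h x) (g x)
    linarith [hh x, hgb x]
  have hhm : MemLp h ⊤ (μ.restrict U) :=
    memLp_top_of_bound h.aestronglyMeasurable _ (Eventually.of_forall hhb)
  have hgm : MemLp g ⊤ (μ.restrict U) :=
    memLp_top_of_bound hg.aestronglyMeasurable _ (Eventually.of_forall hgb)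
  have e1 : |F φ - applyFun F h| ≤ ‖F‖ * η := by
    rw [← applyFun_coe F φ, applyFun_congr F hφg, ← applyFun_sub F hgm hhm]
    refine abs_applyFun_le F (by positivity) (Eventually.of_forall fun x => ?_)
    rw [Pi.sub_apply, norm_sub_rev]
    exact hh x
  have e2 : |applyFun F h| ≤ M * (‖φ‖ + η) := by
    rw [applyFun_simpleFunc F hU]
    have h0 : ∑ c ∈ h.range, ‖vecFun F (h ⁻¹' {c} ∩ U)‖ ≤ M := by
      refine (ENNReal.ofReal_le_iff_le_toReal hfin).1 ?_
      rw [← sum_enorm_eq_ofReal]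
      refine (Finset.sum_le_sum fun c _ => ?_).trans (sum_variation_fiber_le (vecFun F) hU h)
      exact enorm_le_variation _ ((h.measurableSet_fiber c).inter hU)
    refine (Finset.abs_sum_le_sum_abs _ _).trans ?_
    refine le_trans ?_ (mul_le_mul_of_nonneg_right h0 (by positivity))
    rw [Finset.sum_mul]
    refine Finset.sum_le_sum fun c hc => ?_
    obtain ⟨x, rfl⟩ := SimpleFunc.mem_range.1 hc
    exact (abs_real_inner_le_norm _ _).trans (mul_le_mul_of_nonneg_left (hhb x) (norm_nonneg _))
  have e3 : (‖F‖ + M) * η ≤ ε := by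
    have : (‖F‖ + M + 1) * η = ε := mul_div_cancel₀ ε hKpos.ne'
    nlinarith [div_pos hε hKpos]
  rw [Real.norm_eq_abs]
  have := abs_sub_abs_le_abs_sub (F φ) (applyFun F h)
  nlinarith

lemma baNorm_ofDual (hU : MeasurableSet U) : baNorm (ofDual F) = ENNReal.ofReal ‖F‖ :=
  le_antisymm (vecVariation_ofDual_le F subset_rfl) (norm_le_baNorm F hU)

end OfDual
lemma memLp_coord {α ι : Type*} [MeasurableSpace α] [Fintype ι]
    {f : α → EuclideanSpace ℝ ι} {ν : Measure α} (hf : MemLp f ⊤ ν) (i : ι) :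
    MemLp (fun x => f x i) ⊤ ν :=
  hf.mono ((EuclideanSpace.proj (𝕜 := ℝ) i).continuous.comp_aestronglyMeasurable hf.1)
    (Eventually.of_forall fun x => PiLp.norm_apply_le (f x) i)

/-! ### Integration against the induced measures, supports and cores -/

section OfDualIntegral

variable {α : Type*} [MeasurableSpace α] {μ : Measure α} {U : Set α} {ι : Type*} [Fintype ι]
  [DecidableEq ι] (F : StrongDual ℝ (Lp (EuclideanSpace ℝ ι) ⊤ (μ.restrict U)))

lemma norm_smul_single (c : ℝ) (i : ι) :
    ‖c • (EuclideanSpace.single i 1 : EuclideanSpace ℝ ι)‖ = |c| := by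
  rw [norm_smul, PiLp.norm_single, norm_one, mul_one, Real.norm_eq_abs]

lemma simpleIntegral_ofDual (hU : MeasurableSet U) (i : ι) (h : SimpleFunc α ℝ) :
    simpleIntegral (ofDual F i) h =
      applyFun F fun x => h x • (EuclideanSpace.single i 1 : EuclideanSpace ℝ ι) := by
  have hm : ∀ c, MeasurableSet (h ⁻¹' {c} ∩ U) := fun c => (h.measurableSet_fiber c).inter hU
  have h1 : (fun x => h x • (EuclideanSpace.single i 1 : EuclideanSpace ℝ ι)) =ᵐ[μ.restrict U]
      ∑ c ∈ h.range, c • (h ⁻¹' {c} ∩ U).indicator fun _ => EuclideanSpace.single i 1 := by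
    filter_upwards [ae_restrict_mem hU] with x hx
    rw [Finset.sum_apply, Finset.sum_eq_single (h x)]
    · simp [hx]
    · intro c _ hc
      simp [hc.symm]
    · intro hc
      exact absurd (SimpleFunc.mem_range_self h x) hc
  rw [applyFun_congr F h1,
    applyFun_sum F _ fun c _ => (memLp_indicator_const (hm c) _).const_smul c]
  refine Finset.sum_congr rfl fun c _ => ?_
  rw [applyFun_smul F c (memLp_indicator_const (hm c) _),
    ofDual_apply F i (hm c) inter_subset_right]

lemma simpleAbsIntegral_le (ν : Ba U μ) (hU : MeasurableSet U) (h : SimpleFunc α ℝ) {C : ℝ}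
    (hC : ∀ x, |h x| ≤ C) :
    simpleAbsIntegral ν h ≤ ENNReal.ofReal C * variation ν.toFun U := by
  refine le_trans ?_ (mul_le_mul_right (sum_variation_fiber_le ν.toFun hU h) _)
  rw [Finset.mul_sum]
  refine Finset.sum_le_sum fun c hc => ?_
  obtain ⟨x, rfl⟩ := SimpleFunc.mem_range.1 hc
  gcongr
  rw [← ofReal_norm]
  exact ENNReal.ofReal_le_ofReal (hC x)

lemma variation_eq_zero_of_null (ν : Ba U μ) {N : Set α} (hNU : N ⊆ U) (h0 : μ N = 0) :
    variation ν.toFun N = 0 := by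
  refine le_antisymm (variation_le fun k P h1 _ h3 => ?_) bot_le
  have hPN : ∀ j, P j ⊆ N := fun j => (subset_iUnion P j).trans h3.subset
  refine (Finset.sum_eq_zero fun j _ => ?_).le
  rw [ν.wac _ (h1 j) ((hPN j).trans hNU) (measure_mono_null (hPN j) h0), enorm_zero]

/-- The set `S` need not be measurable, so it is covered by its measurable hull inside `U`, on which
weak absolute continuity applies. -/
lemma outerVariation_eq_zero_of_null (ν : Ba U μ) (hU : MeasurableSet U) {S : Set α} (hSU : S ⊆ U)
    (h0 : μ S = 0) : outerVariation ν S = 0 := by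
  refine le_antisymm ?_ bot_le
  have h1 : outerVariation ν S ≤ variation ν.toFun (toMeasurable μ S ∩ U) :=
    (iInf_le _ (toMeasurable μ S ∩ U)).trans <|
      (iInf_le _ ((measurableSet_toMeasurable μ S).inter hU)).trans <|
      (iInf_le _ inter_subset_right).trans <|
      iInf_le _ (subset_inter (subset_toMeasurable μ S) hSU)
  refine h1.trans ?_
  refine (variation_eq_zero_of_null ν inter_subset_right ?_).le
  exact measure_mono_null inter_subset_left ((measure_toMeasurable S).trans h0)

/-- Simple functions within `1 / (k + 1)` of a bounded representative form a determining sequence: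
the exceptional sets are eventually null, the mean distances are controlled by the finite variation,
and the integrals converge by continuity of `F`. -/
lemma hasIntegral_ofDual (hU : MeasurableSet U) (i : ι) {f : α → ℝ}
    (hf : MemLp f ⊤ (μ.restrict U)) :
    HasIntegral (ofDual F i) f
      (applyFun F fun x => f x • (EuclideanSpace.single i 1 : EuclideanSpace ℝ ι)) := by
  obtain ⟨g, hg, hfg, hgb⟩ := exists_bounded_representative hf
  have hpos : ∀ k : ℕ, (0 : ℝ) < 1 / (k + 1) := fun k => Nat.one_div_pos_of_nat
  choose h hh using fun k : ℕ => exists_simpleFunc_norm_sub_le hg hgb (hpos k)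
  have hlim : Tendsto (fun k : ℕ => (1 : ℝ) / (k + 1)) atTop (𝓝 0) :=
    tendsto_one_div_add_atTop_nhds_zero_nat
  refine ⟨h, fun ε hε => ?_, ?_, ?_⟩
  · refine tendsto_const_nhds.congr' ?_
    filter_upwards [hlim.eventually_le_const hε] with k hk
    refine (outerVariation_eq_zero_of_null _ hU (fun x hx => hx.1) ?_).symm
    have h2 : ∀ᵐ x ∂μ, x ∈ U → f x = g x := (ae_restrict_iff' hU).1 hfg
    refine measure_mono_null (fun x hx => ?_) (ae_iff.1 h2)
    intro hfx
    rw [mem_ofPred_eq, hfx hx.1] at hx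
    exact absurd hx.2 (not_lt.2 ((hh k x).trans hk))
  · have hb : ∀ p : ℕ × ℕ, simpleAbsIntegral (ofDual F i) (h p.1 - h p.2) ≤
        ENNReal.ofReal (1 / (p.1 + 1) + 1 / (p.2 + 1)) * variation (ofDual F i).toFun U := by
      intro p
      refine simpleAbsIntegral_le _ hU _ fun x => ?_
      have h1 := hh p.1 x
      have h2 := hh p.2 x
      rw [norm_sub_rev] at h2
      rw [SimpleFunc.coe_sub, Pi.sub_apply, ← Real.norm_eq_abs,
        ← sub_add_sub_cancel (h p.1 x) (g x) (h p.2 x)]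
      exact (norm_add_le _ _).trans (add_le_add h1 h2)
    refine tendsto_of_tendsto_of_tendsto_of_le_of_le tendsto_const_nhds ?_ (fun _ => bot_le) hb
    rw [← prod_atTop_atTop_eq]
    have h1 : Tendsto (fun p : ℕ × ℕ => (1 : ℝ) / (p.1 + 1) + 1 / (p.2 + 1)) (atTop ×ˢ atTop)
        (𝓝 (0 + 0)) := (hlim.comp tendsto_fst).add (hlim.comp tendsto_snd)
    have h2 := ENNReal.Tendsto.mul_const (b := variation (ofDual F i).toFun U)
      (ENNReal.tendsto_ofReal h1) (Or.inr (variation_ofDual_ne_top F i))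
    simpa using h2
  · simp_rw [simpleIntegral_ofDual F hU]
    have hsm : ∀ {k : α → ℝ}, MemLp k ⊤ (μ.restrict U) →
        MemLp (fun x => k x • (EuclideanSpace.single i 1 : EuclideanSpace ℝ ι)) ⊤
          (μ.restrict U) := fun {k} hk =>
      memLp_top_of_bound (hk.1.smul_const _) ‖hk.toLp‖ (by
        filter_upwards [hk.coeFn_toLp, ae_norm_le_norm hk.toLp] with x h1 h2
        rw [norm_smul_single, ← Real.norm_eq_abs, ← h1]
        exact h2)
    have hhm : ∀ k, MemLp (h k) ⊤ (μ.restrict U) := fun k =>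
      memLp_top_of_bound (h k).aestronglyMeasurable (‖hf.toLp‖ + 1 / (k + 1))
        (Eventually.of_forall fun x => by
          have := norm_le_insert' (h k x) (g x)
          linarith [hh k x, hgb x])
    rw [tendsto_iff_norm_sub_tendsto_zero]
    refine squeeze_zero (fun _ => norm_nonneg _) (fun k => ?_)
      (by rw [← mul_zero ‖F‖]; exact hlim.const_mul ‖F‖)
    rw [← applyFun_sub F (hsm (hhm k)) (hsm hf)]
    refine abs_applyFun_le F (hpos k).le ?_
    filter_upwards [hfg] with x hx
    rw [Pi.sub_apply, ← sub_smul, norm_smul_single, hx]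
    exact hh k x

lemma hasVecIntegral_ofDual (hU : MeasurableSet U) {f : α → EuclideanSpace ℝ ι} {A : Set α}
    (hf : MemLp (A.indicator f) ⊤ (μ.restrict U)) :
    HasVecIntegral (ofDual F) A f (applyFun F (A.indicator f)) := by
  have hi : ∀ i, (A.indicator fun x => f x i) = fun x => A.indicator f x i := fun i => by
    funext x
    by_cases hx : x ∈ A <;> simp [hx]
  refine ⟨fun i => applyFun F fun x => A.indicator f x i •
    (EuclideanSpace.single i 1 : EuclideanSpace ℝ ι), fun i => ?_, ?_⟩
  · rw [hi]
    exact hasIntegral_ofDual F hU i (memLp_coord hf i)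
  · rw [← applyFun_sum]
    · congr 1
      funext x
      rw [Finset.sum_apply]
      ext j
      simp [Pi.single_apply]
    · intro i _
      refine (memLp_coord hf i).mono ((memLp_coord hf i).1.smul_const _)
        (Eventually.of_forall fun x => ?_)
      rw [norm_smul_single, Real.norm_eq_abs]

lemma vecVariation_eq_zero {B : Set α} (hBU : B ⊆ U)
    (h : ∀ f : α → EuclideanSpace ℝ ι, (∀ x, x ∉ B → f x = 0) → applyFun F f = 0) :
    vecVariation (ofDual F) B = 0 := by
  rw [vecVariation_ofDual]
  refine le_antisymm (variation_le fun k P h1 _ h3 => ?_) bot_le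
  have hPB : ∀ j, P j ⊆ B := fun j => (subset_iUnion P j).trans h3.subset
  refine (Finset.sum_eq_zero fun j _ => ?_).le
  have : vecFun F (P j) = 0 := by
    refine ext_inner_right ℝ fun v => ?_
    rw [inner_vecFun F (h1 j) ((hPB j).trans hBU), inner_zero_left]
    exact h _ fun x hx => indicator_of_notMem (fun hx' => hx (hPB j hx')) _
  rw [this, enorm_zero]

/-- Intersecting the pieces of a partition of `U` with `B` leaves their measures unchanged, because
`F` ignores what happens outside `B`. -/
lemma vecVariation_eq_baNorm {B : Set α} (hB : MeasurableSet B) (hU : MeasurableSet U) (hBU : B ⊆ U)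
    (h : ∀ f : α → EuclideanSpace ℝ ι, (∀ x ∈ B, f x = 0) → applyFun F f = 0) :
    vecVariation (ofDual F) B = baNorm (ofDual F) := by
  refine le_antisymm ?_ ?_
  · rw [baNorm_ofDual F hU]
    exact vecVariation_ofDual_le F hBU
  · rw [baNorm, vecVariation_ofDual, vecVariation_ofDual]
    refine variation_le fun k P h1 h2 h3 => ?_
    have hPU : ∀ j, P j ⊆ U := fun j => (subset_iUnion P j).trans h3.subset
    have e : ∀ j, vecFun F (P j) = vecFun F (P j ∩ B) := fun j => by
      refine ext_inner_right ℝ fun v => ?_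
      rw [inner_vecFun F (h1 j) (hPU j),
        inner_vecFun F ((h1 j).inter hB) (inter_subset_left.trans (hPU j)), ← sub_eq_zero,
        ← applyFun_sub F (memLp_indicator_const (h1 j) v)
          (memLp_indicator_const ((h1 j).inter hB) v)]
      refine h _ fun x hx => ?_
      by_cases hxP : x ∈ P j <;> simp [hxP, hx]
    simp_rw [e]
    refine enorm_sum_le_variation _ _ (fun j => (h1 j).inter hB) (fun i j hij =>
      (h2 hij).mono inter_subset_left inter_subset_left) ?_
    rw [← iUnion_inter, h3, inter_eq_right.2 hBU]

lemma core_ofDual_subset [TopologicalSpace α] {C : Set α}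
    (h : ∀ x ∉ C, ∃ O, IsOpen O ∧ x ∈ O ∧
      ∀ f : α → EuclideanSpace ℝ ι, (∀ y, y ∉ O → f y = 0) → applyFun F f = 0) :
    core (ofDual F) ⊆ C := by
  intro x hx
  by_contra hxC
  obtain ⟨O, hO, hxO, hF⟩ := h x hxC
  exact (hx O hO hxO).ne' (vecVariation_eq_zero F inter_subset_right fun f hf =>
    hF f fun y hy => hf y fun hy' => hy hy'.1)

end OfDualIntegral

/-! ### The weak derivative tested against Lipschitz functions -/

section Mollify

open scoped Convolution

variable {n : ℕ}

/-- Convolution with a normalized bump function. -/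
def mollify (ρ : ContDiffBump (0 : Euc n)) (g : Euc n → ℝ) : Euc n → ℝ :=
  ρ.normed volume ⋆[ContinuousLinearMap.lsmul ℝ ℝ, volume] g

lemma mollify_apply (ρ : ContDiffBump (0 : Euc n)) (g : Euc n → ℝ) (x : Euc n) :
    mollify ρ g x = ∫ t, ρ.normed volume t * g (x - t) := rfl

lemma abs_mollify_le (ρ : ContDiffBump (0 : Euc n)) {g : Euc n → ℝ} {C : ℝ}
    (hC : ∀ x, |g x| ≤ C) (x : Euc n) : |mollify ρ g x| ≤ C := by
  rw [mollify_apply, ← Real.norm_eq_abs]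
  calc ‖∫ t, ρ.normed volume t * g (x - t)‖
      ≤ ∫ t, ρ.normed volume t * C := by
        refine norm_integral_le_of_norm_le (ρ.integrable_normed.mul_const C)
          (Eventually.of_forall fun t => ?_)
        rw [norm_mul, Real.norm_of_nonneg (ρ.nonneg_normed t)]
        exact mul_le_mul_of_nonneg_left (hC _) (ρ.nonneg_normed t)
    _ = C := by rw [integral_mul_const, ρ.integral_normed, one_mul]

lemma contDiff_mollify (ρ : ContDiffBump (0 : Euc n)) {g : Euc n → ℝ}
    (hg : LocallyIntegrable g) : ContDiff ℝ ((⊤ : ℕ∞) : WithTop ℕ∞) (mollify ρ g) :=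
  ρ.hasCompactSupport_normed.contDiff_convolution_left _ ρ.contDiff_normed hg

lemma tsupport_mollify_subset (ρ : ContDiffBump (0 : Euc n)) (g : Euc n → ℝ) :
    tsupport (mollify ρ g) ⊆ Metric.cthickening ρ.rOut (tsupport g) := by
  refine closure_minimal ?_ Metric.isClosed_cthickening
  intro x hx
  obtain ⟨a, ha, b, hb, rfl⟩ := support_convolution_subset _ hx
  rw [ρ.support_normed_eq, mem_ball_zero_iff] at ha
  refine Metric.mem_cthickening_of_dist_le _ b _ _ (subset_tsupport g hb) ?_
  simpa [dist_eq_norm] using ha.le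

/-- Differentiation under the integral, with the Lipschitz constant as domination; the derivative of
`θ` exists almost everywhere by Rademacher's theorem. -/
lemma fderiv_mollify (ρ : ContDiffBump (0 : Euc n)) {θ : Euc n → ℝ} {C : NNReal}
    (hθ : LipschitzWith C θ) (x v : Euc n) :
    fderiv ℝ (mollify ρ θ) x v = mollify ρ (fun z => fderiv ℝ θ z v) x := by
  have hcont : Continuous fun t => ρ.normed volume t := ρ.continuous_normed
  -- The reflection `t ↦ x - t` pulls null sets back to null sets.
  have hd : ∀ᵐ t : Euc n, DifferentiableAt ℝ θ (x - t) :=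
    (quasiMeasurePreserving_sub_left_of_right_invariant volume x).ae hθ.ae_differentiableAt
  have hFint : ∀ y, Integrable (fun t => ρ.normed volume t * θ (y - t)) := fun y =>
    (hcont.mul (hθ.continuous.comp
      (continuous_const.sub continuous_id))).integrable_of_hasCompactSupport
      ρ.hasCompactSupport_normed.mul_right
  have key := hasFDerivAt_integral_of_dominated_loc_of_lip' (𝕜 := ℝ) (μ := volume)
    (F := fun y t => ρ.normed volume t * θ (y - t)) (s := univ) (x₀ := x)
    (bound := fun t => ρ.normed volume t * C)
    (F' := fun t => ρ.normed volume t • fderiv ℝ θ (x - t)) univ_mem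
    (fun y _ => (hFint y).aestronglyMeasurable) (hFint x)
    (hcont.aestronglyMeasurable.smul ((measurable_fderiv ℝ θ).comp
      (measurable_const.sub measurable_id)).aestronglyMeasurable)
    (Eventually.of_forall fun t y _ => by
      rw [← mul_sub, norm_mul, Real.norm_of_nonneg (ρ.nonneg_normed t), mul_assoc]
      refine mul_le_mul_of_nonneg_left ?_ (ρ.nonneg_normed t)
      simpa [dist_eq_norm] using hθ.dist_le_mul (y - t) (x - t))
    (ρ.integrable_normed.mul_const _)
    (by
      filter_upwards [hd] with t ht
      have h1 : HasFDerivAt (fun y => θ (y - t)) (fderiv ℝ θ (x - t)) x := by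
        have := ht.hasFDerivAt.comp x ((hasFDerivAt_id x).sub_const t)
        rw [ContinuousLinearMap.comp_id] at this
        exact this
      simpa using h1.const_mul (ρ.normed volume t))
  have h2 : HasFDerivAt (mollify ρ θ) _ x := key.2
  rw [h2.fderiv, ContinuousLinearMap.integral_apply key.1]
  rfl

/-- Mollifications of `θ` are admissible smooth test functions, supported in one compact subset of
`U` and with uniformly bounded values and derivatives. Dominated convergence carries the identity to
`θ`. -/
lemma integral_mul_fderiv_of_lipschitz {U : Set (Euc n)} (hU : IsOpen U) {p q : Euc n → ℝ} {B : ℝ}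
    (hpm : AEStronglyMeasurable p (volume.restrict U))
    (hqm : AEStronglyMeasurable q (volume.restrict U))
    (hp : ∀ᵐ x ∂volume.restrict U, |p x| ≤ B) (hq : ∀ᵐ x ∂volume.restrict U, |q x| ≤ B) (v : Euc n)
    (h : ∀ η : Euc n → ℝ, ContDiff ℝ ((⊤ : ℕ∞) : WithTop ℕ∞) η → HasCompactSupport η →
      tsupport η ⊆ U → ∫ x in U, p x * fderiv ℝ η x v = - ∫ x in U, q x * η x)
    {θ : Euc n → ℝ} {C : NNReal} (hθ : LipschitzWith C θ) (hc : HasCompactSupport θ)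
    (hs : tsupport θ ⊆ U) :
    ∫ x in U, p x * fderiv ℝ θ x v = - ∫ x in U, q x * θ x := by
  obtain ⟨r, hr, hrU⟩ := hc.isCompact.exists_cthickening_subset_open hU hs
  set K := Metric.cthickening r (tsupport θ) with hK
  have hKc : IsCompact K := hc.isCompact.cthickening
  -- The outer radius is twice the inner one; this bounded ratio is what the almost everywhere
  -- convergence of mollified, merely integrable derivatives requires.
  let ρ : ℕ → ContDiffBump (0 : Euc n) := fun k =>
    ⟨r / 2 / (k + 1), r / (k + 1), by positivity, by
      apply div_lt_div_of_pos_right _ (by positivity)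
      linarith⟩
  have hρlim : Tendsto (fun k => (ρ k).rOut) atTop (𝓝 0) :=
    tendsto_const_div_atTop_nhds_zero_nat r |>.comp (tendsto_add_atTop_nat 1) |>.congr
      fun k => by simp [ρ]
  have hρle : ∀ k, (ρ k).rOut ≤ r := fun k => by
    refine div_le_self hr.le ?_
    have : (0 : ℝ) ≤ k := k.cast_nonneg
    linarith
  have hgb : ∀ x, |fderiv ℝ θ x v| ≤ C * ‖v‖ := fun x =>
    ((fderiv ℝ θ x).le_opNorm v).trans
      (mul_le_mul_of_nonneg_right (norm_fderiv_le_of_lipschitz ℝ hθ) (norm_nonneg v))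
  have hgm : Measurable fun x => fderiv ℝ θ x v := measurable_fderiv_apply_const ℝ θ v
  have hgl : LocallyIntegrable fun x => fderiv ℝ θ x v := fun x =>
    ⟨Metric.ball x 1, Metric.ball_mem_nhds x one_pos,
      Measure.integrableOn_of_bounded measure_ball_lt_top.ne hgm.aestronglyMeasurable
        (Eventually.of_forall hgb)⟩
  have hsup : ∀ k, tsupport (mollify (ρ k) θ) ⊆ K := fun k =>
    (tsupport_mollify_subset _ _).trans (Metric.cthickening_mono (hρle k) _)
  obtain ⟨M, hM⟩ := hc.exists_bound_of_continuous hθ.continuous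
  have hsm : ∀ k, ContDiff ℝ ((⊤ : ℕ∞) : WithTop ℕ∞) (mollify (ρ k) θ) := fun k =>
    contDiff_mollify _ hθ.continuous.locallyIntegrable
  have hfin : volume K ≠ ⊤ := hKc.measure_lt_top.ne
  have hbd : ∀ D : ℝ, Integrable (K.indicator fun _ => B * D) (volume.restrict U) := fun D =>
    ((integrable_indicator_iff hKc.measurableSet).2 (integrableOn_const hfin)).restrict
  have lim1 : Tendsto (fun k => ∫ x in U, p x * fderiv ℝ (mollify (ρ k) θ) x v) atTop
      (𝓝 (∫ x in U, p x * fderiv ℝ θ x v)) := by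
    refine tendsto_integral_of_dominated_convergence _ (fun k => ?_) (hbd (C * ‖v‖))
      (fun k => ?_) ?_
    · exact hpm.mul (((hsm k).continuous_fderiv (by simp)).clm_apply
        continuous_const).aestronglyMeasurable
    · filter_upwards [hp] with x hx
      by_cases hxK : x ∈ K
      · rw [indicator_of_mem hxK, norm_mul, fderiv_mollify _ hθ]
        exact mul_le_mul hx (abs_mollify_le _ hgb x) (norm_nonneg _) ((abs_nonneg _).trans hx)
      · have : fderiv ℝ (mollify (ρ k) θ) x = 0 := by
          by_contra h0
          exact hxK (hsup k (support_fderiv_subset ℝ h0))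
        simp [this, hxK]
    · have := (ContDiffBump.ae_convolution_tendsto_right_of_locallyIntegrable (K := 2) hρlim
        (Eventually.of_forall fun k => by simp only [ρ]; apply le_of_eq; ring) hgl)
      filter_upwards [ae_restrict_of_ae this] with x hx
      simp_rw [fderiv_mollify _ hθ]
      exact hx.const_mul _
  have lim2 : Tendsto (fun k => ∫ x in U, q x * mollify (ρ k) θ x) atTop
      (𝓝 (∫ x in U, q x * θ x)) := by
    refine tendsto_integral_of_dominated_convergence _ (fun k => ?_) (hbd M) (fun k => ?_) ?_
    · exact hqm.mul (hsm k).continuous.aestronglyMeasurable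
    · filter_upwards [hq] with x hx
      by_cases hxK : x ∈ K
      · rw [indicator_of_mem hxK, norm_mul]
        exact mul_le_mul hx (abs_mollify_le _ hM x) (norm_nonneg _) ((abs_nonneg _).trans hx)
      · have : mollify (ρ k) θ x = 0 := by
          by_contra h0
          exact hxK (hsup k (subset_tsupport _ h0))
        simp [this, hxK]
    · refine Eventually.of_forall fun x => Tendsto.const_mul _ ?_
      exact ContDiffBump.convolution_tendsto_right_of_continuous hρlim hθ.continuous x
  refine tendsto_nhds_unique lim1 (lim2.neg.congr fun k => ?_)
  exact (h _ (hsm k) (hKc.of_isClosed_subset (isClosed_tsupport _) (hsup k))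
    ((hsup k).trans hrU)).symm

end Mollify

section Sobolev

variable {n m : ℕ}

/-! ### Products with Lipschitz functions, uniqueness of weak derivatives, restriction -/

lemma W1Inf.integral_mul_fderiv {V : Set (Euc n)} (hV : IsOpen V) (φ : W1Inf V m) (i : Fin m)
    (j : Fin n) {θ : Euc n → ℝ} {C : NNReal} (hθ : LipschitzWith C θ) (hc : HasCompactSupport θ)
    (hs : tsupport θ ⊆ V) :
    ∫ x in V, val φ x i * fderiv ℝ θ x (EuclideanSpace.single j 1) =
      - ∫ x in V, grad φ x (i, j) * θ x := by
  refine integral_mul_fderiv_of_lipschitz (B := max ‖φ.1.1‖ ‖φ.1.2‖) hV ?_ ?_ ?_ ?_ _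
    (fun η h1 h2 h3 => φ.2 i j η h1 h2 h3) hθ hc hs
  · exact (EuclideanSpace.proj (𝕜 := ℝ) i).continuous.comp_aestronglyMeasurable (Lp.memLp φ.1.1).1
  · exact (EuclideanSpace.proj (𝕜 := ℝ) (i, j)).continuous.comp_aestronglyMeasurable
      (Lp.memLp φ.1.2).1
  · filter_upwards [ae_norm_le_norm φ.1.1] with x hx
    exact (PiLp.norm_apply_le (φ.1.1 x) i).trans (hx.trans (le_max_left _ _))
  · filter_upwards [ae_norm_le_norm φ.1.2] with x hx
    exact (PiLp.norm_apply_le (φ.1.2 x) (i, j)).trans (hx.trans (le_max_right _ _))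

lemma lipschitzWith_mul_of_bounded {α : Type*} [PseudoMetricSpace α] {f g : α → ℝ} {C D : NNReal}
    {A B : NNReal} (hf : LipschitzWith C f) (hg : LipschitzWith D g) (hA : ∀ x, |f x| ≤ A)
    (hB : ∀ x, |g x| ≤ B) : LipschitzWith (A * D + B * C) fun x => f x * g x := by
  refine LipschitzWith.of_dist_le_mul fun x y => ?_
  rw [Real.dist_eq]
  have h1 : |f x - f y| ≤ C * dist x y := by simpa [Real.dist_eq] using hf.dist_le_mul x y
  have h2 : |g x - g y| ≤ D * dist x y := by simpa [Real.dist_eq] using hg.dist_le_mul x y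
  calc |f x * g x - f y * g y| = |f x * (g x - g y) + g y * (f x - f y)| := by congr 1; ring
    _ ≤ |f x| * |g x - g y| + |g y| * |f x - f y| := by
        rw [← abs_mul, ← abs_mul]; exact abs_add_le _ _
    _ ≤ A * (D * dist x y) + B * (C * dist x y) := by
        gcongr
        · exact hA x
        · exact hB y
    _ = _ := by push_cast; ring

/-- The gradient of `χ φ` according to the product rule. -/
def mulGrad (χ : Euc n → ℝ) (u : Euc n → Euc m) (w : Euc n → EucMat m n) (x : Euc n) :
    EucMat m n :=
  χ x • w x + ∑ i, ∑ j, (u x i * fderiv ℝ χ x (EuclideanSpace.single j 1)) •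
    (EuclideanSpace.single (i, j) 1 : EucMat m n)

lemma mulGrad_apply (χ : Euc n → ℝ) (u : Euc n → Euc m) (w : Euc n → EucMat m n) (x : Euc n)
    (i : Fin m) (j : Fin n) : mulGrad χ u w x (i, j) =
      χ x * w x (i, j) + u x i * fderiv ℝ χ x (EuclideanSpace.single j 1) := by
  simp only [mulGrad, PiLp.add_apply, PiLp.smul_apply, smul_eq_mul]
  congr 1
  have h1 : ∀ s : Finset (Fin m × Fin n), ∀ g : Fin m × Fin n → EucMat m n,
      (∑ k ∈ s, g k) (i, j) = ∑ k ∈ s, g k (i, j) := fun s g =>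
    map_sum (EuclideanSpace.proj (𝕜 := ℝ) (i, j)) g s
  rw [← Fintype.sum_prod_type'
    (f := fun i j => (u x i * fderiv ℝ χ x (EuclideanSpace.single j 1)) •
      (EuclideanSpace.single (i, j) 1 : EucMat m n)), h1, Finset.sum_eq_single (i, j)]
  · simp
  · rintro ⟨k, l⟩ - hkl
    simp [hkl.symm]
  · simp

/-- Where `χ` is not differentiable, `fderiv` has the default value `0`, so the bound holds at every
point. -/
lemma abs_fderiv_single_le {χ : Euc n → ℝ} {L : NNReal} (hχ : LipschitzWith L χ) (x : Euc n)
    (j : Fin n) : |fderiv ℝ χ x (EuclideanSpace.single j 1)| ≤ L := by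
  refine ((fderiv ℝ χ x).le_opNorm _).trans ?_
  rw [PiLp.norm_single, norm_one, mul_one]
  exact norm_fderiv_le_of_lipschitz ℝ hχ

/-- The constant is crude. It serves only to show that products lie in `W^{1,∞}` and that the
supremum in `localNorm` is finite, so it never reaches the final estimate. -/
lemma norm_mulGrad_le {χ : Euc n → ℝ} {L : NNReal} (hχ : LipschitzWith L χ)
    (h1 : ∀ x, |χ x| ≤ 1) (u : Euc n → Euc m) (w : Euc n → EucMat m n) (x : Euc n) :
    ‖mulGrad χ u w x‖ ≤ ‖w x‖ + m * n * L * ‖u x‖ := by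
  refine (norm_add_le _ _).trans (add_le_add ?_ ?_)
  · rw [norm_smul]
    exact mul_le_of_le_one_left (norm_nonneg _) (h1 x)
  · refine (norm_sum_le _ _).trans ?_
    calc ∑ i : Fin m, ‖∑ j, (u x i * fderiv ℝ χ x (EuclideanSpace.single j 1)) •
          (EuclideanSpace.single (i, j) 1 : EucMat m n)‖
        ≤ ∑ i : Fin m, ∑ j : Fin n, ‖u x‖ * L := by
          refine Finset.sum_le_sum fun i _ => (norm_sum_le _ _).trans
            (Finset.sum_le_sum fun j _ => ?_)
          rw [norm_smul_single, abs_mul]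
          exact mul_le_mul (PiLp.norm_apply_le (u x) i) (abs_fderiv_single_le hχ x j)
            (abs_nonneg _) (norm_nonneg _)
      _ = m * n * L * ‖u x‖ := by simp; ring

lemma aestronglyMeasurable_mulGrad {V : Set (Euc n)} {χ : Euc n → ℝ} (hχ : Continuous χ)
    {u : Euc n → Euc m} {w : Euc n → EucMat m n}
    (hu : AEStronglyMeasurable u (volume.restrict V))
    (hw : AEStronglyMeasurable w (volume.restrict V)) :
    AEStronglyMeasurable (mulGrad χ u w) (volume.restrict V) := by
  refine (hχ.aestronglyMeasurable.smul hw).add ?_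
  refine Finset.aestronglyMeasurable_fun_sum _ fun i _ =>
    Finset.aestronglyMeasurable_fun_sum _ fun j _ => ?_
  refine AEStronglyMeasurable.smul_const (AEStronglyMeasurable.mul ?_ ?_) _
  · exact (EuclideanSpace.proj (𝕜 := ℝ) i).continuous.comp_aestronglyMeasurable hu
  · exact (measurable_fderiv_apply_const ℝ χ _).aestronglyMeasurable

/-- Testing `χφ` with `η` amounts to testing `φ` with `χη`, up to the term with `Dχ`. -/
lemma exists_lipschitz_mul {V : Set (Euc n)} (hV : IsOpen V) (φ : W1Inf V m) {χ : Euc n → ℝ}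
    {L : NNReal} (hχ : LipschitzWith L χ) (h1 : ∀ x, |χ x| ≤ 1) :
    ∃ ψ : W1Inf V m, (val ψ =ᵐ[volume.restrict V] fun x => χ x • val φ x) ∧
      grad ψ =ᵐ[volume.restrict V] mulGrad χ (val φ) (grad φ) := by
  have hu : MemLp (fun x => χ x • val φ x) ⊤ (volume.restrict V) := by
    refine memLp_top_of_bound (hχ.continuous.aestronglyMeasurable.smul (Lp.memLp φ.1.1).1)
      ‖φ.1.1‖ ?_
    filter_upwards [ae_norm_le_norm φ.1.1] with x hx
    rw [norm_smul]
    exact (mul_le_of_le_one_left (norm_nonneg _) (h1 x)).trans hx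
  have hw : MemLp (mulGrad χ (val φ) (grad φ)) ⊤ (volume.restrict V) := by
    refine memLp_top_of_bound (aestronglyMeasurable_mulGrad hχ.continuous (Lp.memLp φ.1.1).1
      (Lp.memLp φ.1.2).1) (‖φ.1.2‖ + m * n * L * ‖φ.1.1‖) ?_
    filter_upwards [ae_norm_le_norm φ.1.1, ae_norm_le_norm φ.1.2] with x hx hx'
    refine (norm_mulGrad_le hχ h1 _ _ x).trans (add_le_add hx' ?_)
    exact mul_le_mul_of_nonneg_left hx (by positivity)
  refine ⟨⟨(hu.toLp, hw.toLp), ?_⟩, hu.coeFn_toLp, hw.coeFn_toLp⟩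
  intro i j η hη hc hs
  set e : Euc n := EuclideanSpace.single j 1
  obtain ⟨D, hD⟩ := hη.lipschitzWith_of_hasCompactSupport hc (by simp)
  obtain ⟨B, hB⟩ := hc.exists_bound_of_continuous hη.continuous
  have hB0 : 0 ≤ B := (norm_nonneg _).trans (hB 0)
  -- The product `χη` is no longer smooth; this is where Lipschitz test functions are indispensable.
  have hLip := lipschitzWith_mul_of_bounded (A := 1) (B := ⟨B, hB0⟩) hχ hD h1 hB
  have key := W1Inf.integral_mul_fderiv hV φ i j hLip hc.mul_left
    ((closure_mono (Function.support_mul_subset_right _ _)).trans hs)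
  have hae : ∀ᵐ x, fderiv ℝ (fun x => χ x * η x) x e =
      χ x * fderiv ℝ η x e + η x * fderiv ℝ χ x e := by
    filter_upwards [hχ.ae_differentiableAt] with x hx
    have := (hx.hasFDerivAt.mul (hη.differentiable (by simp) x).hasFDerivAt).fderiv
    have h2 : fderiv ℝ (fun x => χ x * η x) x = χ x • fderiv ℝ η x + η x • fderiv ℝ χ x := this
    rw [h2]
    simp
  have hηe : Continuous fun x => fderiv ℝ η x e :=
    (hη.continuous_fderiv (by simp)).clm_apply continuous_const
  have i1 : Integrable (fun x => val φ x i * (χ x * fderiv ℝ η x e)) (volume.restrict V) :=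
    integrable_mul_test φ.1.1 i (hχ.continuous.mul hηe) (hc.fderiv_apply ℝ _).mul_left
  have i2 : Integrable (fun x => val φ x i * η x * fderiv ℝ χ x e) (volume.restrict V) :=
    (integrable_mul_test φ.1.1 i hη.continuous hc).mul_bdd (c := L)
      (measurable_fderiv_apply_const ℝ χ _).aestronglyMeasurable
      (Eventually.of_forall fun x => abs_fderiv_single_le hχ x j)
  have i3 : Integrable (fun x => grad φ x (i, j) * (χ x * η x)) (volume.restrict V) :=
    integrable_mul_test φ.1.2 (i, j) (hχ.continuous.mul hη.continuous) hc.mul_left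
  have e1 : ∫ x in V, val φ x i * fderiv ℝ (fun x => χ x * η x) x e =
      (∫ x in V, val φ x i * (χ x * fderiv ℝ η x e)) +
      ∫ x in V, val φ x i * η x * fderiv ℝ χ x e := by
    rw [← integral_add i1 i2]
    refine integral_congr_ae ?_
    filter_upwards [ae_restrict_of_ae hae] with x hx
    rw [hx]
    ring
  have e2 : ∫ x in V, hu.toLp _ x i * fderiv ℝ η x e =
      ∫ x in V, val φ x i * (χ x * fderiv ℝ η x e) := by
    refine integral_congr_ae ?_
    filter_upwards [hu.coeFn_toLp] with x hx
    rw [hx, PiLp.smul_apply, smul_eq_mul]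
    ring
  have e3 : ∫ x in V, hw.toLp _ x (i, j) * η x =
      (∫ x in V, grad φ x (i, j) * (χ x * η x)) + ∫ x in V, val φ x i * η x * fderiv ℝ χ x e := by
    rw [← integral_add i3 i2]
    refine integral_congr_ae ?_
    filter_upwards [hw.coeFn_toLp] with x hx
    rw [hx, mulGrad_apply]
    ring
  change ∫ x in V, hu.toLp _ x i * fderiv ℝ η x e = - ∫ x in V, hw.toLp _ x (i, j) * η x
  rw [e2, e3]
  rw [e1] at key
  linarith

lemma locallyIntegrableOn_coord {V : Set (Euc n)} {ι : Type*} [Fintype ι]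
    (p : Lp (EuclideanSpace ℝ ι) ⊤ (volume.restrict V)) (i : ι) :
    LocallyIntegrableOn (fun x => p x i) V := by
  intro x _
  refine ⟨V ∩ Metric.ball x 1, inter_mem self_mem_nhdsWithin
    (mem_nhdsWithin_of_mem_nhds (Metric.ball_mem_nhds x one_pos)), ?_⟩
  refine ⟨((EuclideanSpace.proj (𝕜 := ℝ) i).continuous.comp_aestronglyMeasurable
    (Lp.memLp p).1).mono_measure (Measure.restrict_mono inter_subset_left le_rfl), ?_⟩
  refine HasFiniteIntegral.restrict_of_bounded (C := ‖p‖)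
    ((measure_mono inter_subset_right).trans_lt measure_ball_lt_top) ?_
  refine ae_restrict_of_ae_restrict_of_subset inter_subset_left ?_
  filter_upwards [ae_norm_le_norm p] with y hy
  exact (PiLp.norm_apply_le (p y) i).trans hy

/-- By the fundamental lemma of the calculus of variations the weak derivative is unique. It makes
the element `χφ` in `localNorm` unambiguous. -/
lemma W1Inf.ext_val {V : Set (Euc n)} (hV : IsOpen V) {φ ψ : W1Inf V m}
    (h : val φ =ᵐ[volume.restrict V] val ψ) : φ = ψ := by
  have h0 : ∀ i j, ∀ᵐ x, x ∈ V → grad φ x (i, j) - grad ψ x (i, j) = 0 := by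
    intro i j
    refine hV.ae_eq_zero_of_integral_contDiff_smul_eq_zero
      ((locallyIntegrableOn_coord φ.1.2 (i, j)).sub (locallyIntegrableOn_coord ψ.1.2 (i, j)))
      fun η hη hc hs => ?_
    have e0 : ∫ x, η x • (grad φ x (i, j) - grad ψ x (i, j)) =
        ∫ x in V, (grad φ x (i, j) * η x - grad ψ x (i, j) * η x) := by
      rw [← setIntegral_eq_integral_of_forall_compl_eq_zero (s := V)]
      · congr 1
        funext x
        rw [smul_eq_mul]
        ring
      · intro x hx
        rw [image_eq_zero_of_notMem_tsupport fun h => hx (hs h), zero_smul]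
    have e1 := φ.2 i j η hη hc hs
    have e2 := ψ.2 i j η hη hc hs
    have e3 : ∫ x in V, φ.1.1 x i * fderiv ℝ η x (EuclideanSpace.single j 1) =
        ∫ x in V, ψ.1.1 x i * fderiv ℝ η x (EuclideanSpace.single j 1) := by
      refine integral_congr_ae ?_
      filter_upwards [h] with x hx
      have : φ.1.1 x = ψ.1.1 x := hx
      rw [this]
    have e4 := integral_sub (integrable_mul_test φ.1.2 (i, j) hη.continuous hc)
      (integrable_mul_test ψ.1.2 (i, j) hη.continuous hc)
    refine e0.trans (e4.trans ?_)
    rw [e1, e2] at e3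
    linarith
  refine Subtype.ext (Prod.ext (Lp.ext h) (Lp.ext ?_))
  have h1 : ∀ᵐ x, ∀ i j, x ∈ V → grad φ x (i, j) - grad ψ x (i, j) = 0 :=
    ae_all_iff.2 fun i => ae_all_iff.2 fun j => h0 i j
  filter_upwards [ae_restrict_of_ae h1, ae_restrict_mem hV.measurableSet] with x hx hxV
  ext ⟨i, j⟩
  exact sub_eq_zero.1 (hx i j hxV)

/-- Test functions supported in `V` are test functions on `U`, and the integrands vanish on `U \ V`.
-/
lemma W1Inf.exists_restrict {U V : Set (Euc n)} (hU : IsOpen U) (hVU : V ⊆ U)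
    (φ : W1Inf U m) :
    ∃ ψ : W1Inf V m, (val ψ =ᵐ[volume.restrict V] val φ) ∧
      grad ψ =ᵐ[volume.restrict V] grad φ := by
  have hu : MemLp (val φ) ⊤ (volume.restrict V) :=
    (Lp.memLp φ.1.1).mono_measure (Measure.restrict_mono hVU le_rfl)
  have hw : MemLp (grad φ) ⊤ (volume.restrict V) :=
    (Lp.memLp φ.1.2).mono_measure (Measure.restrict_mono hVU le_rfl)
  refine ⟨⟨(hu.toLp, hw.toLp), ?_⟩, hu.coeFn_toLp, hw.coeFn_toLp⟩
  intro i j η hη hc hs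
  have e1 : ∫ x in V, hu.toLp _ x i * fderiv ℝ η x (EuclideanSpace.single j 1) =
      ∫ x in U, val φ x i * fderiv ℝ η x (EuclideanSpace.single j 1) := by
    rw [setIntegral_eq_of_subset_of_forall_sdiff_eq_zero hU.measurableSet hVU]
    · refine integral_congr_ae ?_
      filter_upwards [hu.coeFn_toLp] with x hx
      rw [hx]
    · intro x hx
      have : fderiv ℝ η x = 0 := by
        by_contra h0
        exact hx.2 (hs (support_fderiv_subset ℝ h0))
      simp [this]
  have e2 : ∫ x in V, hw.toLp _ x (i, j) * η x = ∫ x in U, grad φ x (i, j) * η x := by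
    rw [setIntegral_eq_of_subset_of_forall_sdiff_eq_zero hU.measurableSet hVU]
    · refine integral_congr_ae ?_
      filter_upwards [hw.coeFn_toLp] with x hx
      rw [hx]
    · intro x hx
      rw [image_eq_zero_of_notMem_tsupport fun h => hx.2 (hs h), mul_zero]
  change ∫ x in V, hu.toLp _ x i * _ = - ∫ x in V, hw.toLp _ x (i, j) * η x
  rw [e1, e2]
  exact φ.2 i j η hη hc (hs.trans hVU)

end Sobolev

section LocalNorm

variable {n m : ℕ}

/-! ### The tent function and the localized functional -/

section Tent

variable {K : Set (Euc n)} {δ : ℝ}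

/-- The empty set is treated apart: `infDist` to it is `0` by convention, so the clamped formula
`tent_eq` would give `1`. -/
lemma tent_empty (x : Euc n) : tent (∅ : Set (Euc n)) δ x = 0 := by
  simp [tent]

lemma tent_eq (hK : K.Nonempty) (hδ : 0 < δ) (x : Euc n) :
    tent K δ x = max 0 (min 1 (2 - 2 / δ * Metric.infDist x K)) := by
  have e : 2 / δ * Metric.infDist x K = 2 * (Metric.infDist x K / δ) := by ring
  rw [tent, Metric.mem_thickening_iff_infDist_lt hK, Metric.mem_thickening_iff_infDist_lt hK, e]
  split_ifs with h1 h2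
  · have : Metric.infDist x K / δ < 1 / 2 := by rw [div_lt_iff₀ hδ]; linarith
    rw [min_eq_left (by linarith), max_eq_right zero_le_one]
  · have h3 : Metric.infDist x K / δ < 1 := by rw [div_lt_iff₀ hδ]; linarith
    have h4 : 1 / 2 ≤ Metric.infDist x K / δ := by rw [le_div_iff₀ hδ]; linarith
    rw [min_eq_right (by linarith), max_eq_right (by linarith)]
  · have h3 : 1 ≤ Metric.infDist x K / δ := by rw [le_div_iff₀ hδ]; linarith
    rw [min_eq_right (by linarith), max_eq_left (by linarith)]

lemma tent_nonneg (hδ : 0 < δ) (x : Euc n) : 0 ≤ tent K δ x := by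
  rcases K.eq_empty_or_nonempty with rfl | hK
  · rw [tent_empty]
  · rw [tent_eq hK hδ]
    exact le_max_left _ _

lemma abs_tent_le_one (hδ : 0 < δ) (x : Euc n) : |tent K δ x| ≤ 1 := by
  rw [abs_of_nonneg (tent_nonneg hδ x)]
  rcases K.eq_empty_or_nonempty with rfl | hK
  · simp [tent_empty]
  · rw [tent_eq hK hδ]
    exact max_le zero_le_one (min_le_left _ _)

lemma exists_lipschitzWith_tent (hδ : 0 < δ) : ∃ L, LipschitzWith L (tent K δ) := by
  rcases K.eq_empty_or_nonempty with rfl | hK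
  · exact ⟨0, LipschitzWith.of_dist_le_mul fun x y => by simp [tent_empty]⟩
  · refine ⟨(2 / δ).toNNReal, ?_⟩
    have h1 : LipschitzWith (2 / δ).toNNReal fun x => 2 - 2 / δ * Metric.infDist x K := by
      refine LipschitzWith.of_dist_le_mul fun x y => ?_
      have := (Metric.lipschitz_infDist_pt K).dist_le_mul x y
      rw [Real.dist_eq] at this ⊢
      rw [Real.coe_toNNReal _ (by positivity), show 2 - 2 / δ * Metric.infDist x K -
        (2 - 2 / δ * Metric.infDist y K) =
          -(2 / δ * (Metric.infDist x K - Metric.infDist y K)) by ring, abs_neg, abs_mul,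
        abs_of_nonneg (by positivity : 0 ≤ 2 / δ)]
      refine mul_le_mul_of_nonneg_left ?_ (by positivity)
      simpa using this
    have h2 := (h1.const_min 1).const_max 0
    exact (funext fun x => tent_eq hK hδ x : tent K δ = _) ▸ h2

lemma tent_eq_one {x : Euc n} (hx : x ∈ Metric.thickening (δ / 2) K) : tent K δ x = 1 := if_pos hx

lemma tent_eq_zero (hδ : 0 < δ) {x : Euc n} (hx : x ∉ Metric.thickening δ K) : tent K δ x = 0 := by
  rw [tent, if_neg fun h => hx (Metric.thickening_mono (by linarith) K h), if_neg hx]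

/-- Points outside the open set `K_δ`, including its boundary, are minima of the tent function. Thus
it is not necessary to know that the boundary is a null set. -/
lemma fderiv_tent_eq_zero (hδ : 0 < δ) {x : Euc n} (hx : x ∉ Metric.thickening δ K) :
    fderiv ℝ (tent K δ) x = 0 := by
  refine IsLocalMin.fderiv_eq_zero (Eventually.of_forall fun y => ?_)
  rw [tent_eq_zero hδ hx]
  exact tent_nonneg hδ y

end Tent

variable {U K : Set (Euc n)} {δ : ℝ}

lemma isOpen_nbhd (hU : IsOpen U) : IsOpen (nbhd U K δ) := Metric.isOpen_thickening.inter hU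

lemma nbhd_subset : nbhd U K δ ⊆ U := inter_subset_right

lemma eLpNorm_top_le_iff {α E : Type*} [MeasurableSpace α] [NormedAddCommGroup E] {ν : Measure α}
    {f : α → E} {C : ℝ} (hC : 0 ≤ C) :
    eLpNorm f ⊤ ν ≤ ENNReal.ofReal C ↔ ∀ᵐ x ∂ν, ‖f x‖ ≤ C := by
  rw [eLpNorm_exponent_top]
  refine ⟨fun h => ?_, eLpNormEssSup_le_of_ae_bound⟩
  filter_upwards [ae_le_eLpNormEssSup (f := f) (μ := ν)] with x hx
  have := hx.trans h
  rwa [← ofReal_norm, ENNReal.ofReal_le_ofReal_iff hC] at this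

lemma eLpNorm_top_le_one_iff {α E : Type*} [MeasurableSpace α] [NormedAddCommGroup E]
    {ν : Measure α} {f : α → E} : eLpNorm f ⊤ ν ≤ 1 ↔ ∀ᵐ x ∂ν, ‖f x‖ ≤ 1 := by
  rw [← eLpNorm_top_le_iff zero_le_one, ENNReal.ofReal_one]

lemma W1Inf.norm_eq {V : Set (Euc n)} (φ : W1Inf V m) : ‖φ‖ = max ‖φ.1.1‖ ‖φ.1.2‖ := rfl

/-- The element `χφ` has the same value under `f`, as `χφ - φ` vanishes on `K_{δ/2} ∩ U`. Its norm
is controlled by `φ` on `V` alone, because `χ` and its derivative vanish off `K_δ`. -/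
lemma exists_tent_mul (hU : IsOpen U) (hδ : 0 < δ) (f : StrongDual ℝ (W1Inf U m))
    (hf : IsTrace K f) : ∃ C : ℝ, 0 ≤ C ∧ ∀ φ : W1Inf U m, ∃ ψ : W1Inf U m,
      (∀ᵐ x ∂(volume.restrict U), val ψ x = tent K δ x • val φ x) ∧ f ψ = f φ ∧
      ∀ a : ℝ, 0 ≤ a → (∀ᵐ x ∂(volume.restrict (nbhd U K δ)), ‖val φ x‖ ≤ a) →
        (∀ᵐ x ∂(volume.restrict (nbhd U K δ)), ‖grad φ x‖ ≤ a) → ‖ψ‖ ≤ C * a := by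
  obtain ⟨L, hL⟩ := exists_lipschitzWith_tent (K := K) hδ
  refine ⟨1 + m * n * L, by positivity, fun φ => ?_⟩
  obtain ⟨ψ, h1, h2⟩ := exists_lipschitz_mul hU φ hL (abs_tent_le_one hδ)
  refine ⟨ψ, h1, ?_, fun a ha hv hg => ?_⟩
  · rw [← sub_eq_zero, ← map_sub]
    refine hf _ ⟨δ / 2, by linarith, ?_⟩
    have h3 : val (ψ - φ) =ᵐ[volume.restrict U] val ψ - val φ := Lp.coeFn_sub ψ.1.1 φ.1.1
    filter_upwards [ae_restrict_of_ae_restrict_of_subset nbhd_subset h1,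
      ae_restrict_of_ae_restrict_of_subset nbhd_subset h3,
      ae_restrict_mem (isOpen_nbhd hU).measurableSet] with x h1 h3 hx
    rw [h3, Pi.sub_apply, h1, tent_eq_one hx.1, one_smul, sub_self]
  · have hV : MeasurableSet (nbhd U K δ) := (isOpen_nbhd hU).measurableSet
    have hv' := ae_restrict_of_ae (μ := volume) (s := U) ((ae_restrict_iff' hV).1 hv)
    have hg' := ae_restrict_of_ae (μ := volume) (s := U) ((ae_restrict_iff' hV).1 hg)
    have hC : (0 : ℝ) ≤ m * n * L := by positivity
    rw [W1Inf.norm_eq]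
    refine max_le (norm_le_of_ae_le (by positivity) ?_) (norm_le_of_ae_le (by positivity) ?_)
    · filter_upwards [h1, hv', ae_restrict_mem hU.measurableSet] with x h1 hv hx
      have e : ‖ψ.1.1 x‖ = ‖tent K δ x • val φ x‖ := congrArg norm h1
      rw [e, norm_smul]
      by_cases hxK : x ∈ Metric.thickening δ K
      · refine (mul_le_of_le_one_left (norm_nonneg _) (abs_tent_le_one hδ x)).trans ?_
        nlinarith [hv ⟨hxK, hx⟩]
      · rw [tent_eq_zero hδ hxK, norm_zero, zero_mul]
        positivity
    · filter_upwards [h2, hv', hg', ae_restrict_mem hU.measurableSet] with x h2 hv hg hx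
      have e : ‖ψ.1.2 x‖ = ‖mulGrad (tent K δ) (val φ) (grad φ) x‖ := congrArg norm h2
      rw [e]
      by_cases hxK : x ∈ Metric.thickening δ K
      · refine (norm_mulGrad_le hL (abs_tent_le_one hδ) _ _ x).trans ?_
        have h3 := hv ⟨hxK, hx⟩
        have h4 := hg ⟨hxK, hx⟩
        nlinarith [mul_le_mul_of_nonneg_left h3 hC]
      · simp only [mulGrad, tent_eq_zero hδ hxK, fderiv_tent_eq_zero hδ hxK,
          _root_.zero_apply, mul_zero, zero_smul, Finset.sum_const_zero, add_zero,
          norm_zero]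
        positivity

/-- Without this bound the real supremum `localNorm` would be the default value `0`. -/
lemma localNorm_set_bddAbove (hU : IsOpen U) (hδ : 0 < δ) (f : StrongDual ℝ (W1Inf U m))
    (hf : IsTrace K f) : BddAbove {r : ℝ | ∃ φ ψ : W1Inf U m,
      eLpNorm (val φ) ⊤ (volume.restrict (nbhd U K δ)) ≤ 1 ∧
      eLpNorm (grad φ) ⊤ (volume.restrict (nbhd U K δ)) ≤ 1 ∧
      (∀ᵐ x ∂(volume.restrict U), val ψ x = tent K δ x • val φ x) ∧ r = f ψ} := by
  obtain ⟨C, hC, h⟩ := exists_tent_mul hU hδ f hf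
  refine ⟨‖f‖ * (C * 1), ?_⟩
  rintro r ⟨φ, ψ, h1, h2, h3, rfl⟩
  obtain ⟨ψ', h4, h5, h6⟩ := h φ
  have : ψ = ψ' := W1Inf.ext_val hU (EventuallyEq.trans h3 (EventuallyEq.symm h4))
  subst this
  refine (le_abs_self _).trans ((f.le_opNorm ψ).trans ?_)
  exact mul_le_mul_of_nonneg_left (h6 1 zero_le_one (eLpNorm_top_le_one_iff.1 h1)
    (eLpNorm_top_le_one_iff.1 h2)) (norm_nonneg f)

lemma zero_mem_localNorm_set (f : StrongDual ℝ (W1Inf U m)) :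
    (0 : ℝ) ∈ {r : ℝ | ∃ φ ψ : W1Inf U m,
      eLpNorm (val φ) ⊤ (volume.restrict (nbhd U K δ)) ≤ 1 ∧
      eLpNorm (grad φ) ⊤ (volume.restrict (nbhd U K δ)) ≤ 1 ∧
      (∀ᵐ x ∂(volume.restrict U), val ψ x = tent K δ x • val φ x) ∧ r = f ψ} := by
  have h1 : val (0 : W1Inf U m) =ᵐ[volume.restrict U] 0 := Lp.coeFn_zero (Euc m) ⊤ _
  have h2 : grad (0 : W1Inf U m) =ᵐ[volume.restrict U] 0 := Lp.coeFn_zero (EucMat m n) ⊤ _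
  refine ⟨0, 0, eLpNorm_top_le_one_iff.2 ?_, eLpNorm_top_le_one_iff.2 ?_, ?_, by simp⟩
  · filter_upwards [ae_restrict_of_ae_restrict_of_subset nbhd_subset h1] with x hx
    simp [hx]
  · filter_upwards [ae_restrict_of_ae_restrict_of_subset nbhd_subset h2] with x hx
    simp [hx]
  · filter_upwards [h1] with x hx
    simp [hx]

lemma localNorm_nonneg (hU : IsOpen U) (hδ : 0 < δ) (f : StrongDual ℝ (W1Inf U m))
    (hf : IsTrace K f) : 0 ≤ localNorm K δ f :=
  le_csSup (localNorm_set_bddAbove hU hδ f hf) (zero_mem_localNorm_set f)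

lemma localNorm_le (hU : IsOpen U) (hδ : 0 < δ) (f : StrongDual ℝ (W1Inf U m))
    (hf : IsTrace K f) {c : ℝ} (h : ∀ φ : W1Inf U m,
      (∀ᵐ x ∂(volume.restrict (nbhd U K δ)), ‖val φ x‖ ≤ 1) →
      (∀ᵐ x ∂(volume.restrict (nbhd U K δ)), ‖grad φ x‖ ≤ 1) → f φ ≤ c) :
    localNorm K δ f ≤ c := by
  refine csSup_le ⟨0, zero_mem_localNorm_set f⟩ ?_
  rintro r ⟨φ, ψ, h1, h2, h3, rfl⟩
  obtain ⟨C, hC, h0⟩ := exists_tent_mul hU hδ f hf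
  obtain ⟨ψ', h4, h5, h6⟩ := h0 φ
  have : ψ = ψ' := W1Inf.ext_val hU (EventuallyEq.trans h3 (EventuallyEq.symm h4))
  rw [this, h5]
  exact h φ (eLpNorm_top_le_one_iff.1 h1) (eLpNorm_top_le_one_iff.1 h2)

/-- Scaling by `s⁻¹` with `s > t` and letting `s` decrease to `t` covers `t = 0` as well. -/
lemma apply_le_localNorm (hU : IsOpen U) (hδ : 0 < δ) (f : StrongDual ℝ (W1Inf U m))
    (hf : IsTrace K f) (φ : W1Inf U m) {t : ℝ} (ht : 0 ≤ t)
    (h1 : ∀ᵐ x ∂(volume.restrict (nbhd U K δ)), ‖val φ x‖ ≤ t)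
    (h2 : ∀ᵐ x ∂(volume.restrict (nbhd U K δ)), ‖grad φ x‖ ≤ t) :
    f φ ≤ localNorm K δ f * t := by
  have key : ∀ s, t < s → f φ ≤ localNorm K δ f * s := by
    intro s hs
    have hs0 : 0 < s := ht.trans_lt hs
    obtain ⟨C, hC, h0⟩ := exists_tent_mul hU hδ f hf
    obtain ⟨ψ, h4, h5, -⟩ := h0 (s⁻¹ • φ)
    have hv : val (s⁻¹ • φ) =ᵐ[volume.restrict U] s⁻¹ • val φ := Lp.coeFn_smul s⁻¹ φ.1.1
    have hg : grad (s⁻¹ • φ) =ᵐ[volume.restrict U] s⁻¹ • grad φ := Lp.coeFn_smul s⁻¹ φ.1.2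
    have hle : ∀ r : ℝ, r ≤ t → s⁻¹ * r ≤ 1 := fun r hr => by
      rw [inv_mul_le_iff₀ hs0]
      linarith
    have := le_csSup (localNorm_set_bddAbove hU hδ f hf) ⟨s⁻¹ • φ, ψ, eLpNorm_top_le_one_iff.2 ?_,
      eLpNorm_top_le_one_iff.2 ?_, h4, rfl⟩
    · rw [h5, map_smul, smul_eq_mul, inv_mul_le_iff₀ hs0] at this
      rwa [mul_comm]
    · filter_upwards [ae_restrict_of_ae_restrict_of_subset nbhd_subset hv, h1] with x hx h1
      rw [hx, Pi.smul_apply, norm_smul, norm_inv, Real.norm_of_nonneg hs0.le]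
      exact hle _ h1
    · filter_upwards [ae_restrict_of_ae_restrict_of_subset nbhd_subset hg, h2] with x hx h2
      rw [hx, Pi.smul_apply, norm_smul, norm_inv, Real.norm_of_nonneg hs0.le]
      exact hle _ h2
  refine ge_of_tendsto (f := fun s => localNorm K δ f * s) (x := 𝓝[>] t) ?_
    (eventually_nhdsWithin_of_forall key)
  exact (continuous_const.mul continuous_id).continuousWithinAt

end LocalNorm

section Functionals

variable {n m : ℕ}

/-! ### The essential supremum near a set -/

section EssSup

variable {E : Type*} [NormedAddCommGroup E]

/-- The infimum of `‖φ‖_{L^∞(K_r ∩ V)}` over `r > 0`. -/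
def essSupNear (V K : Set (Euc n)) (φ : Euc n → E) : ℝ :=
  (⨅ (r : ℝ) (_ : 0 < r), eLpNorm φ ⊤ (volume.restrict (nbhd V K r))).toReal

lemma seminormK_eq_essSupNear (V K : Set (Euc n)) (φ : Euc n → Euc m) :
    seminormK V K φ = essSupNear V K φ := rfl

lemma essSupNear_nonneg (V K : Set (Euc n)) (φ : Euc n → E) : 0 ≤ essSupNear V K φ :=
  ENNReal.toReal_nonneg

lemma essSupNear_le {V K : Set (Euc n)} {φ : Euc n → E} {r c : ℝ} (hr : 0 < r) (hc : 0 ≤ c)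
    (h : ∀ᵐ x ∂volume.restrict (nbhd V K r), ‖φ x‖ ≤ c) : essSupNear V K φ ≤ c :=
  ENNReal.toReal_le_of_le_ofReal hc
    ((iInf₂_le r hr).trans ((eLpNorm_top_le_iff hc).2 h))

/-- The a priori bound `hB` keeps the infimum finite; an infinite one would be sent to `0` by
`toReal`. -/
lemma exists_of_essSupNear_lt {V K : Set (Euc n)} {φ : Euc n → E} {B c : ℝ}
    (hB : ∀ᵐ x ∂volume.restrict V, ‖φ x‖ ≤ B) (h : essSupNear V K φ < c) :
    ∃ r : ℝ, 0 < r ∧ ∀ᵐ x ∂volume.restrict (nbhd V K r), ‖φ x‖ ≤ c := by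
  have hc : 0 < c := (essSupNear_nonneg V K φ).trans_lt h
  have hfin : (⨅ (r : ℝ) (_ : 0 < r), eLpNorm φ ⊤ (volume.restrict (nbhd V K r))) ≠ ⊤ := by
    refine ne_top_of_le_ne_top (b := ENNReal.ofReal (max B 0)) ENNReal.ofReal_ne_top
      ((iInf₂_le 1 one_pos).trans ((eLpNorm_top_le_iff (le_max_right _ _)).2 ?_))
    filter_upwards [ae_restrict_of_ae_restrict_of_subset nbhd_subset hB] with x hx
    exact hx.trans (le_max_left _ _)
  rw [essSupNear, ← ENNReal.lt_ofReal_iff_toReal_lt hfin] at h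
  obtain ⟨r, h⟩ := iInf_lt_iff.1 h
  obtain ⟨hr, hlt⟩ := iInf_lt_iff.1 h
  exact ⟨r, hr, (eLpNorm_top_le_iff hc.le).1 hlt.le⟩

lemma nbhd_mono {V K : Set (Euc n)} {r s : ℝ} (h : r ≤ s) : nbhd V K r ⊆ nbhd V K s :=
  inter_subset_inter_left _ (Metric.thickening_mono h K)

/-- Consequently `essSupNear V univ` is the norm of `L^∞(V)`, so one extension lemma serves both the
general case and case (L). -/
lemma nbhd_univ {V : Set (Euc n)} {r : ℝ} (hr : 0 < r) : nbhd V univ r = V := by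
  have : Metric.thickening r (univ : Set (Euc n)) = univ :=
    univ_subset_iff.1 (Metric.self_subset_thickening hr univ)
  rw [nbhd, this, univ_inter]

lemma essSupNear_congr {V K : Set (Euc n)} {φ ψ : Euc n → E} (h : φ =ᵐ[volume.restrict V] ψ) :
    essSupNear V K φ = essSupNear V K ψ := by
  unfold essSupNear
  congr 1
  refine iInf_congr fun r => iInf_congr fun _ => ?_
  exact eLpNorm_congr_ae (ae_restrict_of_ae_restrict_of_subset nbhd_subset h)

lemma essSupNear_add_le {V K : Set (Euc n)} {φ ψ : Euc n → E} {A B : ℝ}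
    (hA : ∀ᵐ x ∂volume.restrict V, ‖φ x‖ ≤ A) (hB : ∀ᵐ x ∂volume.restrict V, ‖ψ x‖ ≤ B) :
    essSupNear V K (φ + ψ) ≤ essSupNear V K φ + essSupNear V K ψ := by
  refine le_of_forall_pos_le_add fun ε hε => ?_
  obtain ⟨r, hr, h1⟩ := exists_of_essSupNear_lt hA
    (lt_add_of_pos_right (essSupNear V K φ) (half_pos hε))
  obtain ⟨s, hs, h2⟩ := exists_of_essSupNear_lt hB
    (lt_add_of_pos_right (essSupNear V K ψ) (half_pos hε))
  have := essSupNear_nonneg V K φ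
  have := essSupNear_nonneg V K ψ
  refine essSupNear_le (lt_min hr hs) (by positivity) ?_
  filter_upwards [ae_restrict_of_ae_restrict_of_subset (nbhd_mono (min_le_left r s)) h1,
    ae_restrict_of_ae_restrict_of_subset (nbhd_mono (min_le_right r s)) h2] with x h1 h2
  refine (norm_add_le _ _).trans ?_
  linarith

lemma essSupNear_smul_le [NormedSpace ℝ E] {V K : Set (Euc n)} {φ : Euc n → E} {A : ℝ} (c : ℝ)
    (hA : ∀ᵐ x ∂volume.restrict V, ‖φ x‖ ≤ A) :
    essSupNear V K (c • φ) ≤ ‖c‖ * essSupNear V K φ := by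
  have h0 := essSupNear_nonneg V K φ
  refine ge_of_tendsto (f := fun s => ‖c‖ * s) (x := 𝓝[>] (essSupNear V K φ))
    (continuous_const.mul continuous_id).continuousWithinAt
    (eventually_nhdsWithin_of_forall fun s hs => ?_)
  obtain ⟨r, hr, h1⟩ := exists_of_essSupNear_lt hA hs
  refine essSupNear_le hr (mul_nonneg (norm_nonneg c) (h0.trans (le_of_lt hs))) ?_
  filter_upwards [h1] with x hx
  rw [Pi.smul_apply, norm_smul]
  gcongr

lemma essSupNear_eq_zero {V K : Set (Euc n)} {φ : Euc n → E} {r : ℝ} (hr : 0 < r)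
    (h : ∀ᵐ x ∂volume.restrict (nbhd V K r), φ x = 0) : essSupNear V K φ = 0 :=
  le_antisymm (essSupNear_le hr le_rfl (h.mono fun x hx => by rw [hx, norm_zero]))
    (essSupNear_nonneg _ _ _)

variable {U V : Set (Euc n)}

lemma ae_norm_le_of_subset (hVU : V ⊆ U) (φ : Lp E ⊤ (volume.restrict U)) :
    ∀ᵐ x ∂volume.restrict V, ‖φ x‖ ≤ ‖φ‖ :=
  ae_restrict_of_ae_restrict_of_subset hVU (ae_norm_le_norm φ)

/-- `essSupNear` as a seminorm on `L^∞`. -/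
def essSeminorm [NormedSpace ℝ E] (hVU : V ⊆ U) (K : Set (Euc n)) :
    Seminorm ℝ (Lp E ⊤ (volume.restrict U : Measure (Euc n))) :=
  Seminorm.ofSMulLE (fun φ => essSupNear V K φ)
    (essSupNear_eq_zero one_pos (ae_restrict_of_ae_restrict_of_subset
      (nbhd_subset.trans hVU) (Lp.coeFn_zero E ⊤ _)))
    (fun φ ψ => (essSupNear_congr (ae_restrict_of_ae_restrict_of_subset hVU
      (Lp.coeFn_add φ ψ))).trans_le
        (essSupNear_add_le (ae_norm_le_of_subset hVU φ) (ae_norm_le_of_subset hVU ψ)))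
    (fun c φ => (essSupNear_congr (ae_restrict_of_ae_restrict_of_subset hVU
      (Lp.coeFn_smul c φ))).trans_le (essSupNear_smul_le c (ae_norm_le_of_subset hVU φ)))

lemma essSupNear_le_norm (hVU : V ⊆ U) (K : Set (Euc n)) (φ : Lp E ⊤ (volume.restrict U)) :
    essSupNear V K φ ≤ ‖φ‖ :=
  essSupNear_le one_pos (norm_nonneg _)
    (ae_restrict_of_ae_restrict_of_subset nbhd_subset (ae_norm_le_of_subset hVU φ))

end EssSup

/-! ### Extension of functionals -/

/-- The norm dual to a maximum is a sum: the supremum is taken over `x` with `y` fixed, and then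
over `y`. -/
lemma norm_add_norm_le {X Y : Type*} [NormedAddCommGroup X] [NormedSpace ℝ X]
    [NormedAddCommGroup Y] [NormedSpace ℝ Y] (F : StrongDual ℝ X) (G : StrongDual ℝ Y) {c : ℝ}
    (h : ∀ x y, ‖x‖ ≤ 1 → ‖y‖ ≤ 1 → F x + G y ≤ c) : ‖F‖ + ‖G‖ ≤ c := by
  have h1 : ∀ y, ‖y‖ ≤ 1 → ‖F‖ ≤ c - G y := fun y hy => by
    refine ContinuousLinearMap.opNorm_le_of_unit_norm ?_ fun x hx => abs_le.2 ⟨?_, ?_⟩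
    · simpa using h 0 y (by simp) hy
    · have := h (-x) y (by rw [norm_neg, hx]) hy
      rw [map_neg] at this
      linarith
    · linarith [h x y hx.le hy]
  have h2 : ‖G‖ ≤ c - ‖F‖ := by
    refine ContinuousLinearMap.opNorm_le_of_unit_norm ?_ fun y hy => abs_le.2 ⟨?_, ?_⟩
    · simpa using h1 0 (by simp)
    · have := h1 (-y) (by rw [norm_neg, hy])
      rw [map_neg] at this
      linarith
    · linarith [h1 y hy.le]
  linarith

lemma exists_functionals {U V K : Set (Euc n)} (hVU : V ⊆ U) (f : StrongDual ℝ (W1Inf U m)) {c : ℝ}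
    (hc : 0 ≤ c)
    (h : ∀ φ, f φ ≤ c * max (essSupNear V K (val φ)) (essSupNear V univ (grad φ))) :
    ∃ (F : StrongDual ℝ (Lp (Euc m) ⊤ (volume.restrict U)))
      (G : StrongDual ℝ (Lp (EucMat m n) ⊤ (volume.restrict U))),
      (∀ φ, f φ = F φ.1.1 + G φ.1.2) ∧ ‖F‖ + ‖G‖ ≤ c ∧
      (∀ x, |F x| ≤ c * essSupNear V K x) ∧ ∀ y, |G y| ≤ c * essSupNear V univ y := by
  let s₁ : Seminorm ℝ (Lp (Euc m) ⊤ (volume.restrict U : Measure (Euc n))) := essSeminorm hVU K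
  let s₂ : Seminorm ℝ (Lp (EucMat m n) ⊤ (volume.restrict U : Measure (Euc n))) :=
    essSeminorm hVU univ
  let c' : NNReal := ⟨c, hc⟩
  let p : Seminorm ℝ (Lp (Euc m) ⊤ (volume.restrict U) × Lp (EucMat m n) ⊤ (volume.restrict U)) :=
    c' • (s₁.comp (LinearMap.fst ℝ (Lp (Euc m) ⊤ (volume.restrict U))
      (Lp (EucMat m n) ⊤ (volume.restrict U))) ⊔
      s₂.comp (LinearMap.snd ℝ (Lp (Euc m) ⊤ (volume.restrict U))
        (Lp (EucMat m n) ⊤ (volume.restrict U))))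
  have hp : ∀ x y, p (x, y) = c * max (essSupNear V K x) (essSupNear V univ y) := fun x y => rfl
  have hfp : ∀ φ : W1Inf U m, ‖f.toLinearMap φ‖ ≤ p φ.1 := fun φ => by
    refine abs_le.2 ⟨?_, h φ⟩
    have h1 := h (-φ)
    rw [map_neg] at h1
    have h2 : c * max (essSupNear V K (val (-φ))) (essSupNear V univ (grad (-φ))) = p φ.1 :=
      map_neg_eq_map p φ.1
    rw [h2] at h1
    exact neg_le.1 h1
  -- Hahn–Banach from the subspace `W1Inf U m` to the whole product. Evaluation at `(x, 0)` and `(0,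
  -- y)` then splits the extension into two functionals, each dominated by its own seminorm.
  obtain ⟨F, hF, hFp⟩ := Module.Dual.exists_extension_of_le_seminorm (W1Inf U m)
    f.toLinearMap hfp
  have hF1 : ∀ x, |F (x, 0)| ≤ c * essSupNear V K x := fun x => by
    refine (hFp (x, 0)).trans_eq ?_
    rw [hp, show essSupNear V univ ((0 : Lp (EucMat m n) ⊤ (volume.restrict U))) = 0 from
      map_zero (essSeminorm hVU univ), max_eq_left (essSupNear_nonneg _ _ _)]
  have hF2 : ∀ y, |F (0, y)| ≤ c * essSupNear V univ y := fun y => by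
    refine (hFp (0, y)).trans_eq ?_
    rw [hp, show essSupNear V K ((0 : Lp (Euc m) ⊤ (volume.restrict U))) = 0 from
      map_zero (essSeminorm hVU K), max_eq_right (essSupNear_nonneg _ _ _)]
  let F1 : StrongDual ℝ (Lp (Euc m) ⊤ (volume.restrict U)) :=
    (F.comp (LinearMap.inl ℝ _ _)).mkContinuous c fun x =>
      (hF1 x).trans (mul_le_mul_of_nonneg_left (essSupNear_le_norm hVU K x) hc)
  let F2 : StrongDual ℝ (Lp (EucMat m n) ⊤ (volume.restrict U)) :=
    (F.comp (LinearMap.inr ℝ _ _)).mkContinuous c fun y =>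
      (hF2 y).trans (mul_le_mul_of_nonneg_left (essSupNear_le_norm hVU univ y) hc)
  have hsum : ∀ x y, F1 x + F2 y = F (x, y) := fun x y => by
    change F (x, 0) + F (0, y) = F (x, y)
    rw [← map_add, Prod.mk_add_mk, add_zero, zero_add]
  refine ⟨F1, F2, fun φ => ?_, norm_add_norm_le F1 F2 fun x y hx hy => ?_, hF1, hF2⟩
  · rw [hsum]
    exact (hF φ).symm
  · rw [hsum]
    refine (le_abs_self _).trans ((hFp (x, y)).trans ?_)
    rw [hp]
    refine mul_le_of_le_one_right hc (max_le ?_ ?_)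
    · exact (essSupNear_le_norm hVU K x).trans hx
    · exact (essSupNear_le_norm hVU univ y).trans hy

lemma applyFun_eq_zero {U V K : Set (Euc n)} (hV : IsOpen V) {ι : Type*} [Fintype ι]
    (hVU : V ⊆ U) {F : StrongDual ℝ (Lp (EuclideanSpace ℝ ι) ⊤ (volume.restrict U))} {c : ℝ}
    (hF : ∀ x, |F x| ≤ c * essSupNear V K x) {r : ℝ} (hr : 0 < r)
    {g : Euc n → EuclideanSpace ℝ ι} (hg : ∀ x ∈ nbhd V K r, g x = 0) : applyFun F g = 0 := by
  by_cases h : MemLp g ⊤ (volume.restrict U)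
  · rw [applyFun_of_memLp F h, ← abs_nonpos_iff]
    refine (hF _).trans_eq ?_
    rw [essSupNear_eq_zero hr, mul_zero]
    filter_upwards [ae_restrict_of_ae_restrict_of_subset (nbhd_subset.trans hVU) h.coeFn_toLp,
      ae_restrict_mem (isOpen_nbhd hV).measurableSet] with x h1 h2
    rw [h1, hg x h2]
  · rw [applyFun, dif_neg h]

lemma core_subset_closure {U V K : Set (Euc n)} (hV : IsOpen V) {ι : Type*} [Fintype ι]
    [DecidableEq ι]
    (hVU : V ⊆ U) {F : StrongDual ℝ (Lp (EuclideanSpace ℝ ι) ⊤ (volume.restrict U))} {c : ℝ}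
    (hF : ∀ x, |F x| ≤ c * essSupNear V K x) : core (ofDual F) ⊆ closure V := by
  refine core_ofDual_subset F fun x hx => ⟨(closure V)ᶜ, isClosed_closure.isOpen_compl, hx,
    fun g hg => applyFun_eq_zero hV hVU hF one_pos fun y hy => hg y ?_⟩
  exact fun h => h (subset_closure (nbhd_subset hy))

/-- If the ball of radius `ε` about `x` misses `K`, then the ball of radius `ε / 2` misses the `ε /
2`-neighbourhood of `K`, so functions supported there are invisible to `F`. -/
lemma core_subset {U V K : Set (Euc n)} (hV : IsOpen V) (hK : IsClosed K) {ι : Type*} [Fintype ι]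
    [DecidableEq ι]
    (hVU : V ⊆ U) {F : StrongDual ℝ (Lp (EuclideanSpace ℝ ι) ⊤ (volume.restrict U))} {c : ℝ}
    (hF : ∀ x, |F x| ≤ c * essSupNear V K x) : core (ofDual F) ⊆ K := by
  refine core_ofDual_subset F fun x hx => ?_
  obtain ⟨ε, hε, hb⟩ := Metric.isOpen_iff.1 hK.isOpen_compl x hx
  refine ⟨Metric.ball x (ε / 2), Metric.isOpen_ball, Metric.mem_ball_self (half_pos hε),
    fun g hg => applyFun_eq_zero hV hVU hF (half_pos hε) fun y hy => hg y fun hyx => ?_⟩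
  obtain ⟨z, hz, hyz⟩ := Metric.mem_thickening_iff.1 hy.1
  refine hb (Metric.mem_ball.2 ?_) hz
  have := dist_triangle_left z x y
  rw [Metric.mem_ball] at hyx
  linarith

lemma hasVecIntegral_of_applyFun {U A : Set (Euc n)} (hU : IsOpen U) (hA : MeasurableSet A)
    {ι : Type*} [Fintype ι] [DecidableEq ι]
    {F : StrongDual ℝ (Lp (EuclideanSpace ℝ ι) ⊤ (volume.restrict U))}
    {g : Euc n → EuclideanSpace ℝ ι}
    (hg : MemLp g ⊤ (volume.restrict U)) (h : applyFun F (A.indicator g) = applyFun F g) :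
    HasVecIntegral (ofDual F) A g (applyFun F g) := by
  rw [← h]
  exact hasVecIntegral_ofDual F hU.measurableSet (hg.indicator hA)

lemma applyFun_indicator {U V K A : Set (Euc n)} (hV : IsOpen V) {ι : Type*} [Fintype ι]
    (hVU : V ⊆ U) {F : StrongDual ℝ (Lp (EuclideanSpace ℝ ι) ⊤ (volume.restrict U))} {c : ℝ}
    (hF : ∀ x, |F x| ≤ c * essSupNear V K x) {r : ℝ} (hr : 0 < r) (hA : MeasurableSet A)
    (hKA : nbhd V K r ⊆ A) {g : Euc n → EuclideanSpace ℝ ι}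
    (hg : MemLp g ⊤ (volume.restrict U)) : applyFun F (A.indicator g) = applyFun F g := by
  rw [← sub_eq_zero, ← applyFun_sub F (hg.indicator hA) hg]
  refine applyFun_eq_zero hV hVU hF hr fun x hx => ?_
  rw [Pi.sub_apply, indicator_of_mem (hKA hx), sub_self]

/-- The set `K'` is `univ` in the general case and `K` in the other two. The constants are separate
because in case (C) the first functional is replaced by one with a different bound. -/
lemma represents_ofDual {U K K' : Set (Euc n)} (hU : IsOpen U) {δ : ℝ}
    {f : StrongDual ℝ (W1Inf U m)} {F : StrongDual ℝ (Lp (Euc m) ⊤ (volume.restrict U))}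
    {G : StrongDual ℝ (Lp (EucMat m n) ⊤ (volume.restrict U))} {c c' : ℝ}
    (hfFG : ∀ φ, f φ = F φ.1.1 + G φ.1.2)
    (hF : ∀ x, |F x| ≤ c * essSupNear (nbhd U K δ) K' x)
    (hG : ∀ y, |G y| ≤ c' * essSupNear (nbhd U K δ) univ y) :
    Represents K δ f (ofDual F) (ofDual G) := by
  have hV := isOpen_nbhd (K := K) (δ := δ) hU
  refine ⟨core_subset_closure hV nbhd_subset hF, core_subset_closure hV nbhd_subset hG,
    fun φ => ⟨applyFun F (val φ), applyFun G (grad φ), ?_, ?_, ?_⟩, ?_⟩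
  · exact hasVecIntegral_of_applyFun hU hV.measurableSet (Lp.memLp φ.1.1)
      (applyFun_indicator hV nbhd_subset hF one_pos hV.measurableSet nbhd_subset (Lp.memLp φ.1.1))
  · exact hasVecIntegral_of_applyFun hU hV.measurableSet (Lp.memLp φ.1.2)
      (applyFun_indicator hV nbhd_subset hG one_pos hV.measurableSet nbhd_subset (Lp.memLp φ.1.2))
  · rw [hfFG φ, ← applyFun_coe F, ← applyFun_coe G]
    rfl
  · rw [vecVariation_eq_baNorm F hV.measurableSet hU.measurableSet nbhd_subset fun g hg =>
      applyFun_eq_zero hV nbhd_subset hF one_pos fun x hx => hg x (nbhd_subset hx),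
      vecVariation_eq_baNorm G hV.measurableSet hU.measurableSet nbhd_subset fun g hg =>
      applyFun_eq_zero hV nbhd_subset hG one_pos fun x hx => hg x (nbhd_subset hx)]

/-! ### The general case and the Lebesgue case -/

variable {U K : Set (Euc n)} {δ : ℝ}

lemma ae_norm_le_essSupNear_univ {E : Type*} [NormedAddCommGroup E] {V : Set (Euc n)}
    {φ : Euc n → E} {B : ℝ} (hB : ∀ᵐ x ∂volume.restrict V, ‖φ x‖ ≤ B) :
    ∀ᵐ x ∂volume.restrict V, ‖φ x‖ ≤ essSupNear V univ φ := by
  have h : ∀ k : ℕ, ∀ᵐ x ∂volume.restrict V, ‖φ x‖ ≤ essSupNear V univ φ + 1 / (k + 1) := by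
    intro k
    obtain ⟨r, hr, h⟩ := exists_of_essSupNear_lt (K := univ) hB
      (lt_add_of_pos_right (essSupNear V univ φ) (Nat.one_div_pos_of_nat (n := k)))
    rwa [nbhd_univ hr] at h
  filter_upwards [ae_all_iff.2 h] with x hx
  refine ge_of_tendsto' (x := atTop) ?_ hx
  simpa using (tendsto_one_div_add_atTop_nhds_zero_nat (𝕜 := ℝ)).const_add (essSupNear V univ φ)

/-- One inequality is the Hahn–Banach bound. For the other, `F` and `G` do not see values off `V`,
so their values on functions bounded by `1` on `V` are at most their norms. -/
lemma exists_functionals_general (hU : IsOpen U) (hδ : 0 < δ) (f : StrongDual ℝ (W1Inf U m))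
    (hf : IsTrace K f) :
    ∃ (F : StrongDual ℝ (Lp (Euc m) ⊤ (volume.restrict U)))
      (G : StrongDual ℝ (Lp (EucMat m n) ⊤ (volume.restrict U))),
      Represents K δ f (ofDual F) (ofDual G) ∧ ‖F‖ + ‖G‖ = localNorm K δ f := by
  have hV := isOpen_nbhd (K := K) (δ := δ) hU
  obtain ⟨F, G, h1, h2, h3, h4⟩ := exists_functionals (V := nbhd U K δ) (K := univ) nbhd_subset f
    (localNorm_nonneg hU hδ f hf) fun φ => by
      refine apply_le_localNorm hU hδ f hf φ (le_max_of_le_left (essSupNear_nonneg _ _ _)) ?_ ?_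
      · exact (ae_norm_le_essSupNear_univ (ae_norm_le_of_subset nbhd_subset φ.1.1)).mono
          fun x hx => hx.trans (le_max_left _ _)
      · exact (ae_norm_le_essSupNear_univ (ae_norm_le_of_subset nbhd_subset φ.1.2)).mono
          fun x hx => hx.trans (le_max_right _ _)
  refine ⟨F, G, represents_ofDual hU h1 h3 h4, le_antisymm h2 ?_⟩
  refine localNorm_le hU hδ f hf fun φ hv hg => ?_
  rw [h1 φ]
  have key : ∀ {ι : Type} [Fintype ι]
      (H : StrongDual ℝ (Lp (EuclideanSpace ℝ ι) ⊤ (volume.restrict U)))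
      (p : Lp (EuclideanSpace ℝ ι) ⊤ (volume.restrict U)),
      (∀ y, |H y| ≤ localNorm K δ f * essSupNear (nbhd U K δ) univ y) →
      (∀ᵐ x ∂(volume.restrict (nbhd U K δ)), ‖p x‖ ≤ 1) → H p ≤ ‖H‖ := by
    intro ι _ H p hH hp
    rw [← applyFun_coe H p, ← applyFun_indicator hV nbhd_subset hH one_pos hV.measurableSet
      nbhd_subset (Lp.memLp p)]
    refine (le_abs_self _).trans ((abs_applyFun_le H zero_le_one ?_).trans (mul_one _).le)
    filter_upwards [ae_restrict_of_ae (s := U) ((ae_restrict_iff' hV.measurableSet).1 hp)] with x hx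
    by_cases hxV : x ∈ nbhd U K δ
    · rw [indicator_of_mem hxV]
      exact hx hxV
    · rw [indicator_of_notMem hxV, norm_zero]
      exact zero_le_one
  exact add_le_add (key F φ.1.1 h3 hv) (key G φ.1.2 h4 hg)

/-- The general bound `f(φ) ≤ S_δ ‖φ|_V‖` is combined with `‖φ|_V‖ ≤ C max(‖φ‖_K, ‖Dφ‖_{L^∞(V)})`.
-/
lemma exists_functionals_of_invBoundL (hU : IsOpen U) (hδ : 0 < δ) (f : StrongDual ℝ (W1Inf U m))
    (hf : IsTrace K f) {C : ℝ} (hC : InvBoundL U K δ m C) :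
    ∃ (F : StrongDual ℝ (Lp (Euc m) ⊤ (volume.restrict U)))
      (G : StrongDual ℝ (Lp (EucMat m n) ⊤ (volume.restrict U))),
      (∀ φ, f φ = F φ.1.1 + G φ.1.2) ∧ ‖F‖ + ‖G‖ ≤ C * localNorm K δ f ∧
      (∀ x, |F x| ≤ C * localNorm K δ f * essSupNear (nbhd U K δ) K x) ∧
      ∀ y, |G y| ≤ C * localNorm K δ f * essSupNear (nbhd U K δ) univ y := by
  have hV := isOpen_nbhd (K := K) (δ := δ) hU
  have hS := localNorm_nonneg hU hδ f hf
  refine exists_functionals nbhd_subset f (mul_nonneg hC.1 hS) fun φ => ?_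
  obtain ⟨ψ, h1, h2⟩ := W1Inf.exists_restrict hU (nbhd_subset (K := K) (δ := δ)) φ
  have e1 := apply_le_localNorm hU hδ f hf φ (norm_nonneg ψ)
    (by
      filter_upwards [h1, ae_norm_le_norm ψ.1.1] with x hx hx'
      rw [← hx]
      exact hx'.trans (le_max_left _ _))
    (by
      filter_upwards [h2, ae_norm_le_norm ψ.1.2] with x hx hx'
      rw [← hx]
      exact hx'.trans (le_max_right _ _))
  have e2 := hC.2 ψ
  rw [seminormK_eq_essSupNear, essSupNear_congr h1] at e2
  have e3 : ‖ψ.1.2‖ ≤ essSupNear (nbhd U K δ) univ (grad φ) := by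
    rw [← essSupNear_congr h2]
    exact norm_le_of_ae_le (essSupNear_nonneg _ _ _)
      (ae_norm_le_essSupNear_univ (ae_norm_le_norm ψ.1.2))
  calc f φ ≤ localNorm K δ f * ‖ψ‖ := e1
    _ ≤ localNorm K δ f * (C * max (essSupNear (nbhd U K δ) K (val φ))
          (essSupNear (nbhd U K δ) univ (grad φ))) := by
        refine mul_le_mul_of_nonneg_left (e2.trans ?_) hS
        exact mul_le_mul_of_nonneg_left (max_le_max le_rfl e3) hC.1
    _ = _ := by ring

/-- The admissible constants form a closed set bounded below, so the infimum is itself admissible.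
-/
lemma invBoundL_invNormL (h : CaseL U K δ m) : InvBoundL U K δ m (invNormL U K δ m) := by
  refine IsClosed.csInf_mem (s := {C | InvBoundL U K δ m C}) ?_ h ⟨0, fun C hC => hC.1⟩
  have : {C | InvBoundL U K δ m C} = {C : ℝ | 0 ≤ C} ∩ ⋂ φ : W1Inf (nbhd U K δ) m,
      {C : ℝ | ‖φ‖ ≤ C * max (seminormK (nbhd U K δ) K (val φ)) ‖φ.1.2‖} := by
    ext C
    simp [InvBoundL]
  rw [this]
  exact isClosed_Ici.inter (isClosed_iInter fun φ =>
    isClosed_le continuous_const (continuous_id.mul continuous_const))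

end Functionals

/-! ### Riesz representation of vector-valued functionals -/

section Riesz

open scoped NNReal BoundedContinuousFunction CompactlySupported

variable {X E : Type*} [TopologicalSpace X]
  [NormedAddCommGroup E] [InnerProductSpace ℝ E]
  (L : StrongDual ℝ (X →ᵇ E))

/-- The values of `L` on the functions dominated by `g`. -/
def dominatedValues (g : X → ℝ≥0) : Set ℝ := {r | ∃ ψ : X →ᵇ E, (∀ x, ‖ψ x‖ ≤ g x) ∧ r = L ψ}

lemma zero_mem_dominatedValues (g : X → ℝ≥0) : (0 : ℝ) ∈ dominatedValues L g :=
  ⟨0, fun x => by simp, by simp⟩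

lemma le_of_mem_dominatedValues {g : X → ℝ≥0} {M : ℝ} (hM : 0 ≤ M) (hg : ∀ x, (g x : ℝ) ≤ M)
    {r : ℝ} (hr : r ∈ dominatedValues L g) : r ≤ ‖L‖ * M := by
  obtain ⟨ψ, hψ, rfl⟩ := hr
  refine (le_abs_self _).trans ((L.le_opNorm ψ).trans ?_)
  exact mul_le_mul_of_nonneg_left ((BoundedContinuousFunction.norm_le hM).2 fun x =>
    (hψ x).trans (hg x)) (norm_nonneg L)

lemma exists_bound_nnreal (g : C_c(X, ℝ≥0)) : ∃ M : ℝ, 0 ≤ M ∧ ∀ x, (g x : ℝ) ≤ M := by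
  rcases isEmpty_or_nonempty X with h | ⟨⟨x0⟩⟩
  · exact ⟨0, le_rfl, fun x => isEmptyElim x⟩
  obtain ⟨C, hC⟩ := (g.hasCompactSupport.comp_left (g := ((↑) : ℝ≥0 → ℝ))
    NNReal.coe_zero).exists_bound_of_continuous (NNReal.continuous_coe.comp g.continuous)
  exact ⟨C, (norm_nonneg _).trans (hC x0), fun x => (le_abs_self _).trans (hC x)⟩

lemma bddAbove_dominatedValues (g : C_c(X, ℝ≥0)) : BddAbove (dominatedValues L g) := by
  obtain ⟨M, hM, hg⟩ := exists_bound_nnreal g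
  exact ⟨_, fun r hr => le_of_mem_dominatedValues L hM hg hr⟩

/-- The supremum of `L ψ` over `|ψ| ≤ g`. -/
def absFun (g : X → ℝ≥0) : ℝ := sSup (dominatedValues L g)

lemma absFun_nonneg (g : C_c(X, ℝ≥0)) : 0 ≤ absFun L g :=
  le_csSup (bddAbove_dominatedValues L g) (zero_mem_dominatedValues L g)

lemma le_absFun (g : C_c(X, ℝ≥0)) {ψ : X →ᵇ E} (h : ∀ x, ‖ψ x‖ ≤ g x) : L ψ ≤ absFun L g :=
  le_csSup (bddAbove_dominatedValues L g) ⟨ψ, h, rfl⟩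

lemma absFun_le {g : X → ℝ≥0} {C : ℝ} (h : ∀ ψ : X →ᵇ E, (∀ x, ‖ψ x‖ ≤ g x) → L ψ ≤ C) :
    absFun L g ≤ C := by
  refine csSup_le ⟨0, zero_mem_dominatedValues L g⟩ ?_
  rintro r ⟨ψ, hψ, rfl⟩
  exact h ψ hψ

/-- Multiplication of a bounded continuous function by a continuous function with values in
`[0, 1]`. -/
def cutMul (c : X → ℝ) (hc : Continuous c) (h : ∀ x, |c x| ≤ 1) (ψ : X →ᵇ E) : X →ᵇ E :=
  BoundedContinuousFunction.ofNormedAddCommGroup (fun x => c x • ψ x) (hc.smul ψ.continuous) ‖ψ‖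
    fun x => by
      rw [norm_smul]
      exact (mul_le_of_le_one_left (norm_nonneg _) (h x)).trans (ψ.norm_coe_le_norm x)

lemma cutMul_apply (c : X → ℝ) (hc : Continuous c) (h : ∀ x, |c x| ≤ 1) (ψ : X →ᵇ E) (x : X) :
    cutMul c hc h ψ x = c x • ψ x := rfl

/-- Sums of dominated functions give `≥`. For `≤`, a function dominated by `g₁ + g₂` is split in
proportion to `g₁` and `g₂`. -/
lemma absFun_add (g₁ g₂ : C_c(X, ℝ≥0)) :
    absFun L (g₁ + g₂ : C_c(X, ℝ≥0)) = absFun L g₁ + absFun L g₂ := by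
  refine le_antisymm (absFun_le L fun ψ hψ => ?_) ?_
  · refine le_of_forall_pos_le_add fun η hη => ?_
    set ε : ℝ := η / (‖L‖ + 1)
    have hL : 0 < ‖L‖ + 1 := by positivity
    have hε : 0 < ε := div_pos hη hL
    have hψ' : ∀ x, ‖ψ x‖ ≤ (g₁ x : ℝ) + g₂ x := fun x => by simpa using hψ x
    have hden : ∀ x, 0 < (g₁ x : ℝ) + g₂ x + ε := fun x => by positivity
    have c1 : Continuous fun x => (g₁ x : ℝ) := NNReal.continuous_coe.comp g₁.continuous
    have c2 : Continuous fun x => (g₂ x : ℝ) := NNReal.continuous_coe.comp g₂.continuous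
    have cd := (c1.add c2).add (continuous_const (y := ε))
    have aux : ∀ (g : X → ℝ) (x : X), 0 ≤ g x → g x ≤ (g₁ x : ℝ) + g₂ x + ε →
        |g x / ((g₁ x : ℝ) + g₂ x + ε)| ≤ 1 := fun g x h1 h2 => by
      rw [abs_of_nonneg (div_nonneg h1 (hden x).le), div_le_one (hden x)]
      exact h2
    have dom : ∀ (g : X → ℝ) (x : X), 0 ≤ g x →
        ‖(g x / ((g₁ x : ℝ) + g₂ x + ε)) • ψ x‖ ≤ g x := fun g x h1 => by
      rw [norm_smul, Real.norm_of_nonneg (div_nonneg h1 (hden x).le), div_mul_eq_mul_div,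
        div_le_iff₀ (hden x)]
      exact mul_le_mul_of_nonneg_left (by linarith [hψ' x]) h1
    -- The weights are `gᵢ / (g₁ + g₂ + ε)`. The added `ε` keeps them continuous where both
    -- functions vanish, and leaves a remainder `ψ₃` of norm at most `ε`.
    let ψ₁ := cutMul _ (c1.div cd fun x => (hden x).ne')
      (fun x => aux (fun x => g₁ x) x (by positivity) (by linarith [(g₂ x).coe_nonneg])) ψ
    let ψ₂ := cutMul _ (c2.div cd fun x => (hden x).ne')
      (fun x => aux (fun x => g₂ x) x (by positivity) (by linarith [(g₁ x).coe_nonneg])) ψ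
    let ψ₃ := cutMul _ ((continuous_const (y := ε)).div cd fun x => (hden x).ne')
      (fun x => aux (fun _ => ε) x hε.le
        (by linarith [(g₁ x).coe_nonneg, (g₂ x).coe_nonneg])) ψ
    have e : ψ = ψ₁ + ψ₂ + ψ₃ := by
      ext x
      change ψ x = ((g₁ x : ℝ) / (g₁ x + g₂ x + ε)) • ψ x + ((g₂ x : ℝ) / (g₁ x + g₂ x + ε)) • ψ x
        + (ε / (g₁ x + g₂ x + ε)) • ψ x
      rw [← add_smul, ← add_smul, ← add_div, ← add_div, div_self (hden x).ne', one_smul]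
    have h1 : L ψ₁ ≤ absFun L g₁ := le_absFun L g₁ fun x => dom (fun x => g₁ x) x (by positivity)
    have h2 : L ψ₂ ≤ absFun L g₂ := le_absFun L g₂ fun x => dom (fun x => g₂ x) x (by positivity)
    have h3 : L ψ₃ ≤ ‖L‖ * ε := by
      refine (le_abs_self _).trans ((L.le_opNorm ψ₃).trans ?_)
      exact mul_le_mul_of_nonneg_left ((BoundedContinuousFunction.norm_le hε.le).2 fun x =>
        dom (fun _ => ε) x hε.le) (norm_nonneg L)
    have h4 : ‖L‖ * ε ≤ η := by
      have : (‖L‖ + 1) * ε = η := mul_div_cancel₀ η hL.ne'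
      linarith
    rw [e, map_add, map_add]
    linarith
  · have h1 : ∀ ψ₂ : X →ᵇ E, (∀ x, ‖ψ₂ x‖ ≤ g₂ x) →
        L ψ₂ ≤ absFun L (g₁ + g₂ : C_c(X, ℝ≥0)) - absFun L g₁ := fun ψ₂ h₂ => by
      have : absFun L g₁ ≤ absFun L (g₁ + g₂ : C_c(X, ℝ≥0)) - L ψ₂ := absFun_le L fun ψ₁ h₁ => by
        have := le_absFun L (g₁ + g₂) (ψ := ψ₁ + ψ₂) fun x => by
          simpa using (norm_add_le _ _).trans (add_le_add (h₁ x) (h₂ x))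
        rw [map_add] at this
        linarith
      linarith
    have := absFun_le L h1
    linarith

lemma absFun_smul_le (c : ℝ≥0) (g : C_c(X, ℝ≥0)) :
    c * absFun L g ≤ absFun L (c • g : C_c(X, ℝ≥0)) := by
  rcases eq_or_ne c 0 with rfl | hc
  · rw [NNReal.coe_zero, zero_mul]
    exact absFun_nonneg L _
  have hc' : (0 : ℝ) < c := by positivity
  rw [← le_div_iff₀' hc']
  refine absFun_le L fun ψ hψ => ?_
  rw [le_div_iff₀' hc']
  have := le_absFun L (c • g) (ψ := (c : ℝ) • ψ) fun x => by
    simpa [norm_smul] using mul_le_mul_of_nonneg_left (hψ x) hc'.le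
  rwa [map_smul, smul_eq_mul] at this

lemma absFun_smul (c : ℝ≥0) (g : C_c(X, ℝ≥0)) :
    absFun L (c • g : C_c(X, ℝ≥0)) = c * absFun L g := by
  refine le_antisymm ?_ (absFun_smul_le L c g)
  rcases eq_or_ne c 0 with rfl | hc
  · rw [NNReal.coe_zero, zero_mul]
    refine absFun_le L fun ψ hψ => ?_
    have : ψ = 0 := by
      ext x
      simpa using hψ x
    rw [this, map_zero]
  · have h := absFun_smul_le L c⁻¹ (c • g)
    rw [smul_smul, inv_mul_cancel₀ hc, one_smul] at h
    have hc' : (0 : ℝ) < c := by positivity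
    rwa [NNReal.coe_inv, inv_mul_le_iff₀ hc'] at h

/-- The total variation of `L`, as a positive functional. -/
def absFunctional : C_c(X, ℝ≥0) →ₗ[ℝ≥0] ℝ≥0 where
  toFun g := ⟨absFun L g, absFun_nonneg L g⟩
  map_add' g₁ g₂ := NNReal.eq (absFun_add L g₁ g₂)
  map_smul' c g := NNReal.eq (absFun_smul L c g)

variable [T2Space X] [LocallyCompactSpace X]

lemma exists_nnreal_cutoff {C O : Set X} (hC : IsCompact C) (hO : IsOpen O) (hCO : C ⊆ O) :
    ∃ g : C_c(X, ℝ≥0), (∀ x ∈ C, g x = 1) ∧ (∀ x ∉ O, g x = 0) ∧ ∀ x, g x ≤ 1 := by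
  obtain ⟨f, h1, h2, h3, h4⟩ := exists_continuous_one_zero_of_isCompact hC hO.isClosed_compl
    (disjoint_compl_right_iff_subset.2 hCO)
  refine ⟨CompactlySupportedContinuousMap.nnrealPart ⟨f, h3⟩, fun x hx => ?_, fun x hx => ?_,
    fun x => ?_⟩
  · have : f x = 1 := h1 hx
    simp [CompactlySupportedContinuousMap.nnrealPart_apply, this]
  · have : f x = 0 := h2 hx
    simp [CompactlySupportedContinuousMap.nnrealPart_apply, this]
  · have : f x ≤ 1 := (h4 x).2
    simpa [CompactlySupportedContinuousMap.nnrealPart_apply] using this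

variable [MeasurableSpace X] [BorelSpace X]

/-- The measure which represents the total variation of `L`. -/
def absMeasure : Measure X := NNRealRMK.rieszMeasure (absFunctional L)

instance : (absMeasure L).Regular := by
  unfold absMeasure
  infer_instance

lemma integral_absMeasure (g : C_c(X, ℝ≥0)) : ∫ x, (g x : ℝ) ∂(absMeasure L) = absFun L g :=
  NNRealRMK.integral_rieszMeasure (absFunctional L) g

lemma lintegral_absMeasure (g : C_c(X, ℝ≥0)) :
    ∫⁻ x, g x ∂(absMeasure L) = ENNReal.ofReal (absFun L g) := by
  refine (NNRealRMK.lintegral_rieszMeasure (absFunctional L) g).trans ?_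
  rw [ENNReal.ofReal, Real.toNNReal_of_nonneg (absFun_nonneg L g)]
  rfl

/-- Inner regularity reduces to compact subsets, whose measures are bounded by integrals of cutoffs
supported in `O`. -/
lemma absMeasure_open_le {O : Set X} (hO : IsOpen O) {c : ℝ}
    (h : ∀ g : C_c(X, ℝ≥0), (∀ x ∉ O, g x = 0) → (∀ x, g x ≤ 1) → absFun L g ≤ c) :
    absMeasure L O ≤ ENNReal.ofReal c := by
  rw [hO.measure_eq_iSup_isCompact]
  refine iSup_le fun C => iSup_le fun hCO => iSup_le fun hC => ?_
  obtain ⟨g, h1, h2, h3⟩ := exists_nnreal_cutoff hC hO hCO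
  calc absMeasure L C = ∫⁻ x in C, 1 ∂(absMeasure L) := by simp
    _ ≤ ∫⁻ x in C, g x ∂(absMeasure L) := by
        refine setLIntegral_mono' hC.measurableSet fun x hx => ?_
        simp [h1 x hx]
    _ ≤ ∫⁻ x, g x ∂(absMeasure L) := setLIntegral_le_lintegral _ _
    _ = ENNReal.ofReal (absFun L g) := lintegral_absMeasure L g
    _ ≤ _ := ENNReal.ofReal_le_ofReal (h g h2 h3)

lemma absMeasure_univ_le : absMeasure L univ ≤ ENNReal.ofReal ‖L‖ :=
  absMeasure_open_le L isOpen_univ fun g _ hg => absFun_le L fun ψ hψ => by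
    have := le_of_mem_dominatedValues L (g := g) zero_le_one (fun x => by exact_mod_cast hg x)
      ⟨ψ, hψ, rfl⟩
    simpa using this

instance : IsFiniteMeasure (absMeasure L) :=
  ⟨(absMeasure_univ_le L).trans_lt ENNReal.ofReal_lt_top⟩

variable {L} {K : Set X}

/-- A cutoff vanishing on `K` dominates only functions that vanish on `K`, and these are annihilated
by `L`. -/
lemma absMeasure_compl (hK : IsClosed K) (hL : ∀ ψ : X →ᵇ E, (∀ x ∈ K, ψ x = 0) → L ψ = 0) :
    absMeasure L Kᶜ = 0 := by
  refine le_antisymm ((absMeasure_open_le L hK.isOpen_compl (c := 0) fun g hg _ =>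
    absFun_le L fun ψ hψ => (hL ψ fun x hx => ?_).le).trans_eq ENNReal.ofReal_zero) bot_le
  have := hψ x
  rw [hg x (by simpa using hx)] at this
  simpa using this

lemma abs_le_integral_absMeasure (hK : IsCompact K)
    (hL : ∀ ψ : X →ᵇ E, (∀ x ∈ K, ψ x = 0) → L ψ = 0) (ψ : X →ᵇ E) :
    |L ψ| ≤ ∫ x, ‖ψ x‖ ∂(absMeasure L) := by
  have key : ∀ ψ : X →ᵇ E, L ψ ≤ ∫ x, ‖ψ x‖ ∂(absMeasure L) := by
    intro ψ
    -- The function `‖ψ‖` need not have compact support; the cutoff equals `1` on `K`, so `L` does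
    -- not notice it.
    obtain ⟨c, h1, -, h3⟩ := exists_nnreal_cutoff hK isOpen_univ (subset_univ K)
    have h3' : ∀ x, |(c x : ℝ)| ≤ 1 := fun x => by
      rw [abs_of_nonneg (c x).coe_nonneg]
      exact_mod_cast h3 x
    let ψ' := cutMul (fun x => (c x : ℝ)) (NNReal.continuous_coe.comp c.continuous) h3' ψ
    have e : L ψ = L ψ' := by
      rw [← sub_eq_zero, ← map_sub]
      refine hL _ fun x hx => ?_
      change ψ x - (c x : ℝ) • ψ x = 0
      rw [h1 x hx, NNReal.coe_one, one_smul, sub_self]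
    let g : C_c(X, ℝ≥0) := ⟨⟨fun x => c x * ‖ψ x‖₊, c.continuous.mul ψ.continuous.nnnorm⟩,
      c.hasCompactSupport.mul_right⟩
    have hg : ∀ x, (g x : ℝ) = c x * ‖ψ x‖ := fun x => rfl
    rw [e]
    refine (le_absFun L g fun x => ?_).trans ?_
    · rw [hg, cutMul_apply, norm_smul, Real.norm_of_nonneg (c x).coe_nonneg]
    · rw [← integral_absMeasure]
      refine integral_mono ?_ ?_ fun x => ?_
      · exact (NNReal.continuous_coe.comp g.continuous).integrable_of_hasCompactSupport
          (g.hasCompactSupport.comp_left NNReal.coe_zero)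
      · exact Integrable.of_bound ψ.continuous.norm.aestronglyMeasurable ‖ψ‖
          (Eventually.of_forall fun x => by simpa using ψ.norm_coe_le_norm x)
      · rw [hg]
        exact mul_le_of_le_one_left (norm_nonneg _) (by exact_mod_cast h3 x)
  refine abs_le'.2 ⟨key ψ, ?_⟩
  have := key (-ψ)
  simpa using this

end Riesz

lemma integral_norm_le_mul_norm {X E : Type*} [MeasurableSpace X] [NormedAddCommGroup E]
    {ρ : Measure X} [IsFiniteMeasure ρ] :
    ∃ C : ℝ, 0 ≤ C ∧ ∀ u : Lp E 2 ρ, ∫ x, ‖u x‖ ∂ρ ≤ C * ‖u‖ := by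
  refine ⟨(ρ univ ^ (1 / (1 : ℝ≥0∞).toReal - 1 / (2 : ℝ≥0∞).toReal)).toReal,
    ENNReal.toReal_nonneg, fun u => ?_⟩
  have h := eLpNorm_le_eLpNorm_mul_rpow_measure_univ (p := 1) (q := 2) (by norm_num)
    (Lp.memLp u).1
  have hfin : ρ univ ^ (1 / (1 : ℝ≥0∞).toReal - 1 / (2 : ℝ≥0∞).toReal) ≠ ⊤ :=
    ENNReal.rpow_ne_top_of_nonneg (by norm_num) (measure_ne_top _ _)
  rw [integral_norm_eq_lintegral_enorm (Lp.memLp u).1, ← eLpNorm_one_eq_lintegral_enorm,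
    Lp.norm_def, ← ENNReal.toReal_mul, mul_comm]
  exact ENNReal.toReal_mono (ENNReal.mul_ne_top (Lp.memLp u).2.ne hfin) h

/-! ### The density of a functional with respect to its total variation -/

section RieszDensity

open scoped BoundedContinuousFunction

variable {X E : Type*} [TopologicalSpace X] [T2Space X] [LocallyCompactSpace X]
  [SecondCountableTopology X] [MeasurableSpace X] [BorelSpace X]
  [NormedAddCommGroup E] [InnerProductSpace ℝ E] [CompleteSpace E]

/-- A functional on bounded continuous functions which is supported on a compact set `K` is given
by a finite vector measure `h ρ` on `K`, whose total variation is at most the norm of the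
functional. -/
theorem exists_density (L : StrongDual ℝ (X →ᵇ E)) {K : Set X} (hK : IsCompact K)
    (hL : ∀ ψ : X →ᵇ E, (∀ x ∈ K, ψ x = 0) → L ψ = 0) :
    ∃ (ρ : Measure X) (_ : IsFiniteMeasure ρ) (h : X → E), Integrable h ρ ∧ ρ Kᶜ = 0 ∧
      ∫ x, ‖h x‖ ∂ρ ≤ ‖L‖ ∧ ∀ ψ : X →ᵇ E, L ψ = ∫ x, inner ℝ (ψ x) (h x) ∂ρ := by
  let ρ := absMeasure L
  obtain ⟨C, hC0, hC⟩ := integral_norm_le_mul_norm (E := E) (ρ := ρ)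
  let e : (X →ᵇ E) →L[ℝ] Lp E 2 ρ := BoundedContinuousFunction.toLp 2 ρ ℝ
  have he : ∀ ψ, e ψ =ᵐ[ρ] ψ := fun ψ => BoundedContinuousFunction.coeFn_toLp 2 ρ ℝ ψ
  have hdense : DenseRange e :=
    BoundedContinuousFunction.toLp_denseRange E ρ ℝ (by norm_num : (2 : ℝ≥0∞) ≠ ⊤)
  have hLe : ∀ ψ, |L ψ| ≤ ∫ x, ‖e ψ x‖ ∂ρ := fun ψ => by
    refine (abs_le_integral_absMeasure hK hL ψ).trans_eq (integral_congr_ae ?_)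
    filter_upwards [he ψ] with x hx
    rw [hx]
  have hbound : ∀ ψ, ‖L.toLinearMap ψ‖ ≤ C * ‖e.toLinearMap ψ‖ := fun ψ =>
    (hLe ψ).trans (hC _)
  -- As `|L ψ|` is bounded by the `L¹` norm, hence by the `L²` norm, `L` extends from the dense
  -- image of the continuous functions to `L²(ρ)`, where the Fréchet–Riesz theorem supplies the
  -- density `h`.
  let T : StrongDual ℝ (Lp E 2 ρ) := L.toLinearMap.extendOfNorm e.toLinearMap
  have hT : ∀ ψ, T (e ψ) = L ψ := fun ψ =>
    LinearMap.extendOfNorm_eq (f := L.toLinearMap) (e := e.toLinearMap) hdense ⟨C, hbound⟩ ψ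
  have hTu : ∀ u : Lp E 2 ρ, |T u| ≤ ∫ x, ‖u x‖ ∂ρ := by
    have hlip : LipschitzWith ⟨C, hC0⟩ fun u : Lp E 2 ρ => ∫ x, ‖u x‖ ∂ρ := by
      refine LipschitzWith.of_le_add_mul _ fun u v => ?_
      rw [dist_eq_norm]
      refine le_trans ?_ (add_le_add_right (hC (u - v)) _)
      have iu : ∀ w : Lp E 2 ρ, Integrable (fun x => ‖w x‖) ρ := fun w =>
        ((Lp.memLp w).integrable (by norm_num)).norm
      rw [← integral_add (iu v) (iu (u - v))]
      refine integral_mono_ae (iu u) ((iu v).add (iu (u - v))) ?_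
      filter_upwards [Lp.coeFn_sub u v] with x hx
      rw [hx, Pi.sub_apply]
      exact norm_le_insert' (u x) (v x)
    refine fun u => hdense.induction_on u (isClosed_le (by fun_prop) hlip.continuous) fun ψ => ?_
    rw [hT]
    exact hLe ψ
  let h : Lp E 2 ρ := (InnerProductSpace.toDual ℝ _).symm T
  have hh : ∀ u : Lp E 2 ρ, T u = ∫ x, inner ℝ (h x) (u x) ∂ρ := fun u => by
    rw [← L2.inner_def]
    exact (InnerProductSpace.toDual_symm_apply).symm
  refine ⟨ρ, inferInstance, h, (Lp.memLp h).integrable (by norm_num),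
    absMeasure_compl hK.isClosed hL,
    ?_, fun ψ => ?_⟩
  · have hm : MemLp (fun x => ‖h x‖⁻¹ • h x) 2 ρ := by
      refine MemLp.of_bound ((Lp.memLp h).1.norm.inv₀.smul (Lp.memLp h).1) 1
        (Eventually.of_forall fun x => ?_)
      rw [norm_smul, norm_inv, norm_norm]
      exact inv_mul_le_one
    have e1 : T hm.toLp = ∫ x, ‖h x‖ ∂ρ := by
      rw [hh]
      refine integral_congr_ae ?_
      filter_upwards [hm.coeFn_toLp] with x hx
      rw [hx, inner_smul_right, real_inner_self_eq_norm_sq]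
      rcases eq_or_ne ‖h x‖ 0 with h0 | h0
      · simp [h0]
      · field_simp
    have e2 : ∫ x, ‖hm.toLp _ x‖ ∂ρ ≤ ∫ x, (1 : ℝ) ∂ρ := by
      refine integral_mono_ae ((Lp.memLp hm.toLp).integrable (by norm_num)).norm
        (integrable_const 1) ?_
      filter_upwards [hm.coeFn_toLp] with x hx
      rw [hx, norm_smul, norm_inv, norm_norm]
      exact inv_mul_le_one
    have e3 : ∫ x, (1 : ℝ) ∂ρ ≤ ‖L‖ := by
      rw [integral_const, smul_eq_mul, mul_one]
      exact ENNReal.toReal_le_of_le_ofReal (norm_nonneg L) (absMeasure_univ_le L)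
    rw [← e1]
    exact (le_abs_self _).trans ((hTu _).trans (e2.trans e3))
  · rw [← hT, hh]
    refine integral_congr_ae ?_
    filter_upwards [he ψ] with x hx
    rw [hx, real_inner_comm]

end RieszDensity

lemma integrable_inner_of_bound {X E : Type*} [MeasurableSpace X] [NormedAddCommGroup E]
    [InnerProductSpace ℝ E] {ρ : Measure X} {h : X → E} (hh : Integrable h ρ)
    {g : X → E} (hg : StronglyMeasurable g) {C : ℝ} (hC : ∀ x, ‖g x‖ ≤ C) :
    Integrable (fun x => inner ℝ (g x) (h x)) ρ := by
  refine (hh.norm.const_mul C).mono' (hg.aestronglyMeasurable.inner hh.1)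
    (Eventually.of_forall fun x => ?_)
  exact (norm_inner_le_norm _ _).trans (mul_le_mul_of_nonneg_right (hC x) (norm_nonneg _))

/-! ### Integration against the vector measure with density `h` -/

section VectorIntegral

variable {X E : Type*} [MeasurableSpace X] [NormedAddCommGroup E] [InnerProductSpace ℝ E]
  [CompleteSpace E] {ρ : Measure X} {h : X → E}

lemma isFiniteMeasure_variation_withDensityᵥ (hh : Integrable h ρ) :
    IsFiniteMeasure (ρ.withDensityᵥ h).variation := by
  rw [Measure.variation_withDensityᵥ hh]
  exact ⟨by simpa using! hh.2⟩

lemma integral_withDensityᵥ_simpleFunc (hh : Integrable h ρ) (s : SimpleFunc X E) :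
    (ρ.withDensityᵥ h).integral s (innerSL ℝ) = ∫ x, inner ℝ (s x) (h x) ∂ρ := by
  have := isFiniteMeasure_variation_withDensityᵥ hh
  induction s using SimpleFunc.induction with
  | @const c A hA =>
    have e1 : (SimpleFunc.piecewise A hA (SimpleFunc.const X c) (SimpleFunc.const X 0) : X → E) =
        A.indicator fun _ => c := by
      funext x
      by_cases hx : x ∈ A <;> simp [hx]
    rw [e1, VectorMeasure.integral_indicator hA]
    have hfin : IsFiniteMeasure ((ρ.withDensityᵥ h).restrict A).variation := by
      rw [VectorMeasure.variation_restrict hA]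
      infer_instance
    rw [VectorMeasure.integral_const, VectorMeasure.restrict_apply _ hA MeasurableSet.univ,
      univ_inter, withDensityᵥ_apply hh hA, innerSL_apply_apply, ← integral_inner hh.restrict,
      ← integral_indicator hA]
    congr 1
    funext x
    by_cases hx : x ∈ A <;> simp [hx]
  | @add f g hd hf hg =>
    have hb : ∀ s : SimpleFunc X E, ∃ C, ∀ x, ‖s x‖ ≤ C := fun s => s.exists_forall_norm_le
    have hi : ∀ s : SimpleFunc X E, (ρ.withDensityᵥ h).Integrable s := fun s => by
      obtain ⟨C, hC⟩ := hb s
      exact Integrable.of_bound s.aestronglyMeasurable C (Eventually.of_forall hC)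
    obtain ⟨C, hC⟩ := hb f
    obtain ⟨D, hD⟩ := hb g
    rw [SimpleFunc.coe_add, VectorMeasure.integral_add (hi f) (hi g), hf, hg,
      ← integral_add (integrable_inner_of_bound hh f.stronglyMeasurable hC)
        (integrable_inner_of_bound hh g.stronglyMeasurable hD)]
    congr 1
    funext x
    rw [Pi.add_apply, inner_add_left]

/-- The identity holds for simple functions, and both sides are continuous under uniform convergence
because the variation and `∫ ‖h‖` are finite. -/
lemma integral_withDensityᵥ [ProperSpace E] [MeasurableSpace E] [BorelSpace E]
    (hh : Integrable h ρ) {g : X → E} (hg : StronglyMeasurable g) {C : ℝ} (hC : ∀ x, ‖g x‖ ≤ C) :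
    (ρ.withDensityᵥ h).integral g (innerSL ℝ) = ∫ x, inner ℝ (g x) (h x) ∂ρ := by
  have := isFiniteMeasure_variation_withDensityᵥ hh
  set σ := ρ.withDensityᵥ h with hσ
  let B₀ : E →L[ℝ] E →L[ℝ] ℝ := innerSL ℝ
  set D := ‖B₀‖ * σ.variation.real univ + ∫ x, ‖h x‖ ∂ρ
  have hD : 0 ≤ D := add_nonneg (mul_nonneg (norm_nonneg B₀) measureReal_nonneg)
    (integral_nonneg fun x => norm_nonneg _)
  have hgi : σ.Integrable g := Integrable.of_bound hg.aestronglyMeasurable C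
    (Eventually.of_forall hC)
  rw [← sub_eq_zero, ← norm_le_zero_iff]
  refine ge_of_tendsto (f := fun ε : ℝ => ε * D) (x := 𝓝[>] 0) ?_
    (eventually_nhdsWithin_of_forall fun ε hε => ?_)
  · have : Tendsto (fun ε : ℝ => ε * D) (𝓝 0) (𝓝 (0 * D)) := tendsto_id.mul_const D
    rw [zero_mul] at this
    exact this.mono_left nhdsWithin_le_nhds
  obtain ⟨s, hs⟩ := exists_simpleFunc_norm_sub_le hg hC hε
  obtain ⟨B, hB⟩ := s.exists_forall_norm_le
  have hsi : σ.Integrable s := Integrable.of_bound s.aestronglyMeasurable B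
    (Eventually.of_forall hB)
  have e1 : ‖σ.integral g (innerSL ℝ) - σ.integral s (innerSL ℝ)‖ ≤
      ε * ‖B₀‖ * σ.variation.real univ := by
    rw [← VectorMeasure.integral_sub hgi hsi]
    refine VectorMeasure.norm_integral_le_of_norm_le_const (Eventually.of_forall fun x => ?_)
    rw [Pi.sub_apply, norm_sub_rev]
    exact hs x
  have e2 : ‖∫ x, inner ℝ (s x) (h x) ∂ρ - ∫ x, inner ℝ (g x) (h x) ∂ρ‖ ≤ ε * ∫ x, ‖h x‖ ∂ρ := by
    rw [← integral_sub (integrable_inner_of_bound hh s.stronglyMeasurable hB)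
      (integrable_inner_of_bound hh hg hC), ← integral_const_mul]
    refine norm_integral_le_of_norm_le (hh.norm.const_mul ε) (Eventually.of_forall fun x => ?_)
    rw [← inner_sub_left]
    exact (norm_inner_le_norm _ _).trans (mul_le_mul_of_nonneg_right (hs x) (norm_nonneg _))
  rw [integral_withDensityᵥ_simpleFunc hh s] at e1
  calc _ ≤ _ := norm_sub_le_norm_sub_add_norm_sub _ (∫ x, inner ℝ (s x) (h x) ∂ρ) _
    _ ≤ _ := add_le_add e1 e2
    _ = ε * D := by ring

end VectorIntegral

section Continuity

variable {n m : ℕ}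

/-! ### Continuous extensions up to `K` -/

section ContExt

variable {V K : Set (Euc n)} {φ ψ g k : Euc n → Euc m}

lemma IsContExt.congr (h : IsContExt V K φ g) (e : φ =ᵐ[volume.restrict V] ψ) :
    IsContExt V K ψ g := by
  refine ⟨h.1, ?_⟩
  filter_upwards [h.2, e] with x h1 h2
  rw [h1, h2]

lemma IsContExt.sub (h : IsContExt V K φ g) (h' : IsContExt V K ψ k) :
    IsContExt V K (φ - ψ) (g - k) := by
  refine ⟨h.1.sub h'.1, ?_⟩
  filter_upwards [h.2, h'.2] with x h1 h2
  rw [Pi.sub_apply, Pi.sub_apply, h1, h2]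

/-- If `‖g x‖` were larger, then `‖g‖` would exceed an intermediate `c` on a nonempty open part of
`V` near `x`, which has positive measure, against `‖φ‖ ≤ c` almost everywhere there. -/
lemma IsContExt.norm_le_essSupNear (h : IsContExt V K φ g) (hV : IsOpen V) (hKV : K ⊆ closure V)
    {B : ℝ} (hB : ∀ᵐ x ∂volume.restrict V, ‖φ x‖ ≤ B) {x : Euc n} (hx : x ∈ K) :
    ‖g x‖ ≤ essSupNear V K φ := by
  by_contra! hlt
  obtain ⟨c, hc1, hc2⟩ := exists_between hlt
  obtain ⟨r, hr, hrc⟩ := exists_of_essSupNear_lt hB hc1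
  have h1 : {y | c < ‖g y‖} ∈ 𝓝[V ∪ K] x :=
    (h.1 x (Or.inr hx)).norm.eventually (lt_mem_nhds hc2)
  obtain ⟨O, hO, hxO, hOs⟩ := mem_nhdsWithin.1 h1
  have hW : IsOpen (O ∩ Metric.ball x r ∩ V) := (hO.inter Metric.isOpen_ball).inter hV
  have hne : (O ∩ Metric.ball x r ∩ V).Nonempty :=
    mem_closure_iff.1 (hKV hx) _ (hO.inter Metric.isOpen_ball) ⟨hxO, Metric.mem_ball_self hr⟩
  have hsub : O ∩ Metric.ball x r ∩ V ⊆ nbhd V K r := fun y hy =>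
    ⟨Metric.mem_thickening_iff.2 ⟨x, hx, Metric.mem_ball.1 hy.1.2⟩, hy.2⟩
  have hfalse : ∀ᵐ y ∂volume.restrict (O ∩ Metric.ball x r ∩ V), False := by
    filter_upwards [ae_restrict_of_ae_restrict_of_subset hsub hrc,
      ae_restrict_of_ae_restrict_of_subset inter_subset_right h.2,
      ae_restrict_mem hW.measurableSet] with y h1 h2 h3
    have h4 : c < ‖g y‖ := hOs ⟨h3.1.1, Or.inl h3.2⟩
    rw [h2] at h4
    linarith
  have := hW.measure_pos volume hne
  rw [eventually_false_iff_eq_bot, ae_eq_bot, Measure.restrict_eq_zero] at hfalse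
  exact this.ne' hfalse

/-- Continuity makes `g` small in `V` near each point of `K`; compactness gives a uniform
neighbourhood. -/
lemma IsContExt.essSupNear_eq_zero (h : IsContExt V K φ g) (hV : IsOpen V) (hK : IsCompact K)
    (h0 : ∀ x ∈ K, g x = 0) : essSupNear V K φ = 0 := by
  refine le_antisymm (le_of_forall_pos_le_add fun ε hε => ?_) (essSupNear_nonneg _ _ _)
  rw [zero_add]
  have h1 : ∀ x ∈ K, ∃ O, IsOpen O ∧ x ∈ O ∧ O ∩ (V ∪ K) ⊆ {y | ‖g y‖ < ε} := fun x hx => by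
    have : {y | ‖g y‖ < ε} ∈ 𝓝[V ∪ K] x :=
      (h.1 x (Or.inr hx)).norm.eventually (gt_mem_nhds (by
        change ‖g x‖ < ε
        rwa [h0 x hx, norm_zero]))
    obtain ⟨O, hO, hxO, hOs⟩ := mem_nhdsWithin.1 this
    exact ⟨O, hO, hxO, hOs⟩
  choose! O hO hxO hOs using h1
  obtain ⟨r, hr, hrO⟩ := hK.exists_thickening_subset_open
    (isOpen_biUnion fun x hx => hO x hx) (fun x hx => mem_biUnion hx (hxO x hx))
  refine essSupNear_le hr hε.le ?_
  filter_upwards [ae_restrict_of_ae_restrict_of_subset nbhd_subset h.2,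
    ae_restrict_mem (isOpen_nbhd hV).measurableSet] with y h2 h3
  obtain ⟨x, hx, hy⟩ := mem_iUnion₂.1 (hrO h3.1)
  rw [← h2]
  exact le_of_lt (hOs x hx ⟨hy, Or.inl h3.2⟩)

end ContExt

variable {U K : Set (Euc n)} {δ : ℝ}

lemma subset_closure_nbhd (hKU : K ⊆ closure U) (hδ : 0 < δ) : K ⊆ closure (nbhd U K δ) :=
  fun _ hx => Metric.isOpen_thickening.inter_closure
    ⟨Metric.self_subset_thickening hδ K hx, hKU hx⟩

/-- Reduces case (C) to case (L) with the same constant. -/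
lemma InvBoundC.invBoundL (hU : IsOpen U) (hKU : K ⊆ closure U) (hδ : 0 < δ) {C : ℝ}
    (h : InvBoundC U K δ m C)
    (hext : ∀ φ : W1Inf (nbhd U K δ) m, ∃ g, IsContExt (nbhd U K δ) K (val φ) g) :
    InvBoundL U K δ m C := by
  refine ⟨h.1, fun φ => ?_⟩
  obtain ⟨g, hg⟩ := hext φ
  refine (h.2 φ g hg).trans (mul_le_mul_of_nonneg_left (max_le_max ?_ le_rfl) h.1)
  exact Real.iSup_le (fun x => hg.norm_le_essSupNear (isOpen_nbhd hU) (subset_closure_nbhd hKU hδ)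
    (ae_norm_le_norm φ.1.1) x.2) (essSupNear_nonneg _ _ _)

lemma invBoundC_invNormC (h : CaseC U K δ m) : InvBoundC U K δ m (invNormC U K δ m) := by
  refine IsClosed.csInf_mem (s := {C | InvBoundC U K δ m C}) ?_ h.2 ⟨0, fun C hC => hC.1⟩
  have : {C | InvBoundC U K δ m C} = {C : ℝ | 0 ≤ C} ∩ ⋂ (φ : W1Inf (nbhd U K δ) m)
      (g : Euc n → Euc m) (_ : IsContExt (nbhd U K δ) K (val φ) g),
      {C : ℝ | ‖φ‖ ≤ C * max (⨆ x : K, ‖g x‖) ‖φ.1.2‖} := by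
    ext C
    simp [InvBoundC]
  rw [this]
  exact isClosed_Ici.inter (isClosed_iInter fun φ => isClosed_iInter fun g => isClosed_iInter
    fun _ => isClosed_le continuous_const (continuous_id.mul continuous_const))

/-! ### The continuity case -/

open scoped BoundedContinuousFunction

/-- Tietze extension, multiplied by a compactly supported cutoff to make it bounded. -/
lemma exists_boundedContinuous_eqOn {A : Set (Euc n)} (hA : IsCompact A) {g : Euc n → Euc m}
    (hg : ContinuousOn g A) : ∃ ψ : Euc n →ᵇ Euc m, EqOn ψ g A := by
  obtain ⟨f, hf⟩ := ContinuousMap.exists_restrict_eq hA.isClosed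
    ⟨A.domRestrict g, continuousOn_iff_continuous_domRestrict.1 hg⟩
  obtain ⟨c, h1, -, -⟩ := exists_nnreal_cutoff hA isOpen_univ (subset_univ A)
  have hc : Continuous fun x => (c x : ℝ) := NNReal.continuous_coe.comp c.continuous
  have hcs : HasCompactSupport fun x => (c x : ℝ) • f x :=
    HasCompactSupport.smul_right (f := fun x => (c x : ℝ))
      (c.hasCompactSupport.comp_left NNReal.coe_zero)
  obtain ⟨B, hB⟩ := hcs.exists_bound_of_continuous (hc.smul f.continuous)
  refine ⟨BoundedContinuousFunction.ofNormedAddCommGroup _ (hc.smul f.continuous) B hB,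
    fun x hx => ?_⟩
  have h2 : f x = g x := congrArg (fun k : C(A, Euc m) => k ⟨x, hx⟩) hf
  change (c x : ℝ) • f x = g x
  rw [h1 x hx, NNReal.coe_one, one_smul, h2]

lemma memLp_boundedContinuous (ψ : Euc n →ᵇ Euc m) (ν : Measure (Euc n)) : MemLp ψ ⊤ ν :=
  memLp_top_of_bound ψ.continuous.aestronglyMeasurable ‖ψ‖
    (Eventually.of_forall ψ.norm_coe_le_norm)

/-- The class in `L^∞(U)` of a bounded continuous function. -/
def toLinf (U : Set (Euc n)) :
    (Euc n →ᵇ Euc m) →L[ℝ] Lp (Euc m) ⊤ (volume.restrict U : Measure (Euc n)) :=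
  LinearMap.mkContinuous
    { toFun := fun ψ => (memLp_boundedContinuous ψ (volume.restrict U)).toLp
      map_add' := fun _ _ => rfl
      map_smul' := fun _ _ => rfl } 1 fun ψ => by
    rw [one_mul]
    exact norm_toLp_top_le (memLp_boundedContinuous ψ _) (norm_nonneg ψ)
       (Eventually.of_forall ψ.norm_coe_le_norm)

lemma coeFn_toLinf (ψ : Euc n →ᵇ Euc m) : toLinf U ψ =ᵐ[volume.restrict U] ψ :=
  (memLp_boundedContinuous ψ (volume.restrict U)).coeFn_toLp

lemma norm_toLinf_le (ψ : Euc n →ᵇ Euc m) : ‖toLinf U ψ‖ ≤ ‖ψ‖ :=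
  norm_toLp_top_le (memLp_boundedContinuous ψ _) (norm_nonneg ψ)
       (Eventually.of_forall ψ.norm_coe_le_norm)

lemma isContExt_toLinf {V : Set (Euc n)} (hVU : V ⊆ U) (ψ : Euc n →ᵇ Euc m) :
    IsContExt V K (toLinf U ψ) ψ :=
  ⟨ψ.continuous.continuousOn, EventuallyEq.symm
    (ae_restrict_of_ae_restrict_of_subset hVU (coeFn_toLinf ψ))⟩

lemma norm_comp_toLinf_le (F : StrongDual ℝ (Lp (Euc m) ⊤ (volume.restrict U))) :
    ‖F.comp (toLinf U)‖ ≤ ‖F‖ :=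
  ContinuousLinearMap.opNorm_le_bound _ (norm_nonneg F) fun ψ =>
    (F.le_opNorm _).trans (mul_le_mul_of_nonneg_left (norm_toLinf_le ψ) (norm_nonneg F))

/-- A functional supported near `K` depends only on the values on `K` of the continuous
extension. -/
lemma apply_eq_apply_toLinf {V : Set (Euc n)} (hV : IsOpen V) (hVU : V ⊆ U) (hK : IsCompact K)
    {F : StrongDual ℝ (Lp (Euc m) ⊤ (volume.restrict U))} {c : ℝ}
    (hF : ∀ x, |F x| ≤ c * essSupNear V K x) {p : Lp (Euc m) ⊤ (volume.restrict U)}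
    {g : Euc n → Euc m} (hp : IsContExt V K p g) {ψ : Euc n →ᵇ Euc m} (hψ : EqOn ψ g K) :
    F p = F (toLinf U ψ) := by
  rw [← sub_eq_zero, ← map_sub, ← abs_nonpos_iff]
  refine (hF _).trans_eq ?_
  have h1 : IsContExt V K (p - toLinf U ψ : Lp (Euc m) ⊤ (volume.restrict U)) (g - ψ) :=
    (hp.sub (isContExt_toLinf hVU ψ)).congr
      (EventuallyEq.symm (ae_restrict_of_ae_restrict_of_subset hVU (Lp.coeFn_sub p (toLinf U ψ))))
  rw [h1.essSupNear_eq_zero hV hK fun x hx => by rw [Pi.sub_apply, hψ hx, sub_self], mul_zero]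

/-- A finitely additive extension may carry more mass than the Radon measure it induces. `F` is
therefore restricted to continuous functions, where it is dominated by `M ‖·‖_K` with `M` the mass
of the measure, and extended afresh under this domination. -/
lemma exists_radon_functional {V : Set (Euc n)} (hV : IsOpen V) (hVU : V ⊆ U) (hK : IsCompact K)
    (hKV : K ⊆ closure V) {F : StrongDual ℝ (Lp (Euc m) ⊤ (volume.restrict U))} {c : ℝ}
    (hF : ∀ x, |F x| ≤ c * essSupNear V K x) :
    ∃ (F' : StrongDual ℝ (Lp (Euc m) ⊤ (volume.restrict U)))
      (ρ : Measure (Euc n)) (_ : IsFiniteMeasure ρ) (h : Euc n → Euc m),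
      Integrable h ρ ∧ ρ Kᶜ = 0 ∧ ∫ x, ‖h x‖ ∂ρ = ‖F'‖ ∧ ‖F'‖ ≤ ‖F‖ ∧
      (∀ x, |F' x| ≤ ‖F'‖ * essSupNear V K x) ∧
      (∀ ψ, F' (toLinf U ψ) = F (toLinf U ψ)) ∧
      ∀ ψ, F' (toLinf U ψ) = ∫ x, inner ℝ (ψ x) (h x) ∂ρ := by
  obtain ⟨ρ, hρ, h, hh, hρK, hM, hL⟩ := exists_density (F.comp (toLinf U)) hK fun ψ hψ => by
    rw [← abs_nonpos_iff]
    refine (hF (toLinf U ψ)).trans_eq ?_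
    rw [(isContExt_toLinf hVU ψ).essSupNear_eq_zero hV hK hψ, mul_zero]
  set M := ∫ x, ‖h x‖ ∂ρ with hMdef
  have hM0 : 0 ≤ M := integral_nonneg fun x => norm_nonneg _
  have hFM : ∀ ψ, |F (toLinf U ψ)| ≤ M * essSupNear V K (toLinf U ψ) := fun ψ => by
    have h1 : F (toLinf U ψ) = ∫ x, inner ℝ (ψ x) (h x) ∂ρ := hL ψ
    rw [h1, hMdef, ← integral_mul_const, ← Real.norm_eq_abs]
    refine norm_integral_le_of_norm_le (hh.norm.mul_const _) ?_
    have h2 : ∀ᵐ x ∂ρ, x ∉ Kᶜ := measure_eq_zero_iff_ae_notMem.1 hρK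
    filter_upwards [h2] with x hx
    refine (norm_inner_le_norm _ _).trans ?_
    rw [mul_comm]
    refine mul_le_mul_of_nonneg_left ?_ (norm_nonneg _)
    exact (isContExt_toLinf hVU ψ).norm_le_essSupNear hV hKV (ae_norm_le_of_subset hVU _)
      (not_not.1 hx)
  let M' : NNReal := ⟨M, hM0⟩
  let s : Seminorm ℝ (Lp (Euc m) ⊤ (volume.restrict U : Measure (Euc n))) :=
    M' • essSeminorm hVU K
  have hs : ∀ x, s x = M * essSupNear V K x := fun x => rfl
  obtain ⟨G, hG, hGs⟩ := Module.Dual.exists_extension_of_le_seminorm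
    (LinearMap.range (toLinf (m := m) U).toLinearMap)
    (F.toLinearMap.domRestrict (LinearMap.range (toLinf (m := m) U).toLinearMap)) (p := s) (by
      rintro ⟨_, ψ, rfl⟩
      exact hFM ψ)
  let F' : StrongDual ℝ (Lp (Euc m) ⊤ (volume.restrict U)) := G.mkContinuous M fun x =>
    (hGs x).trans (mul_le_mul_of_nonneg_left (essSupNear_le_norm hVU K x) hM0)
  have hF'F : ∀ ψ, F' (toLinf U ψ) = F (toLinf U ψ) := fun ψ => hG ⟨_, ψ, rfl⟩
  have h1 : ‖F'‖ ≤ M := LinearMap.mkContinuous_norm_le _ hM0 _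
  -- The Riesz bound controls `M` by the norm of the functional on continuous functions, on which
  -- `F` and `F'` agree.
  have h2 : M ≤ ‖F'‖ := by
    have e : F.comp (toLinf U) = F'.comp (toLinf U) := by
      ext ψ
      exact (hF'F ψ).symm
    rw [e] at hM
    exact hM.trans (norm_comp_toLinf_le F')
  have h3 : ‖F'‖ = M := le_antisymm h1 h2
  refine ⟨F', ρ, hρ, h, hh, hρK, h3.symm, ?_, fun x => ?_, hF'F, fun ψ => ?_⟩
  · rw [h3]
    exact hM.trans (norm_comp_toLinf_le F)
  · rw [h3]
    exact hGs x
  · rw [hF'F]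
    exact hL ψ

lemma setIntegral_withDensityᵥ {ρ : Measure (Euc n)} {h : Euc n → Euc m} (hh : Integrable h ρ)
    (hK : IsClosed K) (hρK : ρ Kᶜ = 0) {g : Euc n → Euc m} {ψ : Euc n →ᵇ Euc m} (hψ : EqOn ψ g K) :
    ((ρ.withDensityᵥ h).restrict K).integral g (innerSL ℝ) = ∫ x, inner ℝ (ψ x) (h x) ∂ρ := by
  rw [← VectorMeasure.setIntegral_congr_fun hψ, ← VectorMeasure.integral_indicator hK.measurableSet,
    integral_withDensityᵥ hh (ψ.continuous.stronglyMeasurable.indicator hK.measurableSet)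
      (C := ‖ψ‖) fun x => (norm_indicator_le_norm_self _ _).trans (ψ.norm_coe_le_norm x)]
  refine integral_congr_ae ?_
  have h2 : ∀ᵐ x ∂ρ, x ∉ Kᶜ := measure_eq_zero_iff_ae_notMem.1 hρK
  filter_upwards [h2] with x hx
  rw [indicator_of_mem (not_not.1 hx)]

end Continuity

/-! ### Norms and integral formulas for the representing measures -/

section Representation

variable {n m : ℕ} {U K : Set (Euc n)} {δ : ℝ}

lemma baNorm_add_baNorm (hU : IsOpen U) (F : StrongDual ℝ (Lp (Euc m) ⊤ (volume.restrict U)))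
    (G : StrongDual ℝ (Lp (EucMat m n) ⊤ (volume.restrict U))) :
    baNorm (ofDual F) + baNorm (ofDual G) = ENNReal.ofReal (‖F‖ + ‖G‖) := by
  rw [baNorm_ofDual F hU.measurableSet, baNorm_ofDual G hU.measurableSet,
    ← ENNReal.ofReal_add (norm_nonneg F) (norm_nonneg G)]

lemma hasVecIntegral_of_isOpen_superset (hU : IsOpen U) (hK : IsCompact K)
    {F : StrongDual ℝ (Lp (Euc m) ⊤ (volume.restrict U))} {c : ℝ}
    (hF : ∀ x, |F x| ≤ c * essSupNear (nbhd U K δ) K x) {O : Set (Euc n)} (hO : IsOpen O)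
    (hKO : K ⊆ O) (p : Lp (Euc m) ⊤ (volume.restrict U)) :
    HasVecIntegral (ofDual F) (O ∩ U) p (F p) := by
  obtain ⟨r, hr, hrO⟩ := hK.exists_thickening_subset_open hO hKO
  have hA := (hO.inter hU).measurableSet
  have hsub : nbhd (nbhd U K δ) K r ⊆ O ∩ U := fun x hx => ⟨hrO hx.1, hx.2.2⟩
  rw [← applyFun_coe F p]
  exact hasVecIntegral_of_applyFun hU hA (Lp.memLp p)
    (applyFun_indicator (isOpen_nbhd hU) nbhd_subset hF hr hA hsub (Lp.memLp p))

lemma hasVecIntegral_nbhd (hU : IsOpen U) {ι : Type*} [Fintype ι] [DecidableEq ι]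
    {G : StrongDual ℝ (Lp (EuclideanSpace ℝ ι) ⊤ (volume.restrict U))} {c : ℝ}
    (hG : ∀ y, |G y| ≤ c * essSupNear (nbhd U K δ) univ y)
    (p : Lp (EuclideanSpace ℝ ι) ⊤ (volume.restrict U)) :
    HasVecIntegral (ofDual G) (nbhd U K δ) p (G p) := by
  have hV := isOpen_nbhd (K := K) (δ := δ) hU
  rw [← applyFun_coe G p]
  exact hasVecIntegral_of_applyFun hU hV.measurableSet (Lp.memLp p)
    (applyFun_indicator hV nbhd_subset hG one_pos hV.measurableSet nbhd_subset (Lp.memLp p))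

lemma hasVecIntegral_continuousOn (hU : IsOpen U) (hUb : Bornology.IsBounded U)
    (hKU : K ⊆ closure U) (F : StrongDual ℝ (Lp (Euc m) ⊤ (volume.restrict U))) {I : ℝ}
    {g : Euc n → Euc m} (hg : ContinuousOn g (closure U))
    (h : ∀ ψ : BoundedContinuousFunction (Euc n) (Euc m), EqOn ψ g K → F (toLinf U ψ) = I) :
    HasVecIntegral (ofDual F) U g I := by
  obtain ⟨ψ, hψ⟩ := exists_boundedContinuous_eqOn hUb.isCompact_closure hg
  have e : U.indicator g =ᵐ[volume.restrict U] toLinf U ψ := by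
    filter_upwards [coeFn_toLinf (U := U) ψ, ae_restrict_mem hU.measurableSet] with x h1 h2
    rw [h1, indicator_of_mem h2, hψ (subset_closure h2)]
  rw [← h ψ (hψ.mono hKU), ← applyFun_coe F, ← applyFun_congr F e]
  exact hasVecIntegral_ofDual F hU.measurableSet ((memLp_congr_ae e).2 (Lp.memLp _))

end Representation

end TraceRep

end

/-! ### The three cases assembled -/

theorem mainTheorem2 {n m : ℕ} {U K : Set (TraceRep.Euc n)}
    (hU : IsOpen U) (hUb : Bornology.IsBounded U) (hK : IsClosed K) (hKU : K ⊆ closure U)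
    (f : StrongDual ℝ (TraceRep.W1Inf U m)) (hf : TraceRep.IsTrace K f) (δ : ℝ) (hδ : 0 < δ) :
    -- the general case (G), which is always present: equality with constant 1
    (∃ (lam : Fin m → TraceRep.Ba U (volume : Measure (TraceRep.Euc n)))
        (mu : Fin m × Fin n → TraceRep.Ba U (volume : Measure (TraceRep.Euc n))),
      TraceRep.Represents K δ f lam mu ∧
      TraceRep.baNorm lam + TraceRep.baNorm mu = ENNReal.ofReal (TraceRep.localNorm K δ f)) ∧
    -- the Lebesgue case (L), with constant `max 1 ‖ι⁻¹‖`
    (TraceRep.CaseL U K δ m →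
      ∃ (lam : Fin m → TraceRep.Ba U (volume : Measure (TraceRep.Euc n)))
        (mu : Fin m × Fin n → TraceRep.Ba U (volume : Measure (TraceRep.Euc n))),
      TraceRep.Represents K δ f lam mu ∧
      TraceRep.baNorm lam + TraceRep.baNorm mu ≤
        ENNReal.ofReal (max 1 (TraceRep.invNormL U K δ m) * TraceRep.localNorm K δ f) ∧
      TraceRep.core lam ⊆ K ∧
      ∀ O : Set (TraceRep.Euc n), IsOpen O → K ⊆ O → ∀ φ : TraceRep.W1Inf U m, ∃ a b : ℝ,
        TraceRep.HasVecIntegral lam (O ∩ U) (TraceRep.val φ) a ∧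
        TraceRep.HasVecIntegral mu (TraceRep.nbhd U K δ) (TraceRep.grad φ) b ∧ f φ = a + b) ∧
    -- the continuity case (C), with constant `max 1 ‖ι⁻¹‖`
    (TraceRep.CaseC U K δ m →
      ∃ (lam : Fin m → TraceRep.Ba U (volume : Measure (TraceRep.Euc n)))
        (mu : Fin m × Fin n → TraceRep.Ba U (volume : Measure (TraceRep.Euc n)))
        (σ : VectorMeasure (TraceRep.Euc n) (TraceRep.Euc m)),
      TraceRep.Represents K δ f lam mu ∧
      TraceRep.baNorm lam + TraceRep.baNorm mu ≤
        ENNReal.ofReal (max 1 (TraceRep.invNormC U K δ m) * TraceRep.localNorm K δ f) ∧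
      TraceRep.core lam ⊆ K ∧
      -- `lam` corresponds to the Radon measure `σ` supported on `K`
      σ.variation Kᶜ = 0 ∧ σ.variation K = TraceRep.baNorm lam ∧
      (∀ g : TraceRep.Euc n → TraceRep.Euc m, ContinuousOn g (closure U) →
        TraceRep.HasVecIntegral lam U g ((σ.restrict K).integral g (innerSL ℝ))) ∧
      ∀ (φ : TraceRep.W1Inf U m) (g : TraceRep.Euc n → TraceRep.Euc m),
        TraceRep.IsContExt (TraceRep.nbhd U K δ) K (TraceRep.val φ) g →
        ∃ b : ℝ, TraceRep.HasVecIntegral mu (TraceRep.nbhd U K δ) (TraceRep.grad φ) b ∧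
          f φ = (σ.restrict K).integral g (innerSL ℝ) + b) := by
  have hKc : IsCompact K := hUb.isCompact_closure.of_isClosed_subset hK hKU
  have hV := TraceRep.isOpen_nbhd (K := K) (δ := δ) hU
  have hVU := TraceRep.nbhd_subset (U := U) (K := K) (δ := δ)
  have hS := TraceRep.localNorm_nonneg hU hδ f hf
  refine ⟨?_, fun hL => ?_, fun hC => ?_⟩
  · obtain ⟨F, G, hR, hN⟩ := TraceRep.exists_functionals_general hU hδ f hf
    exact ⟨_, _, hR, by rw [TraceRep.baNorm_add_baNorm hU, hN]⟩
  · obtain ⟨F, G, hFG, hN, hF, hG⟩ := TraceRep.exists_functionals_of_invBoundL hU hδ f hf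
      (TraceRep.invBoundL_invNormL hL)
    refine ⟨_, _, TraceRep.represents_ofDual hU hFG hF hG, ?_,
      TraceRep.core_subset hV hK hVU hF, fun O hO hKO φ => ⟨_, _,
        TraceRep.hasVecIntegral_of_isOpen_superset hU hKc hF hO hKO φ.1.1,
        TraceRep.hasVecIntegral_nbhd hU hG φ.1.2, hFG φ⟩⟩
    -- The estimate holds with `‖ι⁻¹‖` itself; taking the maximum with `1` only enlarges the
    -- constant.
    rw [TraceRep.baNorm_add_baNorm hU]
    exact ENNReal.ofReal_le_ofReal
      (hN.trans (mul_le_mul_of_nonneg_right (le_max_right _ _) hS))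
  · obtain ⟨F, G, hFG, hN, hF, hG⟩ := TraceRep.exists_functionals_of_invBoundL hU hδ f hf
      ((TraceRep.invBoundC_invNormC hC).invBoundL hU hKU hδ hC.1)
    obtain ⟨F', ρ, hρ, h, hh, hρK, hhF, hF'F, hF', heq, hint⟩ :=
      TraceRep.exists_radon_functional hV hVU hKc (TraceRep.subset_closure_nbhd hKU hδ) hF
    have hσ : ∀ (g : TraceRep.Euc n → TraceRep.Euc m)
        (ψ : BoundedContinuousFunction (TraceRep.Euc n) (TraceRep.Euc m)), EqOn ψ g K →
        F' (TraceRep.toLinf U ψ) = ((ρ.withDensityᵥ h).restrict K).integral g (innerSL ℝ) :=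
      fun g ψ hψ => by rw [TraceRep.setIntegral_withDensityᵥ hh hK hρK hψ, hint]
    have hF'φ : ∀ (p : Lp (TraceRep.Euc m) ⊤ (volume.restrict U))
        (g : TraceRep.Euc n → TraceRep.Euc m),
        TraceRep.IsContExt (TraceRep.nbhd U K δ) K p g →
        F p = F' p ∧ F' p = ((ρ.withDensityᵥ h).restrict K).integral g (innerSL ℝ) := by
      intro p g hg
      obtain ⟨ψ, hψ⟩ := TraceRep.exists_boundedContinuous_eqOn hKc
        (hg.1.mono subset_union_right)
      have e := TraceRep.apply_eq_apply_toLinf hV hVU hKc hF' hg hψ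
      exact ⟨by rw [TraceRep.apply_eq_apply_toLinf hV hVU hKc hF hg hψ, e, heq],
        e.trans (hσ g ψ hψ)⟩
    -- `F'` may take the place of `F`: restricted to `V`, each `φ` extends continuously to `K`, and
    -- both functionals depend only on the values of this extension on `K`.
    have hF'G : ∀ φ : TraceRep.W1Inf U m, f φ = F' φ.1.1 + G φ.1.2 := fun φ => by
      obtain ⟨φ', h1, -⟩ := TraceRep.W1Inf.exists_restrict hU hVU φ
      obtain ⟨g, hg⟩ := hC.1 φ'
      rw [hFG, (hF'φ φ.1.1 g (hg.congr h1)).1]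
    have hvar := Measure.variation_withDensityᵥ hh
    refine ⟨_, _, ρ.withDensityᵥ h, TraceRep.represents_ofDual hU hF'G hF' hG, ?_,
      TraceRep.core_subset hV hK hVU hF', ?_, ?_, fun g hg =>
        TraceRep.hasVecIntegral_continuousOn hU hUb hKU F' hg (hσ g),
      fun φ g hg => ⟨_, TraceRep.hasVecIntegral_nbhd hU hG φ.1.2, ?_⟩⟩
    · rw [TraceRep.baNorm_add_baNorm hU]
      exact ENNReal.ofReal_le_ofReal ((add_le_add_left hF'F ‖G‖).trans
        (hN.trans (mul_le_mul_of_nonneg_right (le_max_right _ _) hS)))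
    · rw [hvar]
      exact withDensity_absolutelyContinuous _ _ hρK
    -- As `ρ` lives on `K`, `|σ|(K) = ∫ ‖h‖ dρ = ‖F'‖`, the norm of the measure of `F'`.
    · rw [hvar, TraceRep.baNorm_ofDual F' hU.measurableSet, ← hhF,
        withDensity_apply _ hK.measurableSet, ofReal_integral_norm_eq_lintegral_enorm hh,
        Measure.restrict_eq_self_of_ae_mem (measure_eq_zero_iff_ae_notMem.1 hρK |>.mono
          fun x hx => not_not.1 hx)]
    · rw [hF'G, (hF'φ φ.1.1 g hg).2]
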